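/- Let $d\ge 2$ be an integer and $s_{d-1}=2\pi^{d/2}/\Gamma(d/2)$, $\widehat d=\max\{1,d-2\}$. For $t>0$ put $\Bbbk_{d-2}(t)=\ln t$ if $d=2$ and $\Bbbk_{d-2}(t)=-t^{2-d}$ if $d>2$. Let $0<\rho\le+\infty$, let $B(\rho)\subset\mathbb R^d$ be the open ball of radius $\rho$ centred at $0$ ($B(+\infty)=\mathbb R^d$), and let $U=u-v\not\equiv\pm\infty$ be a nontrivial $\delta$-subharmonic function on $B(\rho)$, i.e. $u\not\equiv-\infty$ and $v\not\equiv-\infty$ are subharmonic on $B(\rho)$. Let $\varDelta_u=\frac{1}{s_{d-1}\widehat d}\,\triangle u$ and $\varDelta_v=\frac{1}{s_{d-1}\widehat d}\,\triangle v$ (Laplacian in the sense of distributions) be their Riesz measures, $\varDelta_U=\varDelta_u-\varDelta_v$ the Riesz charge of $U$, and $\varDelta_U^-=\sup\{0,-\varDelta_U\}$ its lower variation. For $0\le r<R<\rho$ define the difference Nevanlinna characteristic $$\boldsymbol T_U(r,R)=\frac{1}{s_{d-1}R^{d-1}}\int_{|x|=R}U^+\,d\sigma+\widehat d\int_r^R\frac{\varDelta_U^-(\{|x|\le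 t\})}{t^{d-1}}\,dt\in[0,+\infty],$$ where $\sigma$ is the surface measure on the sphere $\{|x|=R\}$. A real function $f$ on an open interval $I\subset(0,+\infty)$ is called convex (concave) with respect to $\Bbbk_{d-2}$ if $f\circ\Bbbk_{d-2}^{-1}$ is convex (concave) on $\Bbbk_{d-2}(I)$. Then: 1. $\boldsymbol T_U(r,R)\ge 0$ for all $0\le r<R<\rho$, and $\boldsymbol T_U(r,R)<+\infty$ if $r>0$. 2. For every fixed $r\ge 0$ the function $R\mapsto\boldsymbol T_U(r,R)$ is increasing (non-strictly) on $(r,\rho)$; it is finite and convex with respect to $\Bbbk_{d-2}$ on $(r,\rho)$, except that for $r=0$ it may instead be identically $+\infty$. 3. For every fixed $R\in(0,\rho)$ the function $r\mapsto\boldsymbol T_U(r,R)$ is decreasing (non-strictly) on $[0,R)$ and concave with respect to $\Bbbk_{d-2}$ on $(0,R)$. -/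

import Mathlib

open scoped ENNReal

namespace DiffNevanlinna

noncomputable section

/-- Euclidean space `ℝ^d`. -/
abbrev E (d : ℕ) : Type := EuclideanSpace ℝ (Fin d)

/-- The area `s_{d-1} = 2 π^{d/2} / Γ(d/2)` of the unit sphere of `ℝ^d`. -/
def sphereArea (d : ℕ) : ℝ :=
  2 * Real.pi ^ ((d : ℝ) / 2) / Real.Gamma ((d : ℝ) / 2)

/-- The number `max {1, d - 2}`. -/
def dHat (d : ℕ) : ℝ := max 1 ((d : ℝ) - 2)

/-- The function `𝕜_{d-2}` on `(0, ∞)`: `ln t` for `d = 2` and `-1 / t^{d-2}` for `d > 2`. -/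
def kernel (d : ℕ) (t : ℝ) : ℝ :=
  if d = 2 then Real.log t else -(1 / t ^ (d - 2))

/-- The integral `∫ f⁺ - ∫ f⁻` of an extended-real function
(`EReal.toENNReal` is the positive part). -/
def extIntegral {α : Type*} [MeasurableSpace α] (μ : MeasureTheory.Measure α)
    (f : α → EReal) : EReal :=
  ((∫⁻ x, (f x).toENNReal ∂μ : ℝ≥0∞) : EReal) - ((∫⁻ x, (-f x).toENNReal ∂μ : ℝ≥0∞) : EReal)

/-- The mean of `f` over the sphere of centre `x` and radius `r`, written as an integral over
the unit sphere with its surface measure. -/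
def sphereMean {d : ℕ} (f : E d → EReal) (x : E d) (r : ℝ) : EReal :=
  (((sphereArea d)⁻¹ : ℝ) : EReal) *
    extIntegral (MeasureTheory.volume : MeasureTheory.Measure (E d)).toSphere
      (fun ω => f (x + r • (ω : E d)))

/-- Subharmonic functions, with values in `[-∞, ∞)`, on a set `Ω` (used for open sets `Ω`);
the function `≡ -∞` is allowed. Values outside `Ω` are irrelevant. -/
structure SubharmonicOn {d : ℕ} (u : E d → EReal) (Ω : Set (E d)) : Prop where
  upperSemicontinuousOn : UpperSemicontinuousOn u Ω
  lt_top : ∀ x ∈ Ω, u x < ⊤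
  le_sphereMean : ∀ x ∈ Ω, ∀ r : ℝ, 0 < r → Metric.closedBall x r ⊆ Ω → u x ≤ sphereMean u x r

/-- `μ` is a Borel measure on the open set `Ω` (extended by zero), finite on compact subsets of
`Ω`, which equals `(s_{d-1} max{1, d-2})⁻¹ Δu` in the sense of distributions on `Ω`. -/
structure IsRieszMeasure {d : ℕ} (Ω : Set (E d)) (u : E d → EReal)
    (μ : MeasureTheory.Measure (E d)) : Prop where
  compl_eq_zero : μ Ωᶜ = 0
  lt_top_of_isCompact : ∀ K : Set (E d), IsCompact K → K ⊆ Ω → μ K < ⊤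
  integral_eq : ∀ φ : E d → ℝ, ContDiff ℝ ((⊤ : ℕ∞) : WithTop ℕ∞) φ → HasCompactSupport φ →
    tsupport φ ⊆ Ω →
    ∫ x, (u x).toReal * Laplacian.laplacian φ x = sphereArea d * dHat d * ∫ x, φ x ∂μ

open Classical in
/-- The Riesz measure of `u` on the open set `Ω`, that is, the only measure that satisfies
`IsRieszMeasure Ω u` (it exists for every subharmonic `u ≢ -∞` on a domain `Ω`). -/
def rieszMeasure {d : ℕ} (Ω : Set (E d)) (u : E d → EReal) : MeasureTheory.Measure (E d) :=
  if h : ∃ μ, IsRieszMeasure Ω u μ then h.choose else 0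

/-- A nontrivial (`≢ ±∞`) `δ`-subharmonic function on `Ω`, given as the difference `pos - neg`
of two subharmonic functions `≢ -∞` on `Ω`. -/
structure DeltaSubharmonic {d : ℕ} (Ω : Set (E d)) where
  pos : E d → EReal
  neg : E d → EReal
  subharmonicOn_pos : SubharmonicOn pos Ω
  subharmonicOn_neg : SubharmonicOn neg Ω
  pos_nontrivial : ∃ x ∈ Ω, pos x ≠ ⊥
  neg_nontrivial : ∃ x ∈ Ω, neg x ≠ ⊥

namespace DeltaSubharmonic

variable {d : ℕ} {Ω : Set (E d)}

/-- The values of `U = pos - neg`. At the points where both functions are `-∞` (a polar set)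
the difference is not defined, and the value here is immaterial. -/
def val (U : DeltaSubharmonic Ω) (x : E d) : EReal := U.pos x - U.neg x

/-- The lower variation of the Riesz charge `Δ_U = Δ_pos - Δ_neg`, that is `sup {0, -Δ_U}`.
The difference of measures is Mathlib's: `ν - μ` is the least measure `τ` with `ν ≤ τ + μ`. -/
def lowerVariation (U : DeltaSubharmonic Ω) : MeasureTheory.Measure (E d) :=
  rieszMeasure Ω U.neg - rieszMeasure Ω U.pos

end DeltaSubharmonic

/-- The radial difference integrated counting function
`N_μ(r, R) = max{1, d-2} ∫_r^R μ(closed ball of radius t) / t^{d-1} dt`. -/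
def countingN {d : ℕ} (μ : MeasureTheory.Measure (E d)) (r R : ℝ) : ℝ≥0∞ :=
  ENNReal.ofReal (dHat d) *
    ∫⁻ t in Set.Ioc r R, μ (Metric.closedBall 0 t) / ENNReal.ofReal (t ^ (d - 1))

/-- The difference Nevanlinna characteristic `T_U(r, R) = C_{U⁺}(R) + N_{Δ_U⁻}(r, R)`. -/
def nevanlinnaT {d : ℕ} {Ω : Set (E d)} (U : DeltaSubharmonic Ω) (r R : ℝ) : EReal :=
  sphereMean (fun x => max 0 (U.val x)) 0 R + (countingN U.lowerVariation r R : EReal)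

/-- `f` is convex on `I` with respect to `k`: `f ∘ k⁻¹` is convex on `k(I)`. -/
def ConvexWrt (k : ℝ → ℝ) (I : Set ℝ) (f : ℝ → ℝ) : Prop :=
  ConvexOn ℝ (k '' I) (f ∘ Function.invFunOn k I)

/-- `f` is concave on `I` with respect to `k`: `f ∘ k⁻¹` is concave on `k(I)`. -/
def ConcaveWrt (k : ℝ → ℝ) (I : Set ℝ) (f : ℝ → ℝ) : Prop :=
  ConcaveOn ℝ (k '' I) (f ∘ Function.invFunOn k I)

end

end DiffNevanlinna

namespace DiffNevanlinna

open MeasureTheory Metric Set Filter Topology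
open scoped Laplacian Convolution

noncomputable section

variable {d : ℕ}

/-! Write `u`, `v` for the two subharmonic functions, `μ`, `ν` for their Riesz measures and `τ = ν -
μ` for the lower variation. For a smooth `f` the divergence theorem shows that the spherical
integral `∫ f(tω) dω` has derivative `t^{1-d} ∫_{B(t)} Δf`. If `Δf ≥ -g` with `g ≥ 0`, then the
increment of the spherical integral over `[a, b]`, plus `∫_a^b t^{1-d} ∫_{B(t)} g dt`, equals the
integral of `t^{1-d}` times a nonnegative increasing function of `t` (`sphere_integral_add_eq`).
Such increments are nonnegative, and their averages against the weight `t^{1-d}` grow from one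
interval to the next (`integral_mul_integral_le_of_monotoneOn`). Since the kernel has derivative
`max{1, d-2} t^{1-d}`, this is monotonicity together with convexity with respect to the kernel.

The function `U⁺` is not smooth, so `u` and `v` are convolved with a radial bump and the positive
part is replaced by a smooth convex function with slope in `[0, 1]`. The Laplacian of the
regularised `u - v` is a constant times the regularisation of `μ - ν`, and `ν ≤ τ + μ` bounds it
below by minus that constant times the regularised `τ`. Kato's inequality carries the bound over to
the smooth positive part (`laplacian_smoothPos_ge`). The smooth inequalities then pass to the limit
in `increment_nonneg_and_mul_le`, the core of the proof.

The limit rests on two facts. The submean property and upper semicontinuity squeeze the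
regularisations of a subharmonic function between the function and its local suprema, which gives
integrability and `L¹` convergence on every centred sphere (`sphere_integrable`,
`tendsto_sphere_moll`). The regularised ball masses of `τ` converge for all but countably many
radii. Existence of the Riesz measures is also proved, from positivity of the distributional
Laplacian, because `rieszMeasure` is a choice that defaults to zero.

In the first variable only the counting function moves. Its negative has increments `max{1, d-2} ∫
t^{1-d} τ(B(t)) dt` with `τ(B(t))` increasing, so the same averaging inequality gives concavity. An
infinite value can only come from the counting integral near `t = 0`; hence the exception at `r =
0`. -/

/-! ### Surface measure and polar coordinates. -/

/-- Surface measure on the unit sphere of `ℝ^d`. -/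
abbrev surf (d : ℕ) : Measure (sphere (0 : E d) 1) := (volume : Measure (E d)).toSphere

theorem sphereArea_pos (hd : 2 ≤ d) : 0 < sphereArea d := by
  have h : (0 : ℝ) < (d : ℝ) / 2 := by have : (2 : ℝ) ≤ d := by exact_mod_cast hd
                                       linarith
  have := Real.Gamma_pos_of_pos h
  unfold sphereArea
  positivity

theorem surf_univ (hd : 2 ≤ d) : surf d univ = ENNReal.ofReal (sphereArea d) := by
  have : Nonempty (Fin d) := ⟨⟨0, by omega⟩⟩
  have h : (0 : ℝ) < (d : ℝ) / 2 := by have : (2 : ℝ) ≤ d := by exact_mod_cast hd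
                                       linarith
  have hG := Real.Gamma_pos_of_pos h
  rw [Measure.toSphere_apply_univ, EuclideanSpace.volume_ball]
  simp only [finrank_euclideanSpace, Fintype.card_fin, ENNReal.ofReal_one, one_pow, one_mul]
  rw [← ENNReal.ofReal_natCast, ← ENNReal.ofReal_mul (by positivity)]
  congr 1
  rw [Real.Gamma_add_one h.ne', sphereArea, Real.sqrt_eq_rpow, ← Real.rpow_natCast,
    ← Real.rpow_mul Real.pi_pos.le]
  rw [show (1 / 2 * (d : ℝ)) = d / 2 by ring]
  field_simp

theorem surf_real_univ (hd : 2 ≤ d) : (surf d).real univ = sphereArea d := by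
  rw [Measure.real, surf_univ hd, ENNReal.toReal_ofReal (sphereArea_pos hd).le]

/-- The polar homeomorphism of the punctured space carries Lebesgue measure to the product of
surface measure and `t^{d-1} dt`, and the origin is a null set. -/
theorem lintegral_polar (f : E d → ℝ≥0∞) (hd : 2 ≤ d) (hf : Measurable f) :
    ∫⁻ x, f x = ∫⁻ t in Ioi (0 : ℝ), ENNReal.ofReal (t ^ (d - 1)) *
      ∫⁻ ω, f (t • (ω : E d)) ∂surf d := by
  have : Nonempty (Fin d) := ⟨⟨0, by omega⟩⟩
  have h1 := (volume : Measure (E d)).measurePreserving_homeomorphUnitSphereProd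
  have h2 : ∫⁻ x, f x = ∫⁻ x : ({0}ᶜ : Set (E d)), f x ∂(Measure.comap Subtype.val volume) := by
    rw [lintegral_subtype_comap (measurableSet_singleton _).compl, restrict_compl_singleton]
  have h3 : Measurable fun p : sphere (0 : E d) 1 × Ioi (0 : ℝ) => f ((p.2 : ℝ) • (p.1 : E d)) := by
    fun_prop
  rw [h2]
  have h4 := h1.lintegral_comp h3
  have h5 : ∀ x : ({0}ᶜ : Set (E d)),
      f (((homeomorphUnitSphereProd (E d) x).2 : ℝ) • ((homeomorphUnitSphereProd (E d) x).1 : E d))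
        = f x := by
    intro x
    have := homeomorphUnitSphereProd_symm_apply_coe (E d) (homeomorphUnitSphereProd (E d) x)
    rw [Homeomorph.symm_apply_apply] at this
    rw [← this]
  simp only [h5] at h4
  rw [h4, lintegral_prod_symm' _ h3, Measure.volumeIoiPow]
  rw [lintegral_withDensity_eq_lintegral_mul _ (by fun_prop)]
  · simp only [Pi.mul_apply, finrank_euclideanSpace, Fintype.card_fin]
    rw [← lintegral_subtype_comap measurableSet_Ioi
      (f := fun t : ℝ => ENNReal.ofReal (t ^ (d - 1)) * ∫⁻ ω, f (t • (ω : E d)) ∂surf d)]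
  · exact h3.lintegral_prod_left'

theorem integrable_polar_iff (hd : 2 ≤ d) (f : E d → ℝ) :
    Integrable f ↔ Integrable (fun p : sphere (0 : E d) 1 × Ioi (0 : ℝ) =>
      f ((p.2 : ℝ) • (p.1 : E d))) ((surf d).prod (.volumeIoiPow (d - 1))) := by
  have : Nonempty (Fin d) := ⟨⟨0, by omega⟩⟩
  have h1 := (volume : Measure (E d)).measurePreserving_homeomorphUnitSphereProd
  have h4 := h1.integrable_comp_emb (Homeomorph.measurableEmbedding _)
    (g := fun p : sphere (0 : E d) 1 × Ioi (0 : ℝ) => f ((p.2 : ℝ) • (p.1 : E d)))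
  have h5 : ∀ x : ({0}ᶜ : Set (E d)),
      f (((homeomorphUnitSphereProd (E d) x).2 : ℝ) • ((homeomorphUnitSphereProd (E d) x).1 : E d))
        = f x := by
    intro x
    have := homeomorphUnitSphereProd_symm_apply_coe (E d) (homeomorphUnitSphereProd (E d) x)
    rw [Homeomorph.symm_apply_apply] at this
    rw [← this]
  simp only [Function.comp_def, h5] at h4
  simp only [finrank_euclideanSpace, Fintype.card_fin] at h4
  have h6 := integrableOn_iff_comap_subtypeVal (μ := (volume : Measure (E d))) (f := f)
    (measurableSet_singleton (0 : E d)).compl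
  rw [IntegrableOn, restrict_compl_singleton] at h6
  rw [← h4, h6, Function.comp_def]

theorem integral_polar (hd : 2 ≤ d) {f : E d → ℝ} (hf : Integrable f) :
    ∫ x, f x = ∫ t in Ioi (0 : ℝ), t ^ (d - 1) * ∫ ω, f (t • (ω : E d)) ∂surf d := by
  have : Nonempty (Fin d) := ⟨⟨0, by omega⟩⟩
  have h1 := (volume : Measure (E d)).measurePreserving_homeomorphUnitSphereProd
  have h2 : ∫ x, f x = ∫ x : ({0}ᶜ : Set (E d)), f x ∂(Measure.comap Subtype.val volume) := by
    rw [integral_subtype_comap (measurableSet_singleton _).compl, restrict_compl_singleton]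
  have h4 := h1.integral_comp (Homeomorph.measurableEmbedding _)
    (fun p : sphere (0 : E d) 1 × Ioi (0 : ℝ) => f ((p.2 : ℝ) • (p.1 : E d)))
  have h5 : ∀ x : ({0}ᶜ : Set (E d)),
      f (((homeomorphUnitSphereProd (E d) x).2 : ℝ) • ((homeomorphUnitSphereProd (E d) x).1 : E d))
        = f x := by
    intro x
    have := homeomorphUnitSphereProd_symm_apply_coe (E d) (homeomorphUnitSphereProd (E d) x)
    rw [Homeomorph.symm_apply_apply] at this
    rw [← this]
  simp only [h5] at h4
  have h6 := (integrable_polar_iff hd f).1 hf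
  simp only [finrank_euclideanSpace, Fintype.card_fin] at h4
  rw [h2, h4, integral_prod_symm _ h6, Measure.volumeIoiPow]
  simp only [ENNReal.ofReal]
  rw [integral_withDensity_eq_integral_smul (by fun_prop)]
  rw [← integral_subtype_comap measurableSet_Ioi
    (fun t : ℝ => t ^ (d - 1) * ∫ ω, f (t • (ω : E d)) ∂surf d)]
  refine integral_congr_ae (Eventually.of_forall fun t => ?_)
  have : (0 : ℝ) < t := t.2
  simp [NNReal.smul_def, Real.coe_toNNReal _ (pow_nonneg this.le _)]

/-! ### The Laplacian and spherical means of smooth functions. -/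

theorem fderiv_fderiv_apply {f : E d → ℝ} (hf : ContDiff ℝ 2 f) (x v w : E d) :
    fderiv ℝ (fun y => fderiv ℝ f y v) x w = fderiv ℝ (fderiv ℝ f) x w v := by
  have h1 : DifferentiableAt ℝ (fderiv ℝ f) x :=
    ((hf.fderiv_right (m := 1) (by norm_num)).differentiable (by norm_num)).differentiableAt
  rw [(h1.hasFDerivAt.clm_apply (hasFDerivAt_const v x)).fderiv]
  simp

theorem laplacian_eq_sum {f : E d → ℝ} (hf : ContDiff ℝ 2 f) (x : E d) :
    (Δ f) x = ∑ i, fderiv ℝ (fun y => fderiv ℝ f y (EuclideanSpace.basisFun (Fin d) ℝ i)) x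
      (EuclideanSpace.basisFun (Fin d) ℝ i) := by
  rw [InnerProductSpace.laplacian_eq_iteratedFDeriv_orthonormalBasis f
    (EuclideanSpace.basisFun (Fin d) ℝ)]
  refine Finset.sum_congr rfl fun i _ => ?_
  rw [fderiv_fderiv_apply hf, iteratedFDeriv_two_apply]
  simp

theorem continuous_fderiv_apply {f : E d → ℝ} (hf : ContDiff ℝ 2 f) (v : E d) :
    ContDiff ℝ 1 fun y => fderiv ℝ f y v :=
  (hf.fderiv_right (m := 1) (by norm_num)).clm_apply contDiff_const

theorem continuous_laplacian {f : E d → ℝ} (hf : ContDiff ℝ 2 f) : Continuous (Δ f) := by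
  have : (Δ f) = fun x => ∑ i, fderiv ℝ
      (fun y => fderiv ℝ f y (EuclideanSpace.basisFun (Fin d) ℝ i)) x
      (EuclideanSpace.basisFun (Fin d) ℝ i) := funext (laplacian_eq_sum hf)
  rw [this]
  refine continuous_finsetSum _ fun i _ => ?_
  exact ((continuous_fderiv_apply hf _).continuous_fderiv (by norm_num)).clm_apply continuous_const

theorem continuous_sphere_integral {X : Type*} [TopologicalSpace X] [FirstCountableTopology X]
    [LocallyCompactSpace X] {F : X → sphere (0 : E d) 1 → ℝ} (hF : Continuous F.uncurry) :
    Continuous fun x => ∫ ω, F x ω ∂surf d := by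
  have := continuous_parametric_integral_of_continuous (μ := surf d) hF isCompact_univ
  simpa using this

theorem hasFDerivAt_norm {x : E d} (hx : x ≠ 0) :
    HasFDerivAt (fun y : E d => ‖y‖) (‖x‖⁻¹ • innerSL ℝ x) x := by
  have h := (hasStrictFDerivAt_norm_sq x).hasFDerivAt.sqrt (by simpa using hx)
  have h2 : (fun y : E d => √(‖y‖ ^ 2)) = fun y => ‖y‖ := by
    ext y; exact Real.sqrt_sq (norm_nonneg y)
  rw [h2] at h
  rw [Real.sqrt_sq (norm_nonneg x), ← Nat.cast_smul_eq_nsmul ℝ, smul_smul] at h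
  have h3 : 1 / (2 * ‖x‖) * ((2 : ℕ) : ℝ) = ‖x‖⁻¹ := by
    have : ‖x‖ ≠ 0 := by simpa using hx
    push_cast; field_simp
  rwa [h3] at h

/-- Integration by parts against the radial function with profile `g`. -/
theorem integral_radial_mul_laplacian {f : E d → ℝ} (hf : ContDiff ℝ 2 f) {g ψ : ℝ → ℝ} {A : ℝ}
    (hg : ∀ t, HasDerivAt g (-ψ t) t) (hψ : Continuous ψ) (hgA : ∀ t, A ≤ t → g t = 0)
    (hψ0 : ψ =ᶠ[𝓝 0] 0) (hg0 : g =ᶠ[𝓝 0] fun _ => g 0) (hψA : ∀ t, A ≤ t → ψ t = 0) :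
    Integrable (fun x => g ‖x‖ * (Δ f) x) ∧
    Integrable (fun x => ψ ‖x‖ * ‖x‖⁻¹ * fderiv ℝ f x x) ∧
    ∫ x, g ‖x‖ * (Δ f) x = ∫ x, ψ ‖x‖ * ‖x‖⁻¹ * fderiv ℝ f x x := by
  -- The norm is not differentiable at the origin, but `g` is constant near `0`, so the formula
  -- holds there too, with both sides zero.
  have hD : ∀ x : E d, HasFDerivAt (fun y : E d => g ‖y‖) ((-ψ ‖x‖ * ‖x‖⁻¹) • innerSL ℝ x) x := by
    intro x
    by_cases hx : x = 0
    · subst hx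
      have hn : Tendsto (fun y : E d => ‖y‖) (𝓝 0) (𝓝 0) := by
        simpa using (continuous_norm (E := E d)).tendsto 0
      have : (fun y : E d => g ‖y‖) =ᶠ[𝓝 0] fun _ => g 0 := hn.eventually hg0
      refine HasFDerivAt.congr_of_eventuallyEq ?_ this
      simpa using hasFDerivAt_const (g 0) (0 : E d)
    · have := (hg ‖x‖).comp_hasFDerivAt x (hasFDerivAt_norm hx)
      rw [mul_smul]
      exact this
  have hsupp : HasCompactSupport fun y : E d => g ‖y‖ := by
    refine HasCompactSupport.of_support_subset_isCompact (isCompact_closedBall (0 : E d) A) ?_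
    intro y hy
    by_contra h
    simp only [mem_closedBall, dist_zero_right, not_le] at h
    exact hy (hgA _ h.le)
  have hgc : Continuous g := continuous_iff_continuousAt.2 fun t => (hg t).continuousAt
  have hφc : Continuous fun y : E d => g ‖y‖ := hgc.comp continuous_norm
  -- The singularity of `1/t` is harmless because `ψ` vanishes near `0`.
  have hcoef : Continuous fun t : ℝ => -ψ t * t⁻¹ := by
    rw [continuous_iff_continuousAt]
    intro t
    by_cases ht : t = 0
    · subst ht
      have : (fun t : ℝ => -ψ t * t⁻¹) =ᶠ[𝓝 0] fun _ => 0 := by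
        filter_upwards [hψ0] with t ht; simp [ht]
      exact continuousAt_const.congr this.symm
    · exact hψ.continuousAt.neg.mul (continuousAt_id.inv₀ ht)
  have hcoef' : Continuous fun x : E d => -ψ ‖x‖ * ‖x‖⁻¹ := hcoef.comp continuous_norm
  have hcs : HasCompactSupport fun x : E d => -ψ ‖x‖ * ‖x‖⁻¹ := by
    refine HasCompactSupport.of_support_subset_isCompact (isCompact_closedBall (0 : E d) A) ?_
    intro y hy
    by_contra h
    simp only [mem_closedBall, dist_zero_right, not_le] at h
    exact hy (by simp [hψA _ h.le])
  have hfd : ∀ x v, fderiv ℝ (fun y : E d => g ‖y‖) x v = -ψ ‖x‖ * ‖x‖⁻¹ * inner ℝ x v := by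
    intro x v; rw [(hD x).fderiv]; simp
  have hc1 := fun i => continuous_fderiv_apply hf (EuclideanSpace.basisFun (Fin d) ℝ i)
  have hc2 := fun i => ((hc1 i).continuous_fderiv (by norm_num)).clm_apply
    (continuous_const (y := EuclideanSpace.basisFun (Fin d) ℝ i))
  have hint1 : ∀ i, Integrable fun x => g ‖x‖ * fderiv ℝ
      (fun y => fderiv ℝ f y (EuclideanSpace.basisFun (Fin d) ℝ i)) x
      (EuclideanSpace.basisFun (Fin d) ℝ i) := fun i =>
    (hφc.mul (hc2 i)).integrable_of_hasCompactSupport hsupp.mul_right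
  have hcin : ∀ v : E d, Continuous fun x : E d => (-ψ ‖x‖ * ‖x‖⁻¹) * inner ℝ x v := fun v =>
    hcoef'.mul (by fun_prop)
  have hint2 : ∀ i, Integrable fun x : E d => (-ψ ‖x‖ * ‖x‖⁻¹ * inner ℝ x
      (EuclideanSpace.basisFun (Fin d) ℝ i)) * fderiv ℝ f x (EuclideanSpace.basisFun (Fin d) ℝ i) :=
    fun i => ((hcin _).mul (hc1 i).continuous).integrable_of_hasCompactSupport
      (hcs.mul_right.mul_right)
  have key : ∀ i, ∫ x, g ‖x‖ * fderiv ℝ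
      (fun y => fderiv ℝ f y (EuclideanSpace.basisFun (Fin d) ℝ i)) x
      (EuclideanSpace.basisFun (Fin d) ℝ i) =
      - ∫ x : E d, (-ψ ‖x‖ * ‖x‖⁻¹ * inner ℝ x
      (EuclideanSpace.basisFun (Fin d) ℝ i)) *
        fderiv ℝ f x (EuclideanSpace.basisFun (Fin d) ℝ i) := by
    intro i
    rw [integral_mul_fderiv_eq_neg_fderiv_mul_of_integrable]
    · simp only [hfd]
    · simpa only [hfd] using hint2 i
    · exact hint1 i
    · exact (hφc.mul (hc1 i).continuous).integrable_of_hasCompactSupport hsupp.mul_right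
    · exact fun x _ => (hD x).differentiableAt
    · exact fun x _ => ((hc1 i).differentiable (by norm_num)).differentiableAt
  have hcf : Continuous fun x => fderiv ℝ f x x :=
    (hf.continuous_fderiv (by norm_num)).clm_apply continuous_id
  refine ⟨(hφc.mul (continuous_laplacian hf)).integrable_of_hasCompactSupport hsupp.mul_right,
    ?_, ?_⟩
  · have := ((hcoef'.mul hcf).integrable_of_hasCompactSupport hcs.mul_right
      (μ := volume)).neg
    refine this.congr (Eventually.of_forall fun x => ?_)
    simp only [Pi.neg_apply, Pi.mul_apply]
    ring
  simp only [laplacian_eq_sum hf, Finset.mul_sum]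
  rw [integral_finsetSum _ fun i _ => hint1 i]
  simp only [key]
  rw [Finset.sum_neg_distrib, ← integral_finsetSum _ fun i _ => hint2 i, ← integral_neg]
  refine integral_congr_ae (Eventually.of_forall fun x => ?_)
  have hx : x = ∑ i, inner ℝ x (EuclideanSpace.basisFun (Fin d) ℝ i) •
      EuclideanSpace.basisFun (Fin d) ℝ i := by
    conv_lhs => rw [← (EuclideanSpace.basisFun (Fin d) ℝ).sum_repr x]
    refine Finset.sum_congr rfl fun i _ => ?_
    rw [OrthonormalBasis.repr_apply_apply, real_inner_comm]
  have : fderiv ℝ f x x = ∑ i, inner ℝ x (EuclideanSpace.basisFun (Fin d) ℝ i) *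
      fderiv ℝ f x (EuclideanSpace.basisFun (Fin d) ℝ i) := by
    conv_lhs => enter [2]; rw [hx]
    rw [map_sum]
    simp
  simp only [this, Finset.mul_sum, ← Finset.sum_neg_distrib]
  refine Finset.sum_congr rfl fun i _ => ?_
  ring

theorem norm_smul_sphere {t : ℝ} (ht : 0 ≤ t) (ω : sphere (0 : E d) 1) : ‖t • (ω : E d)‖ = t := by
  rw [norm_smul, norm_eq_of_mem_sphere ω, mul_one, Real.norm_of_nonneg ht]

theorem integral_radial_mul (hd : 2 ≤ d) (h : ℝ → ℝ) (F : E d → ℝ)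
    (hi : Integrable fun x => h ‖x‖ * F x) :
    ∫ x, h ‖x‖ * F x = ∫ t in Ioi (0 : ℝ), h t * (t ^ (d - 1) * ∫ ω, F (t • (ω : E d)) ∂surf d) := by
  rw [integral_polar hd hi]
  refine setIntegral_congr_fun measurableSet_Ioi fun t ht => ?_
  have : ∀ ω : sphere (0 : E d) 1, ‖t • (ω : E d)‖ = t := norm_smul_sphere (le_of_lt ht)
  simp only [this, integral_const_mul]
  ring

theorem continuous_sphere_integral_smul {F : E d → ℝ} (hF : Continuous F) :
    Continuous fun t : ℝ => ∫ ω, F (t • (ω : E d)) ∂surf d :=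
  continuous_sphere_integral (F := fun (t : ℝ) (ω : sphere (0 : E d) 1) => F (t • (ω : E d)))
    (by simp only [Function.uncurry_def]; fun_prop)

theorem continuous_sphere_flux {f : E d → ℝ} (hf : ContDiff ℝ 2 f) :
    Continuous fun t : ℝ => ∫ ω, fderiv ℝ f (t • (ω : E d)) ω ∂surf d :=
  continuous_sphere_integral
    (F := fun (t : ℝ) (ω : sphere (0 : E d) 1) => fderiv ℝ f (t • (ω : E d)) ω) (by
    have := hf.continuous_fderiv (by norm_num)
    simp only [Function.uncurry_def]
    exact (this.comp (by fun_prop)).clm_apply (by fun_prop))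

/-- The divergence theorem for gradient fields on balls, in polar coordinates. -/
theorem sphere_flux (hd : 2 ≤ d) {f : E d → ℝ} (hf : ContDiff ℝ 2 f) {t : ℝ} (ht : 0 < t) :
    t ^ (d - 1) * ∫ ω, fderiv ℝ f (t • (ω : E d)) ω ∂surf d =
      ∫ s in (0 : ℝ)..t, s ^ (d - 1) * ∫ ω, (Δ f) (s • (ω : E d)) ∂surf d := by
  set Φ : ℝ → ℝ := fun t => t ^ (d - 1) * ∫ ω, fderiv ℝ f (t • (ω : E d)) ω ∂surf d with hΦ
  set p : ℝ → ℝ := fun s => s ^ (d - 1) * ∫ ω, (Δ f) (s • (ω : E d)) ∂surf d with hp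
  set D : ℝ → ℝ := fun t => ∫ s in (0 : ℝ)..t, p s with hD
  have hΦc : Continuous Φ := (continuous_pow _).mul (continuous_sphere_flux hf)
  have hpc : Continuous p :=
    (continuous_pow _).mul (continuous_sphere_integral_smul (continuous_laplacian hf))
  have hDd : ∀ t, HasDerivAt D (p t) t := fun t => (hpc.integral_hasStrictDerivAt 0 t).hasDerivAt
  have hDc : Continuous D := continuous_iff_continuousAt.2 fun t => (hDd t).continuousAt
  have hc : Continuous fun t => Φ t - D t := hΦc.sub hDc
  -- The divergence theorem is obtained weakly: `Φ - D` is orthogonal to every test function `ψ` on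
  -- `(0, ∞)`, hence zero almost everywhere, and continuity removes the exceptional set.
  have key : ∀ᵐ t : ℝ, t ∈ Ioi (0 : ℝ) → Φ t - D t = 0 := by
    refine isOpen_Ioi.ae_eq_zero_of_integral_contDiff_smul_eq_zero
      (hc.locallyIntegrable.locallyIntegrableOn _) fun ψ hψ hψc hψs => ?_
    have hψcont : Continuous ψ := hψ.continuous
    obtain ⟨A, hA0, hA⟩ : ∃ A : ℝ, 0 < A ∧ ∀ t, A ≤ t → ψ t = 0 := by
      obtain ⟨A, hA⟩ := hψc.isCompact.isBounded.subset_closedBall (0 : ℝ)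
      refine ⟨max A 0 + 1, by positivity, fun t ht => ?_⟩
      by_contra h
      have := hA (subset_tsupport _ h)
      rw [mem_closedBall, dist_zero_right, Real.norm_eq_abs] at this
      have h1 := le_max_left A 0
      have h2 := le_abs_self t
      linarith
    have hneg : ∀ t ≤ 0, ψ t = 0 := fun t ht => by
      by_contra h
      have := hψs (subset_tsupport _ h)
      rw [mem_Ioi] at this
      linarith
    have h0 : ψ =ᶠ[𝓝 0] 0 := by
      rw [← notMem_tsupport_iff_eventuallyEq]
      intro h
      exact lt_irrefl (0 : ℝ) (hψs h)
    -- The primitive of `-ψ` that vanishes beyond `A`; as a radial profile it is compactly supported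
    -- and constant near the origin, so integration by parts against `Δf` applies.
    set g : ℝ → ℝ := fun t => -∫ s in A..t, ψ s with hg
    have hgd : ∀ t, HasDerivAt g (-ψ t) t := fun t =>
      (hψcont.integral_hasStrictDerivAt A t).hasDerivAt.neg
    have hgA : ∀ t, A ≤ t → g t = 0 := by
      intro t ht
      simp only [hg, neg_eq_zero]
      rw [intervalIntegral.integral_congr (g := fun _ => 0)]
      · simp
      · intro s hs
        rw [uIcc_of_le ht] at hs
        exact hA s hs.1
    have hg0 : g =ᶠ[𝓝 0] fun _ => g 0 := by
      obtain ⟨η, hη, hη'⟩ := Metric.eventually_nhds_iff.1 h0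
      refine Metric.eventually_nhds_iff.2 ⟨η, hη, fun t ht => ?_⟩
      have hz : ∫ s in (0 : ℝ)..t, ψ s = 0 := by
        rw [intervalIntegral.integral_congr (g := fun _ => 0)]
        · simp
        · intro s hs
          refine hη' ?_
          have := abs_sub_left_of_mem_uIcc hs
          rw [Real.dist_eq] at ht ⊢
          linarith
      simp only [hg]
      rw [← intervalIntegral.integral_add_adjacent_intervals (a := A) (b := 0) (c := t)
        (hψcont.intervalIntegrable _ _) (hψcont.intervalIntegrable _ _), hz, add_zero]
    obtain ⟨hi1, hi2, heq⟩ := integral_radial_mul_laplacian hf hgd hψcont hgA h0 hg0 hA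
    rw [integral_radial_mul hd g _ hi1,
      integral_radial_mul hd (fun t => ψ t * t⁻¹) _ hi2] at heq
    -- One-dimensional integration by parts; the boundary terms vanish because `g A = 0` and `D 0 =
    -- 0`.
    have e1 : ∫ t in Ioi (0 : ℝ), g t * p t = ∫ t in (0 : ℝ)..A, ψ t * D t := by
      have e : ∫ t in Ioi (0 : ℝ), g t * p t = ∫ t in (0 : ℝ)..A, g t * p t := by
        rw [intervalIntegral.integral_of_le hA0.le]
        refine setIntegral_eq_of_subset_of_forall_sdiff_eq_zero measurableSet_Ioi
          Ioc_subset_Ioi_self fun t ht => ?_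
        have : A ≤ t := by
          by_contra h
          exact ht.2 ⟨ht.1, (not_le.1 h).le⟩
        rw [hgA t this, zero_mul]
      rw [e, intervalIntegral.integral_mul_deriv_eq_deriv_mul (u := g) (v := D) (u' := fun t => -ψ t)
        (fun t _ => hgd t) (fun t _ => hDd t) (hψcont.neg.intervalIntegrable _ _)
        (hpc.intervalIntegrable _ _), hgA A le_rfl]
      simp [hD]
    have e2 : ∫ t in Ioi (0 : ℝ), ψ t * t⁻¹ *
        (t ^ (d - 1) * ∫ ω, fderiv ℝ f (t • (ω : E d)) (t • (ω : E d)) ∂surf d) =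
        ∫ t in (0 : ℝ)..A, ψ t * Φ t := by
      rw [intervalIntegral.integral_of_le hA0.le]
      rw [setIntegral_eq_of_subset_of_forall_sdiff_eq_zero measurableSet_Ioi
          (Ioc_subset_Ioi_self : Ioc (0 : ℝ) A ⊆ Ioi 0)]
      · refine setIntegral_congr_fun measurableSet_Ioc fun t ht => ?_
        have ht0 : t ≠ 0 := ht.1.ne'
        simp only [map_smul, smul_eq_mul, integral_const_mul, hΦ]
        field_simp
      · intro t ht
        have : A ≤ t := by
          by_contra h
          exact ht.2 ⟨ht.1, (not_le.1 h).le⟩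
        rw [hA t this]; simp
    have e3 : ∫ t, ψ t • (Φ t - D t) = ∫ t in (0 : ℝ)..A, ψ t • (Φ t - D t) := by
      rw [intervalIntegral.integral_of_le hA0.le]
      refine (setIntegral_eq_integral_of_forall_compl_eq_zero fun t ht => ?_).symm
      have : ψ t = 0 := by
        by_cases h : t ≤ 0
        · exact hneg t h
        · refine hA t ?_
          by_contra h'
          exact ht ⟨not_le.1 h, (not_le.1 h').le⟩
      rw [this, zero_smul]
    rw [e3]
    simp only [smul_eq_mul, mul_sub]
    rw [intervalIntegral.integral_sub
      ((by fun_prop : Continuous fun t => ψ t * Φ t).intervalIntegrable _ _)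
      ((by fun_prop : Continuous fun t => ψ t * D t).intervalIntegrable _ _), ← e2, ← e1, sub_eq_zero]
    exact heq.symm
  have := Measure.eqOn_open_of_ae_eq (μ := (volume : Measure ℝ)) (f := Φ) (g := D) (U := Ioi 0) ?_ isOpen_Ioi
    hΦc.continuousOn hDc.continuousOn
  · exact this ht
  · refine (ae_restrict_iff' measurableSet_Ioi).2 ?_
    filter_upwards [key] with t h1 h2 using sub_eq_zero.1 (h1 h2)

/-- The fundamental theorem of calculus along each ray, followed by Fubini. -/
theorem sphere_integral_sub_eq_flux {f : E d → ℝ} (hf : ContDiff ℝ 2 f) (a b : ℝ) :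
    ∫ ω, f (b • (ω : E d)) ∂surf d - ∫ ω, f (a • (ω : E d)) ∂surf d =
      ∫ t in a..b, ∫ ω, fderiv ℝ f (t • (ω : E d)) ω ∂surf d := by
  have hfc := hf.continuous
  have hdc := hf.continuous_fderiv (by norm_num)
  have hcu : Continuous fun p : ℝ × sphere (0 : E d) 1 => fderiv ℝ f (p.1 • (p.2 : E d)) p.2 :=
    (hdc.comp (by fun_prop)).clm_apply (by fun_prop)
  rw [intervalIntegral_integral_swap]
  · rw [← integral_sub]
    · refine integral_congr_ae (Eventually.of_forall fun ω => ?_)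
      simp only
      rw [intervalIntegral.integral_eq_sub_of_hasDerivAt (f := fun t : ℝ => f (t • (ω : E d)))]
      · intro t _
        have h1 : HasDerivAt (fun t : ℝ => t • (ω : E d)) (ω : E d) t := by
          simpa using (hasDerivAt_id t).smul_const (ω : E d)
        exact ((hf.differentiable (by norm_num) _).hasFDerivAt.comp_hasDerivAt t h1)
      · exact (hcu.comp (Continuous.prodMk_left ω)).intervalIntegrable _ _
    · exact (by fun_prop : Continuous fun ω : sphere (0 : E d) 1 =>
        f (b • (ω : E d))).integrable_of_hasCompactSupport (HasCompactSupport.of_compactSpace _)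
    · exact (by fun_prop : Continuous fun ω : sphere (0 : E d) 1 =>
        f (a • (ω : E d))).integrable_of_hasCompactSupport (HasCompactSupport.of_compactSpace _)
  · have hK : IsCompact (uIcc a b ×ˢ (univ : Set (sphere (0 : E d) 1))) :=
      isCompact_uIcc.prod isCompact_univ
    have h1 : IntegrableOn (fun p : ℝ × sphere (0 : E d) 1 => fderiv ℝ f (p.1 • (p.2 : E d)) p.2)
        (uIcc a b ×ˢ univ) (volume.prod (surf d)) := hcu.continuousOn.integrableOn_compact hK
    have h2 := h1.mono_set (prod_mono_left (t := univ) (uIoc_subset_uIcc (a := a) (b := b)))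
    rw [IntegrableOn, ← Measure.prod_restrict, Measure.restrict_univ] at h2
    exact h2

theorem sphere_flux_eq_ball (hd : 2 ≤ d) {f : E d → ℝ} (hf : ContDiff ℝ 2 f) {t : ℝ}
    (ht0 : 0 < t) : ∫ ω, fderiv ℝ f (t • (ω : E d)) ω ∂surf d =
      (t ^ (d - 1))⁻¹ * ∫ x in ball (0 : E d) t, (Δ f) x := by
  have h1 := sphere_flux hd hf ht0
  have hi : Integrable ((ball (0 : E d) t).indicator (Δ f)) :=
    (integrable_indicator_iff measurableSet_ball).2
      (((continuous_laplacian hf).continuousOn.integrableOn_compact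
        (isCompact_closedBall 0 t)).mono_set ball_subset_closedBall)
  have h2 : ∫ x in ball (0 : E d) t, (Δ f) x =
      ∫ s in (0 : ℝ)..t, s ^ (d - 1) * ∫ ω, (Δ f) (s • (ω : E d)) ∂surf d := by
    rw [← integral_indicator measurableSet_ball, integral_polar hd hi,
      intervalIntegral.integral_of_le ht0.le, integral_Ioc_eq_integral_Ioo]
    rw [setIntegral_eq_of_subset_of_forall_sdiff_eq_zero measurableSet_Ioi
          (Ioo_subset_Ioi_self : Ioo (0 : ℝ) t ⊆ Ioi 0)]
    · refine setIntegral_congr_fun measurableSet_Ioo fun s hs => ?_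
      congr 2
      ext ω
      rw [indicator_of_mem]
      simpa [norm_smul_sphere hs.1.le ω] using hs.2
    · intro s hs
      have : t ≤ s := by
        by_contra h
        exact hs.2 ⟨hs.1, not_le.1 h⟩
      have h3 : ∀ ω : sphere (0 : E d) 1,
          (ball (0 : E d) t).indicator (Δ f) (s • (ω : E d)) = 0 := by
        intro ω
        rw [indicator_of_notMem]
        rw [mem_ball_zero_iff, norm_smul_sphere (le_of_lt hs.1) ω]
        exact not_lt.2 this
      simp [h3]
  rw [h2, ← h1, inv_mul_cancel_left₀ (pow_pos ht0 _).ne']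

/-- The derivative of spherical integrals of a smooth function, in terms of its Laplacian. -/
theorem hasDerivAt_sphere_integral (hd : 2 ≤ d) {f : E d → ℝ} (hf : ContDiff ℝ 2 f) {t : ℝ}
    (ht : 0 < t) : HasDerivAt (fun t : ℝ => ∫ ω, f (t • (ω : E d)) ∂surf d)
      ((t ^ (d - 1))⁻¹ * ∫ x in ball (0 : E d) t, (Δ f) x) t := by
  rw [← sphere_flux_eq_ball hd hf ht]
  have h := ((continuous_sphere_flux hf).integral_hasStrictDerivAt 0 t).hasDerivAt
  have h2 := h.add_const (∫ ω, f ((0 : ℝ) • (ω : E d)) ∂surf d)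
  refine h2.congr_of_eventuallyEq (Eventually.of_forall fun b => ?_)
  simp only [← sphere_integral_sub_eq_flux hf, sub_add_cancel]

/-- The derivative is an integral of `Δf` over a ball. Applied to regularisations, this transfers
finiteness from a small sphere to a larger one. -/
theorem sphere_integral_mono (hd : 2 ≤ d) {f : E d → ℝ} (hf : ContDiff ℝ 2 f) {a b : ℝ}
    (ha : 0 < a) (hab : a ≤ b) (hΔ : ∀ x ∈ ball (0 : E d) b, 0 ≤ (Δ f) x) :
    ∫ ω, f (a • (ω : E d)) ∂surf d ≤ ∫ ω, f (b • (ω : E d)) ∂surf d := by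
  have hc := continuous_sphere_integral_smul hf.continuous
  refine monotoneOn_of_deriv_nonneg (convex_Icc a b) hc.continuousOn ?_ ?_
    (left_mem_Icc.2 hab) (right_mem_Icc.2 hab) hab
  · rw [interior_Icc]
    exact fun t ht =>
      (hasDerivAt_sphere_integral hd hf (ha.trans ht.1)).differentiableAt.differentiableWithinAt
  · rw [interior_Icc]
    intro t ht
    have ht0 := ha.trans ht.1
    rw [(hasDerivAt_sphere_integral hd hf ht0).deriv]
    refine mul_nonneg (by positivity) (setIntegral_nonneg measurableSet_ball fun x hx => ?_)
    exact hΔ x (ball_subset_ball ht.2.le hx)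

theorem laplacian_comp_add_left {f : E d → ℝ} (hf : ContDiff ℝ 2 f) (x y : E d) :
    (Δ fun z => f (x + z)) y = (Δ f) (x + y) := by
  have hf' : ContDiff ℝ 2 fun z => f (x + z) := hf.comp (contDiff_const.add contDiff_id)
  rw [laplacian_eq_sum hf', laplacian_eq_sum hf]
  refine Finset.sum_congr rfl fun i _ => ?_
  simp only [fderiv_comp_add_left]
  rw [fderiv_comp_add_left (f := fun y => fderiv ℝ f y (EuclideanSpace.basisFun (Fin d) ℝ i))]

/-- A smooth function with the submean property has nonnegative Laplacian. -/
theorem laplacian_nonneg_of_submean (hd : 2 ≤ d) {f : E d → ℝ} (hf : ContDiff ℝ 2 f) {x : E d}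
    {δ : ℝ} (hδ : 0 < δ)
    (h : ∀ r, 0 < r → r < δ → sphereArea d * f x ≤ ∫ ω, f (x + r • (ω : E d)) ∂surf d) :
    0 ≤ (Δ f) x := by
  by_contra hneg
  push Not at hneg
  have hcont := (continuous_laplacian hf).continuousAt (x := x)
  obtain ⟨η, hη, hη'⟩ := Metric.eventually_nhds_iff.1 (hcont.eventually_lt_const hneg)
  set F : E d → ℝ := fun y => f (x + y)
  have hF : ContDiff ℝ 2 F := hf.comp (contDiff_const.add contDiff_id)
  set b := min (η / 2) (δ / 2) with hb
  have hb0 : 0 < b := lt_min (by positivity) (by positivity)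
  have hc := continuous_sphere_integral_smul hF.continuous
  -- A negative Laplacian at `x` is negative nearby, so the spherical integrals strictly decrease
  -- from their value `sphereArea d * f x` at radius `0`, against the submean inequality.
  have hanti : StrictAntiOn (fun t : ℝ => ∫ ω, F (t • (ω : E d)) ∂surf d) (Icc 0 b) := by
    refine strictAntiOn_of_deriv_neg (convex_Icc 0 b) hc.continuousOn ?_
    rw [interior_Icc]
    intro t ht
    rw [(hasDerivAt_sphere_integral hd hF ht.1).deriv]
    have ht0 := ht.1
    refine mul_neg_of_pos_of_neg (by positivity) ?_
    have hlt : ∀ y ∈ ball (0 : E d) t, 0 < -(Δ F) y := by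
      intro y hy
      have hy' : (Δ F) y = (Δ f) (x + y) := laplacian_comp_add_left hf x y
      rw [hy']
      have := hη' (y := x + y) (by
        rw [dist_self_add_left]
        rw [mem_ball_zero_iff] at hy
        have := min_le_left (η / 2) (δ / 2)
        have := ht.2
        linarith)
      linarith
    have hi : IntegrableOn (fun y => -(Δ F) y) (ball (0 : E d) t) :=
      ((continuous_laplacian hF).neg.continuousOn.integrableOn_compact
        (isCompact_closedBall 0 t)).mono_set ball_subset_closedBall
    have hpos : 0 < ∫ y in ball (0 : E d) t, -(Δ F) y := by
      rw [setIntegral_pos_iff_support_of_nonneg_ae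
        ((ae_restrict_iff' measurableSet_ball).2 (Eventually.of_forall fun y hy => (hlt y hy).le)) hi]
      refine (measure_ball_pos volume (0 : E d) ht0).trans_le (measure_mono fun y hy => ?_)
      exact ⟨(hlt y hy).ne', hy⟩
    rw [integral_neg] at hpos
    linarith
  have h1 := hanti (left_mem_Icc.2 hb0.le) (right_mem_Icc.2 hb0.le) hb0
  have h2 := h b hb0 ((min_le_right _ _).trans_lt (by linarith))
  simp only [F, zero_smul, add_zero, integral_const, surf_real_univ hd, smul_eq_mul] at h1
  linarith

/-! ### Extended-real integrals reduced to real ones. -/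

theorem extIntegral_eq_integral {α : Type*} [MeasurableSpace α] {μ : Measure α} {f : α → EReal}
    {g : α → ℝ} (hg : Integrable g μ) (hfg : ∀ᵐ x ∂μ, f x = g x) :
    extIntegral μ f = ((∫ x, g x ∂μ : ℝ) : EReal) := by
  have h1 : ∫⁻ x, (f x).toENNReal ∂μ = ∫⁻ x, ENNReal.ofReal (g x) ∂μ :=
    lintegral_congr_ae (by filter_upwards [hfg] with x hx; rw [hx, EReal.real_coe_toENNReal])
  have h2 : ∫⁻ x, (-f x).toENNReal ∂μ = ∫⁻ x, ENNReal.ofReal (-g x) ∂μ :=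
    lintegral_congr_ae (by
      filter_upwards [hfg] with x hx; rw [hx, ← EReal.coe_neg, EReal.real_coe_toENNReal])
  have h3 : ∫⁻ x, ENNReal.ofReal (g x) ∂μ ≠ ⊤ := hg.lintegral_lt_top.ne
  have h4 : ∫⁻ x, ENNReal.ofReal (-g x) ∂μ ≠ ⊤ := hg.neg.lintegral_lt_top.ne
  rw [extIntegral, h1, h2, integral_eq_lintegral_pos_part_sub_lintegral_neg_part hg, EReal.coe_sub,
    EReal.coe_ennreal_toReal h3, EReal.coe_ennreal_toReal h4]

/-- The upper bound on a finite measure controls the positive part. An infinite negative part would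
make the integral `⊥`, since `x - ⊤ = ⊥` in `EReal` for every `x`, including `⊤`. -/
theorem integrable_toReal_of_extIntegral_ne_bot {α : Type*} [MeasurableSpace α] {μ : Measure α}
    [IsFiniteMeasure μ] {f : α → EReal} (hf : Measurable f) {C : ℝ} (hC : ∀ x, f x ≤ C)
    (h : extIntegral μ f ≠ ⊥) :
    (∀ᵐ x ∂μ, f x = (f x).toReal) ∧ Integrable (fun x => (f x).toReal) μ ∧
      extIntegral μ f = ((∫ x, (f x).toReal ∂μ : ℝ) : EReal) := by
  have hB : ∫⁻ x, (-f x).toENNReal ∂μ ≠ ⊤ := by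
    intro hB
    apply h
    rw [extIntegral, hB]
    simp
  have hbot : ∀ᵐ x ∂μ, f x = (f x).toReal := by
    filter_upwards [ae_lt_top' (by fun_prop) hB] with x hx
    refine (EReal.coe_toReal (((hC x).trans_lt (EReal.coe_lt_top C)).ne) fun hx' => ?_).symm
    simp [hx'] at hx
  have hint : Integrable (fun x => (f x).toReal) μ := by
    refine ⟨hf.ereal_toReal.aestronglyMeasurable, ?_⟩
    rw [hasFiniteIntegral_iff_enorm]
    have : ∀ᵐ x ∂μ, ‖(f x).toReal‖ₑ ≤ ENNReal.ofReal C + (-f x).toENNReal := by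
      filter_upwards [hbot] with x hx
      have hx' := hC x
      rw [hx] at hx' ⊢
      rw [EReal.toReal_coe, ← EReal.coe_neg, EReal.real_coe_toENNReal, Real.enorm_eq_ofReal_abs]
      rw [EReal.coe_le_coe_iff] at hx'
      rcases abs_cases (f x).toReal with h | h
      · rw [h.1]; exact (ENNReal.ofReal_le_ofReal hx').trans le_self_add
      · rw [h.1]; exact le_add_self
    refine (lintegral_mono_ae this).trans_lt ?_
    rw [lintegral_add_left (by fun_prop)]
    refine ENNReal.add_lt_top.2 ⟨?_, hB.lt_top⟩
    rw [lintegral_const]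
    exact ENNReal.mul_lt_top ENNReal.ofReal_lt_top (measure_lt_top _ _)
  exact ⟨hbot, hint, extIntegral_eq_integral hint hbot⟩

/-- The difference `C - z`, where `z < ⊤` is meant, as an element of `[0, ∞]`. -/
def gap (C : ℝ) (z : EReal) : ℝ≥0∞ := if z = ⊥ then ⊤ else ENNReal.ofReal (C - z.toReal)

theorem measurable_gap (C : ℝ) : Measurable (gap C) :=
  Measurable.ite (measurableSet_singleton _) measurable_const (by fun_prop)

theorem gap_of_ne_bot (C : ℝ) {z : EReal} (hz : z ≠ ⊥) : gap C z = ENNReal.ofReal (C - z.toReal) :=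
  if_neg hz

/-- The function `gap C` is `⊤` at `⊥`, so a finite integral excludes the value `⊥` almost
everywhere; then `|f| ≤ C + (C - f)` when `C ≥ 0`. -/
theorem integrable_toReal_of_lintegral_gap {α : Type*} [MeasurableSpace α] {μ : Measure α}
    [IsFiniteMeasure μ] {f : α → EReal} (hf : Measurable f) {C : ℝ} (hC0 : 0 ≤ C)
    (hC : ∀ᵐ x ∂μ, f x ≤ C) (h : ∫⁻ x, gap C (f x) ∂μ ≠ ⊤) :
    (∀ᵐ x ∂μ, f x = (f x).toReal) ∧ Integrable (fun x => (f x).toReal) μ := by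
  have hbot : ∀ᵐ x ∂μ, f x = (f x).toReal := by
    filter_upwards [ae_lt_top ((measurable_gap C).comp hf) h, hC] with x hx hCx
    refine (EReal.coe_toReal ((hCx.trans_lt (EReal.coe_lt_top C)).ne) fun hx' => ?_).symm
    simp [hx', gap] at hx
  refine ⟨hbot, hf.ereal_toReal.aestronglyMeasurable, ?_⟩
  rw [hasFiniteIntegral_iff_enorm]
  have : ∀ᵐ x ∂μ, ‖(f x).toReal‖ₑ ≤ ENNReal.ofReal C + gap C (f x) := by
    filter_upwards [hbot, hC] with x hx hCx
    have hxb : f x ≠ ⊥ := by rw [hx]; simp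
    rw [gap_of_ne_bot C hxb]
    rw [hx, EReal.coe_le_coe_iff] at hCx
    rw [Real.enorm_eq_ofReal_abs, ← ENNReal.ofReal_add hC0 (by linarith)]
    refine ENNReal.ofReal_le_ofReal (abs_le.2 ?_)
    constructor <;> linarith
  refine (lintegral_mono_ae this).trans_lt ?_
  rw [lintegral_add_left (by fun_prop)]
  refine ENNReal.add_lt_top.2 ⟨?_, h.lt_top⟩
  rw [lintegral_const]
  exact ENNReal.mul_lt_top ENNReal.ofReal_lt_top (measure_lt_top _ _)

/-! ### Local integrability of subharmonic functions. -/

namespace SubharmonicOn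

variable {u : E d → EReal} {Ω : Set (E d)}

/-- Values of `u` outside `Ω` are arbitrary, so only the cut-off function can be measurable; on `Ω`
this is upper semicontinuity. -/
theorem measurable_indicator (hu : SubharmonicOn u Ω) (hΩ : IsOpen Ω) :
    Measurable (Ω.indicator u) := by
  refine measurable_of_restrict_of_restrict_compl hΩ.measurableSet ?_ ?_
  · have := (upperSemicontinuousOn_iff_restrict.2 hu.upperSemicontinuousOn).measurable
    convert this using 1
    ext x
    simp
  · have : (Ωᶜ).domRestrict (Ω.indicator u) = fun _ => 0 := by
      ext x
      have := x.2
      simp only [domRestrict_apply]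
      rw [indicator_of_notMem this]
    rw [this]
    exact measurable_const

theorem exists_bound (hu : SubharmonicOn u Ω) {K : Set (E d)} (hK : IsCompact K) (hKΩ : K ⊆ Ω) :
    ∃ C : ℝ, 0 ≤ C ∧ ∀ x ∈ K, u x ≤ C := by
  rcases K.eq_empty_or_nonempty with rfl | hne
  · exact ⟨0, le_rfl, by simp⟩
  obtain ⟨a, ha, hmax⟩ := (hu.upperSemicontinuousOn.mono hKΩ).exists_isMaxOn hne hK
  refine ⟨max 0 (u a).toReal, le_max_left _ _, fun x hx => (hmax hx).trans ?_⟩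
  refine (EReal.le_coe_toReal (hu.lt_top a (hKΩ ha)).ne).trans ?_
  exact_mod_cast le_max_right _ _

theorem add_smul_mem_closedBall (x : E d) {r : ℝ} (hr : 0 ≤ r) (ω : sphere (0 : E d) 1) :
    x + r • (ω : E d) ∈ closedBall x r := by
  simp [norm_smul_sphere hr ω]

/-- A finite value at the centre keeps the spherical mean away from `⊥`; as `u` is bounded above on
the ball, this forces integrability on the sphere and turns the inequality into one between real
numbers. -/
theorem submean (hd : 2 ≤ d) (hu : SubharmonicOn u Ω) (hΩ : IsOpen Ω) {x : E d} {r : ℝ}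
    (hr : 0 < r) (hxr : closedBall x r ⊆ Ω) (hx : u x ≠ ⊥) :
    (∀ᵐ ω : sphere (0 : E d) 1 ∂surf d, u (x + r • (ω : E d)) = (u (x + r • (ω : E d))).toReal) ∧
    Integrable (fun ω : sphere (0 : E d) 1 => (u (x + r • (ω : E d))).toReal) (surf d) ∧
    sphereArea d * (u x).toReal ≤ ∫ ω, (u (x + r • (ω : E d))).toReal ∂surf d := by
  have hxΩ : x ∈ Ω := hxr (mem_closedBall_self hr.le)
  obtain ⟨C, hC0, hC⟩ := hu.exists_bound (isCompact_closedBall x r) hxr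
  have hmeas : Measurable fun ω : sphere (0 : E d) 1 => u (x + r • (ω : E d)) := by
    have h1 : (fun ω : sphere (0 : E d) 1 => u (x + r • (ω : E d))) =
        fun ω : sphere (0 : E d) 1 => Ω.indicator u (x + r • (ω : E d)) := by
      ext ω
      rw [indicator_of_mem (hxr (add_smul_mem_closedBall x hr.le ω))]
    rw [h1]
    exact (hu.measurable_indicator hΩ).comp (by fun_prop)
  have hle := hu.le_sphereMean x hxΩ r hr hxr
  have hs := sphereArea_pos hd
  have hne : extIntegral (surf d) (fun ω => u (x + r • (ω : E d))) ≠ ⊥ := by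
    intro h
    rw [sphereMean, h, EReal.coe_mul_bot_of_pos (by positivity)] at hle
    exact hx (le_bot_iff.1 hle)
  obtain ⟨h1, h2, h3⟩ := integrable_toReal_of_extIntegral_ne_bot hmeas
    (fun ω => hC _ (add_smul_mem_closedBall x hr.le ω)) hne
  refine ⟨h1, h2, ?_⟩
  rw [sphereMean, h3, ← EReal.coe_mul, ← EReal.coe_toReal (hu.lt_top x hxΩ).ne hx,
    EReal.coe_le_coe_iff] at hle
  rwa [← le_inv_mul_iff₀ hs]

/-- With `C` an upper bound of `u`, the submean inequality bounds the integral of `C - u` over each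
sphere about `x` by `sphereArea d * (C - u x)`; integration over the radii bounds it on the ball. -/
theorem integrableOn_ball (hd : 2 ≤ d) (hu : SubharmonicOn u Ω) (hΩ : IsOpen Ω) {x : E d} {r : ℝ}
    (hxr : closedBall x r ⊆ Ω) (hx : u x ≠ ⊥) :
    IntegrableOn (fun y => (u y).toReal) (ball x r) ∧
      ∀ᵐ y ∂volume.restrict (ball x r), u y ≠ ⊥ := by
  obtain ⟨C, hC0, hC⟩ := hu.exists_bound (isCompact_closedBall x r) hxr
  set v := Ω.indicator u with hv
  have hvm : Measurable v := hu.measurable_indicator hΩ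
  have hvu : ∀ y ∈ closedBall x r, v y = u y := fun y hy => indicator_of_mem (hxr hy) u
  have hgm := measurable_gap C
  set F : E d → ℝ≥0∞ := (ball (0 : E d) r).indicator fun y => gap C (v (x + y)) with hF
  have hFm : Measurable F := (hgm.comp (hvm.comp (by fun_prop))).indicator measurableSet_ball
  have hF1 : ∫⁻ y, F y = ∫⁻ y in ball x r, gap C (v y) := by
    rw [← lintegral_add_left_eq_self (μ := (volume : Measure (E d))) _ (-x),
      ← lintegral_indicator measurableSet_ball]
    refine lintegral_congr fun y => ?_
    by_cases hy : y ∈ ball x r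
    · rw [indicator_of_mem hy, hF, indicator_of_mem]
      · simp
      · rw [mem_ball_zero_iff, neg_add_eq_sub]; rwa [mem_ball_iff_norm] at hy
    · rw [indicator_of_notMem hy, hF, indicator_of_notMem]
      rw [mem_ball_zero_iff, neg_add_eq_sub]; rwa [mem_ball_iff_norm] at hy
  have hfin : ∫⁻ y in ball x r, gap C (v y) < ⊤ := by
    rw [← hF1, lintegral_polar F hd hFm]
    have hb : ∀ t ∈ Ioi (0 : ℝ), ENNReal.ofReal (t ^ (d - 1)) * ∫⁻ ω, F (t • (ω : E d)) ∂surf d ≤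
        (Ioo (0 : ℝ) r).indicator (fun _ => ENNReal.ofReal (r ^ (d - 1)) *
          ENNReal.ofReal (sphereArea d * C - sphereArea d * (u x).toReal)) t := by
      intro t ht
      rw [mem_Ioi] at ht
      by_cases htr : t < r
      · rw [indicator_of_mem (show t ∈ Ioo 0 r from ⟨ht, htr⟩)]
        gcongr
        have hsub : closedBall x t ⊆ closedBall x r := closedBall_subset_closedBall htr.le
        obtain ⟨h1, h2, h3⟩ := submean hd hu hΩ ht (hsub.trans hxr) hx
        have hmem : ∀ ω : sphere (0 : E d) 1, x + t • (ω : E d) ∈ closedBall x r := fun ω =>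
          hsub (add_smul_mem_closedBall x ht.le ω)
        calc ∫⁻ ω, F (t • (ω : E d)) ∂surf d
            = ∫⁻ ω : sphere (0 : E d) 1,
                ENNReal.ofReal (C - (u (x + t • (ω : E d))).toReal) ∂surf d := by
              refine lintegral_congr_ae ?_
              filter_upwards [h1] with ω hω
              rw [hF, indicator_of_mem]
              · rw [hvu _ (hmem ω), gap_of_ne_bot]
                rw [hω]; simp
              · rw [mem_ball_zero_iff, norm_smul_sphere ht.le]; exact htr
          _ = ENNReal.ofReal (∫ ω : sphere (0 : E d) 1,
                (C - (u (x + t • (ω : E d))).toReal) ∂surf d) := by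
              rw [ofReal_integral_eq_lintegral_ofReal
                (f := fun ω : sphere (0 : E d) 1 => C - (u (x + t • (ω : E d))).toReal)
                ((integrable_const C).sub h2)]
              filter_upwards [h1] with ω hω
              have := hC _ (hmem ω)
              rw [hω, EReal.coe_le_coe_iff] at this
              simpa using this
          _ ≤ _ := by
              rw [integral_sub (integrable_const C) h2, integral_const, surf_real_univ hd,
                smul_eq_mul]
              gcongr
      · have : ∀ ω : sphere (0 : E d) 1, F (t • (ω : E d)) = 0 := fun ω => by
          rw [hF, indicator_of_notMem]
          rw [mem_ball_zero_iff, norm_smul_sphere ht.le]; exact htr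
        simp [this]
    refine (setLIntegral_mono' measurableSet_Ioi hb).trans_lt ?_
    refine (setLIntegral_le_lintegral _ _).trans_lt ?_
    rw [lintegral_indicator measurableSet_Ioo, lintegral_const]
    refine ENNReal.mul_lt_top (ENNReal.mul_lt_top ENNReal.ofReal_lt_top ENNReal.ofReal_lt_top) ?_
    simp
  have : IsFiniteMeasure ((volume : Measure (E d)).restrict (ball x r)) :=
    ⟨by simpa using measure_ball_lt_top⟩
  have hmem := ae_restrict_mem (μ := (volume : Measure (E d))) (measurableSet_ball (x := x) (ε := r))
  have hvC : ∀ᵐ y ∂volume.restrict (ball x r), v y ≤ C := by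
    filter_upwards [hmem] with y hy
    rw [hvu y (ball_subset_closedBall hy)]
    exact hC y (ball_subset_closedBall hy)
  obtain ⟨h1, h2⟩ := integrable_toReal_of_lintegral_gap hvm hC0 hvC hfin.ne
  constructor
  · refine h2.congr ?_
    filter_upwards [hmem] with y hy
    rw [hvu y (ball_subset_closedBall hy)]
  · filter_upwards [h1, hmem] with y hy hyb
    rw [← hvu y (ball_subset_closedBall hyb), hy]
    simp

/-- Connectedness: the set of points near which `u` is integrable and almost everywhere finite is
open, closed relative to `Ω`, and contains a point where `u` is finite. -/
theorem exists_integrableOn_ball (hd : 2 ≤ d) (hu : SubharmonicOn u Ω) (hΩ : IsOpen Ω)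
    (hpre : IsPreconnected Ω) (hne : ∃ x ∈ Ω, u x ≠ ⊥) {x : E d} (hx : x ∈ Ω) :
    ∃ r > 0, IntegrableOn (fun y => (u y).toReal) (ball x r) ∧
      ∀ᵐ y ∂volume.restrict (ball x r), u y ≠ ⊥ := by
  set A : Set (E d) := {x | ∃ r > 0, IntegrableOn (fun y => (u y).toReal) (ball x r) ∧
      ∀ᵐ y ∂volume.restrict (ball x r), u y ≠ ⊥} with hA
  have hAo : IsOpen A := by
    rw [Metric.isOpen_iff]
    rintro x ⟨r, hr, h1, h2⟩
    refine ⟨r / 2, by positivity, fun y hy => ⟨r / 2, by positivity, ?_⟩⟩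
    have : ball y (r / 2) ⊆ ball x r := by
      refine ball_subset_ball' ?_
      rw [mem_ball] at hy
      linarith
    exact ⟨h1.mono_set this, ae_restrict_of_ae_restrict_of_subset this h2⟩
  have hcl : closure A ∩ Ω ⊆ A := by
    rintro x ⟨hxA, hxΩ⟩
    obtain ⟨ε, hε, hεΩ⟩ := Metric.isOpen_iff.1 hΩ x hxΩ
    obtain ⟨y, hyA, hxy⟩ := Metric.mem_closure_iff.1 hxA (ε / 4) (by positivity)
    obtain ⟨r, hr, h1, h2⟩ := hyA
    -- Near `y` the function is finite almost everywhere, so some `z` has a finite value. The radii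
    -- are such that `closedBall z (ε / 2)` stays in `ball x ε` while `ball z (ε / 2)` covers `ball
    -- x (ε / 8)`.
    obtain ⟨z, hz, hzb⟩ : ∃ z ∈ ball y (min r (ε / 8)), u z ≠ ⊥ := by
      by_contra hcon
      push Not at hcon
      have h3 := ae_restrict_of_ae_restrict_of_subset (ball_subset_ball (min_le_left r (ε / 8))) h2
      have h4 : ∀ᵐ z ∂volume.restrict (ball y (min r (ε / 8))), False := by
        filter_upwards [h3, ae_restrict_mem measurableSet_ball] with z hz hzm
        exact hz (hcon z hzm)
      rw [eventually_false_iff_eq_bot, ae_eq_bot, Measure.restrict_eq_zero] at h4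
      exact (measure_ball_pos volume y (lt_min hr (by positivity))).ne' h4
    have hzy : dist z y < ε / 8 := (mem_ball.1 hz).trans_le (min_le_right _ _)
    have hzx : dist z x < 3 * ε / 8 := by
      have := dist_triangle z y x
      rw [dist_comm] at hxy
      linarith
    have hsub : closedBall z (ε / 2) ⊆ Ω := by
      refine Subset.trans (fun w hw => ?_) hεΩ
      rw [mem_closedBall] at hw
      rw [mem_ball]
      have := dist_triangle w z x
      linarith
    obtain ⟨h5, h6⟩ := hu.integrableOn_ball hd hΩ hsub hzb
    have hsub' : ball x (ε / 8) ⊆ ball z (ε / 2) := by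
      refine ball_subset_ball' ?_
      rw [dist_comm]
      linarith
    exact ⟨ε / 8, by positivity, h5.mono_set hsub', ae_restrict_of_ae_restrict_of_subset hsub' h6⟩
  have hne' : (Ω ∩ A).Nonempty := by
    obtain ⟨z, hzΩ, hz⟩ := hne
    obtain ⟨ε, hε, hεΩ⟩ := Metric.isOpen_iff.1 hΩ z hzΩ
    have hsub : closedBall z (ε / 2) ⊆ Ω := (closedBall_subset_ball (by linarith)).trans hεΩ
    exact ⟨z, hzΩ, ε / 2, by positivity, hu.integrableOn_ball hd hΩ hsub hz⟩
  exact hpre.subset_of_closure_inter_subset hAo hne' hcl hx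

theorem integrableOn_compact (hd : 2 ≤ d) (hu : SubharmonicOn u Ω) (hΩ : IsOpen Ω)
    (hpre : IsPreconnected Ω) (hne : ∃ x ∈ Ω, u x ≠ ⊥) {K : Set (E d)} (hK : IsCompact K)
    (hKΩ : K ⊆ Ω) : IntegrableOn (fun y => (u y).toReal) K := by
  have : LocallyIntegrableOn (fun y => (u y).toReal) Ω := by
    intro x hx
    obtain ⟨r, hr, h1, -⟩ := hu.exists_integrableOn_ball hd hΩ hpre hne hx
    exact ⟨ball x r, mem_nhdsWithin_of_mem_nhds (ball_mem_nhds x hr), h1⟩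
  exact this.integrableOn_compact_subset hKΩ hK

theorem ae_ne_bot (hd : 2 ≤ d) (hu : SubharmonicOn u Ω) (hΩ : IsOpen Ω)
    (hpre : IsPreconnected Ω) (hne : ∃ x ∈ Ω, u x ≠ ⊥) : ∀ᵐ x, x ∈ Ω → u x ≠ ⊥ := by
  rw [ae_iff]
  refine measure_null_of_locally_null _ fun x hx => ?_
  simp only [mem_ofPred_eq, Classical.not_imp] at hx
  obtain ⟨r, hr, -, h2⟩ := hu.exists_integrableOn_ball hd hΩ hpre hne hx.1
  refine ⟨_ ∩ ball x r, inter_mem_nhdsWithin _ (ball_mem_nhds x hr), ?_⟩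
  rw [ae_restrict_iff' measurableSet_ball, ae_iff] at h2
  refine measure_mono_null ?_ h2
  rintro y ⟨hy, hyb⟩
  simp only [mem_ofPred_eq, Classical.not_imp] at hy ⊢
  exact ⟨hyb, hy.2⟩

end SubharmonicOn

/-! ### The radial mollifier. -/

theorem two_le_infty : (2 : WithTop ℕ∞) ≤ ((⊤ : ℕ∞) : WithTop ℕ∞) :=
  WithTop.coe_le_coe.2 (le_top : (2 : ℕ∞) ≤ ⊤)

/-- The normalised radial bump function supported in the ball of radius `ε`. -/
def eta (ε : ℝ) (x : E d) : ℝ :=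
  (∫ y : E d, Real.smoothTransition (1 - ‖y‖ ^ 2 / ε ^ 2))⁻¹ *
    Real.smoothTransition (1 - ‖x‖ ^ 2 / ε ^ 2)

/-- The radial profile of `eta`. -/
def etaProfile (d : ℕ) (ε t : ℝ) : ℝ :=
  (∫ y : E d, Real.smoothTransition (1 - ‖y‖ ^ 2 / ε ^ 2))⁻¹ *
    Real.smoothTransition (1 - t ^ 2 / ε ^ 2)

theorem eta_eq_profile (ε : ℝ) (x : E d) : eta ε x = etaProfile d ε ‖x‖ := rfl

theorem eta_nonneg (ε : ℝ) (x : E d) : 0 ≤ eta ε x :=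
  mul_nonneg (inv_nonneg.2 (integral_nonneg fun _ => Real.smoothTransition.nonneg _))
    (Real.smoothTransition.nonneg _)

theorem eta_neg (ε : ℝ) (x : E d) : eta ε (-x) = eta ε x := by simp [eta]

theorem contDiff_eta (ε : ℝ) : ContDiff ℝ ((⊤ : ℕ∞) : WithTop ℕ∞) (eta ε : E d → ℝ) := by
  refine contDiff_const.mul (Real.smoothTransition.contDiff.comp ?_)
  exact contDiff_const.sub ((contDiff_norm_sq ℝ).div_const _)

theorem continuous_eta (ε : ℝ) : Continuous (eta ε : E d → ℝ) := (contDiff_eta ε).continuous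

theorem smoothTransition_eq_zero {ε : ℝ} (hε : 0 < ε) {x : E d} (hx : ε ≤ ‖x‖) :
    Real.smoothTransition (1 - ‖x‖ ^ 2 / ε ^ 2) = 0 := by
  refine Real.smoothTransition.zero_of_nonpos ?_
  have : 1 ≤ ‖x‖ ^ 2 / ε ^ 2 := by
    rw [one_le_div (by positivity)]
    gcongr
  linarith

theorem eta_eq_zero {ε : ℝ} (hε : 0 < ε) {x : E d} (hx : ε ≤ ‖x‖) : eta ε x = 0 := by
  rw [eta, smoothTransition_eq_zero hε hx, mul_zero]

theorem tsupport_eta {ε : ℝ} (hε : 0 < ε) : tsupport (eta ε : E d → ℝ) ⊆ closedBall 0 ε := by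
  refine closure_minimal (fun x hx => ?_) isClosed_closedBall
  rw [mem_closedBall_zero_iff]
  by_contra h
  exact hx (eta_eq_zero hε (not_le.1 h).le)

theorem hasCompactSupport_eta {ε : ℝ} (hε : 0 < ε) : HasCompactSupport (eta ε : E d → ℝ) :=
  (isCompact_closedBall (0 : E d) ε).of_isClosed_subset (isClosed_tsupport _) (tsupport_eta hε)

theorem integrable_eta {ε : ℝ} (hε : 0 < ε) : Integrable (eta ε : E d → ℝ) :=
  (continuous_eta ε).integrable_of_hasCompactSupport (hasCompactSupport_eta hε)

theorem integral_eta {ε : ℝ} (hε : 0 < ε) : ∫ x : E d, eta ε x = 1 := by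
  simp only [eta]
  rw [integral_const_mul]
  refine inv_mul_cancel₀ (ne_of_gt ?_)
  have hc : Continuous fun y : E d => Real.smoothTransition (1 - ‖y‖ ^ 2 / ε ^ 2) :=
    Real.smoothTransition.continuous.comp (by fun_prop)
  have hs : HasCompactSupport fun y : E d => Real.smoothTransition (1 - ‖y‖ ^ 2 / ε ^ 2) := by
    refine HasCompactSupport.of_support_subset_isCompact (isCompact_closedBall (0 : E d) ε) ?_
    intro x hx
    rw [mem_closedBall_zero_iff]
    by_contra h
    exact hx (smoothTransition_eq_zero hε (not_le.1 h).le)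
  refine hc.integral_pos_of_hasCompactSupport_nonneg_nonzero hs
    (fun _ => Real.smoothTransition.nonneg _) (x := 0) ?_
  simp

theorem exists_eta_le (ε : ℝ) : ∃ B : ℝ, 0 ≤ B ∧ ∀ x : E d, eta ε x ≤ B := by
  refine ⟨(∫ y : E d, Real.smoothTransition (1 - ‖y‖ ^ 2 / ε ^ 2))⁻¹,
    inv_nonneg.2 (integral_nonneg fun _ => Real.smoothTransition.nonneg _), fun x => ?_⟩
  refine mul_le_of_le_one_right (inv_nonneg.2
    (integral_nonneg fun _ => Real.smoothTransition.nonneg _)) (Real.smoothTransition.le_one _)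

/-- The regularisation of `w` at scale `ε`. -/
def moll (ε : ℝ) (w : E d → ℝ) : E d → ℝ := w ⋆[ContinuousLinearMap.mul ℝ ℝ, volume] eta ε

theorem moll_apply (ε : ℝ) (w : E d → ℝ) (x : E d) :
    moll ε w x = ∫ y, w y * eta ε (x - y) := rfl

theorem moll_apply_add (ε : ℝ) (w : E d → ℝ) (x : E d) :
    moll ε w x = ∫ y, w (x + y) * eta ε y := by
  rw [moll_apply, ← integral_add_left_eq_self _ x]
  refine integral_congr_ae (Eventually.of_forall fun y => ?_)
  simp only [sub_add_cancel_left, eta_neg]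

theorem contDiff_moll {ε : ℝ} (hε : 0 < ε) {w : E d → ℝ} (hw : LocallyIntegrable w) :
    ContDiff ℝ ((⊤ : ℕ∞) : WithTop ℕ∞) (moll ε w) :=
  (hasCompactSupport_eta hε).contDiff_convolution_right _ hw (contDiff_eta ε)

theorem contDiff_two_moll {ε : ℝ} (hε : 0 < ε) {w : E d → ℝ} (hw : LocallyIntegrable w) :
    ContDiff ℝ 2 (moll ε w) :=
  (contDiff_moll hε hw).of_le two_le_infty

theorem fderiv_convolution_apply {w χ : E d → ℝ} (hw : LocallyIntegrable w)
    (hχ : ContDiff ℝ 1 χ) (hc : HasCompactSupport χ) (x v : E d) :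
    fderiv ℝ (w ⋆[ContinuousLinearMap.mul ℝ ℝ, volume] χ) x v =
      (w ⋆[ContinuousLinearMap.mul ℝ ℝ, volume] fun y => fderiv ℝ χ y v) x := by
  rw [(hc.hasFDerivAt_convolution_right _ hw hχ x).fderiv]
  exact convolution_precompR_apply _ hw (hc.fderiv ℝ) (hχ.continuous_fderiv (by norm_num)) x v

/-- Both derivatives fall on the smooth factor, so local integrability of `w` is enough. -/
theorem laplacian_moll {ε : ℝ} (hε : 0 < ε) {w : E d → ℝ} (hw : LocallyIntegrable w) (x : E d) :
    (Δ (moll ε w)) x = ∫ y, w y * (Δ (eta ε : E d → ℝ)) (x - y) := by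
  have hη : ContDiff ℝ 2 (eta ε : E d → ℝ) := (contDiff_eta ε).of_le two_le_infty
  have hcs := hasCompactSupport_eta (d := d) hε
  have h1 : ∀ v, (fun x => fderiv ℝ (moll ε w) x v) =
      (w ⋆[ContinuousLinearMap.mul ℝ ℝ, volume] fun y => fderiv ℝ (eta ε) y v) := fun v =>
    funext fun x => fderiv_convolution_apply hw (hη.of_le (by norm_num)) hcs x v
  rw [laplacian_eq_sum (contDiff_two_moll hε hw)]
  simp only [h1, laplacian_eq_sum hη, Finset.mul_sum]
  rw [integral_finsetSum]
  · refine Finset.sum_congr rfl fun i _ => ?_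
    rw [fderiv_convolution_apply hw (continuous_fderiv_apply hη _) (hcs.fderiv_apply ℝ _)]
    rfl
  · intro i _
    have h3 := (continuous_fderiv_apply hη (EuclideanSpace.basisFun (Fin d) ℝ i)).continuous_fderiv
      (by norm_num)
    exact ((hcs.fderiv_apply ℝ (EuclideanSpace.basisFun (Fin d) ℝ i)).fderiv_apply ℝ
      (EuclideanSpace.basisFun (Fin d) ℝ i)).convolutionExists_right
        (ContinuousLinearMap.mul ℝ ℝ) hw (h3.clm_apply continuous_const) x

theorem integrable_mul_eta (ε : ℝ) {w : E d → ℝ} (hw : Integrable w) (x : E d) :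
    Integrable fun y => w (x + y) * eta ε y := by
  obtain ⟨B, hB0, hB⟩ := exists_eta_le (d := d) ε
  refine Integrable.mul_bdd (hw.comp_add_left x) (c := B)
    (continuous_eta ε).aestronglyMeasurable (Eventually.of_forall fun y => ?_)
  rw [Real.norm_of_nonneg (eta_nonneg ε y)]
  exact hB y

theorem moll_le {ε : ℝ} (hε : 0 < ε) {w : E d → ℝ} (hw : Integrable w) {x : E d} {C : ℝ}
    (hC : ∀ᵐ y, y ∈ ball x ε → w y ≤ C) : moll ε w x ≤ C := by
  have hC' : ∀ᵐ y, x + y ∈ ball x ε → w (x + y) ≤ C :=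
    (measurePreserving_add_left (volume : Measure (E d)) x).quasiMeasurePreserving.ae hC
  rw [moll_apply_add]
  calc ∫ y, w (x + y) * eta ε y ≤ ∫ y, C * eta ε y := by
        refine integral_mono_ae (integrable_mul_eta ε hw x) ((integrable_eta hε).const_mul C) ?_
        filter_upwards [hC'] with y hy
        by_cases h : ‖y‖ < ε
        · exact mul_le_mul_of_nonneg_right (hy (by simpa using h)) (eta_nonneg ε y)
        · simp [eta_eq_zero hε (not_lt.1 h)]
    _ = C := by rw [integral_const_mul, integral_eta hε, mul_one]

/-! ### Regularisations of a subharmonic function. -/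

/-- The function `u`, made real and cut off outside the closed ball of radius `R`. -/
def trunc (u : E d → EReal) (R : ℝ) : E d → ℝ :=
  (closedBall (0 : E d) R).indicator fun x => (u x).toReal

theorem trunc_of_mem {u : E d → EReal} {R : ℝ} {x : E d} (hx : x ∈ closedBall (0 : E d) R) :
    trunc u R x = (u x).toReal := indicator_of_mem hx _

namespace SubharmonicOn

variable {u : E d → EReal} {Ω : Set (E d)} {R : ℝ}

theorem measurable_trunc (hu : SubharmonicOn u Ω) (hΩ : IsOpen Ω) (hR : closedBall 0 R ⊆ Ω) :
    Measurable (trunc u R) := by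
  have : trunc u R = (closedBall (0 : E d) R).indicator fun x => (Ω.indicator u x).toReal := by
    ext x
    by_cases hx : x ∈ closedBall (0 : E d) R
    · rw [trunc, indicator_of_mem hx, indicator_of_mem hx, indicator_of_mem (hR hx)]
    · rw [trunc, indicator_of_notMem hx, indicator_of_notMem hx]
  rw [this]
  exact (hu.measurable_indicator hΩ).ereal_toReal.indicator measurableSet_closedBall

theorem integrable_trunc (hd : 2 ≤ d) (hu : SubharmonicOn u Ω) (hΩ : IsOpen Ω)
    (hpre : IsPreconnected Ω) (hne : ∃ x ∈ Ω, u x ≠ ⊥) (hR : closedBall 0 R ⊆ Ω) :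
    Integrable (trunc u R) :=
  (integrable_indicator_iff measurableSet_closedBall).2
    (hu.integrableOn_compact hd hΩ hpre hne (isCompact_closedBall 0 R) hR)

/-- Since `eta` is radial with total mass one, the regularisation is an average of spherical means
of `u` about `x`, each at least `u x`. -/
theorem le_moll (hd : 2 ≤ d) (hu : SubharmonicOn u Ω) (hΩ : IsOpen Ω)
    (hpre : IsPreconnected Ω) (hne : ∃ x ∈ Ω, u x ≠ ⊥) (hR : closedBall 0 R ⊆ Ω) {ε : ℝ}
    (hε : 0 < ε) {x : E d} (hx : ‖x‖ + ε ≤ R) (hxb : u x ≠ ⊥) :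
    (u x).toReal ≤ moll ε (trunc u R) x := by
  have hw := hu.integrable_trunc hd hΩ hpre hne hR
  have hi1 := integrable_mul_eta ε hw x
  have hi2 := (integrable_eta (d := d) hε).const_mul (u x).toReal
  have hnn : 0 ≤ ∫ y, (trunc u R (x + y) * eta ε y - (u x).toReal * eta ε y) := by
    rw [integral_polar hd (f := fun y => trunc u R (x + y) * eta ε y - (u x).toReal * eta ε y)
      (hi1.sub hi2)]
    refine setIntegral_nonneg measurableSet_Ioi fun t ht => ?_
    rw [mem_Ioi] at ht
    refine mul_nonneg (by positivity) ?_
    by_cases htε : t < ε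
    · have hsub : closedBall x t ⊆ closedBall 0 R := by
        refine closedBall_subset_closedBall' ?_
        rw [dist_zero_right]; linarith
      obtain ⟨-, h2, h3⟩ := hu.submean hd hΩ ht (hsub.trans hR) hxb
      have : ∀ ω : sphere (0 : E d) 1, trunc u R (x + t • (ω : E d)) * eta ε (t • (ω : E d)) -
          (u x).toReal * eta ε (t • (ω : E d)) =
          etaProfile d ε t * ((u (x + t • (ω : E d))).toReal - (u x).toReal) := by
        intro ω
        rw [trunc_of_mem (hsub (add_smul_mem_closedBall x ht.le ω)), eta_eq_profile,
          norm_smul_sphere ht.le]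
        ring
      simp only [this]
      rw [integral_const_mul, integral_sub h2 (integrable_const _), integral_const,
        surf_real_univ hd, smul_eq_mul]
      refine mul_nonneg ?_ (by linarith)
      exact mul_nonneg (inv_nonneg.2 (integral_nonneg fun _ => Real.smoothTransition.nonneg _))
        (Real.smoothTransition.nonneg _)
    · refine integral_nonneg fun ω => ?_
      simp only [Pi.zero_apply]
      rw [eta_eq_zero hε (by rw [norm_smul_sphere ht.le]; exact not_lt.1 htε)]
      simp
  rw [integral_sub hi1 hi2, integral_const_mul, integral_eta hε, ← moll_apply_add] at hnn
  linarith

/-- The regularisation is an average of translates of `u`; each inherits the submean inequality, and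
Fubini exchanges the average with the spherical integral. -/
theorem submean_moll (hd : 2 ≤ d) (hu : SubharmonicOn u Ω) (hΩ : IsOpen Ω)
    (hpre : IsPreconnected Ω) (hne : ∃ x ∈ Ω, u x ≠ ⊥) (hR : closedBall 0 R ⊆ Ω) {ε r : ℝ}
    (hε : 0 < ε) (hr : 0 < r) {x : E d} (hx : ‖x‖ + ε + r ≤ R) :
    sphereArea d * moll ε (trunc u R) x ≤
      ∫ ω, moll ε (trunc u R) (x + r • (ω : E d)) ∂surf d := by
  have hw := hu.integrable_trunc hd hΩ hpre hne hR
  have hwm := hu.measurable_trunc hΩ hR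
  set w := trunc u R with hwdef
  obtain ⟨B, hB0, hB⟩ := exists_eta_le (d := d) ε
  set H : E d × sphere (0 : E d) 1 → ℝ := fun p => w (x + r • (p.2 : E d) + p.1) * eta ε p.1 with hH
  have hHm : Measurable H :=
    (hwm.comp (by fun_prop)).mul ((continuous_eta ε).measurable.comp measurable_fst)
  have hHi : Integrable H (volume.prod (surf d)) := by
    refine ⟨hHm.aestronglyMeasurable, ?_⟩
    rw [hasFiniteIntegral_iff_enorm, lintegral_prod_symm' _ (by fun_prop)]
    have hb : ∀ ω : sphere (0 : E d) 1, ∫⁻ y, ‖H (y, ω)‖ₑ ≤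
        (∫⁻ y, ‖w y‖ₑ) * ENNReal.ofReal B := by
      intro ω
      rw [← lintegral_mul_const _ (by fun_prop),
        ← lintegral_add_left_eq_self (fun y => ‖w y‖ₑ * ENNReal.ofReal B) (x + r • (ω : E d))]
      refine lintegral_mono fun y => ?_
      simp only [hH, enorm_mul]
      gcongr
      rw [Real.enorm_eq_ofReal (eta_nonneg ε y)]
      exact ENNReal.ofReal_le_ofReal (hB y)
    refine (lintegral_mono hb).trans_lt ?_
    rw [lintegral_const]
    refine ENNReal.mul_lt_top (ENNReal.mul_lt_top ?_ ENNReal.ofReal_lt_top) (measure_lt_top _ _)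
    exact (hasFiniteIntegral_iff_enorm.1 hw.2)
  have hae : ∀ᵐ y : E d, x + y ∈ Ω → u (x + y) ≠ ⊥ :=
    (measurePreserving_add_left (volume : Measure (E d)) x).quasiMeasurePreserving.ae
      (hu.ae_ne_bot hd hΩ hpre hne)
  calc sphereArea d * moll ε w x = ∫ y, sphereArea d * (w (x + y) * eta ε y) := by
        rw [integral_const_mul, moll_apply_add]
    _ ≤ ∫ y, ∫ ω, H (y, ω) ∂surf d := by
        refine integral_mono_ae ((integrable_mul_eta ε hw x).const_mul _) hHi.integral_prod_left ?_
        filter_upwards [hae] with y hy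
        simp only [hH, integral_mul_const]
        by_cases h : ‖y‖ < ε
        · have hsub : closedBall (x + y) r ⊆ closedBall 0 R := by
            refine closedBall_subset_closedBall' ?_
            rw [dist_zero_right]
            have := norm_add_le x y
            linarith
          have hmem := hsub (mem_closedBall_self hr.le)
          obtain ⟨-, h2, h3⟩ := hu.submean hd hΩ hr (hsub.trans hR) (hy (hR hmem))
          rw [← mul_assoc]
          refine mul_le_mul_of_nonneg_right ?_ (eta_nonneg ε y)
          rw [hwdef, trunc_of_mem hmem]
          refine h3.trans_eq (integral_congr_ae (Eventually.of_forall fun ω => ?_))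
          simp only
          rw [show x + r • (ω : E d) + y = x + y + r • (ω : E d) by abel,
            trunc_of_mem (hsub (add_smul_mem_closedBall _ hr.le ω))]
        · simp [eta_eq_zero hε (not_lt.1 h)]
    _ = ∫ ω, (∫ y, H (y, ω)) ∂surf d :=
        integral_integral_swap (f := fun y ω => H (y, ω)) hHi
    _ = _ := by
        refine integral_congr_ae (Eventually.of_forall fun ω => ?_)
        simp only [moll_apply_add, hH]

theorem laplacian_moll_nonneg (hd : 2 ≤ d) (hu : SubharmonicOn u Ω) (hΩ : IsOpen Ω)
    (hpre : IsPreconnected Ω) (hne : ∃ x ∈ Ω, u x ≠ ⊥) (hR : closedBall 0 R ⊆ Ω) {ε : ℝ}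
    (hε : 0 < ε) {x : E d} (hx : ‖x‖ + ε < R) : 0 ≤ (Δ (moll ε (trunc u R))) x := by
  refine laplacian_nonneg_of_submean hd
    (contDiff_two_moll hε (hu.integrable_trunc hd hΩ hpre hne hR).locallyIntegrable)
    (sub_pos.2 hx) fun r hr hrδ => ?_
  exact hu.submean_moll hd hΩ hpre hne hR hε hr (by linarith)

end SubharmonicOn

/-! ### Convergence of the regularisations, pointwise and on spheres. -/

/-- The scales of regularisation. -/
def scale (n : ℕ) : ℝ := 1 / ((n : ℝ) + 1)

theorem scale_pos (n : ℕ) : 0 < scale n := Nat.one_div_pos_of_nat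

theorem eventually_scale_lt {δ : ℝ} (hδ : 0 < δ) : ∀ᶠ n in atTop, scale n < δ :=
  (tendsto_one_div_add_atTop_nhds_zero_nat (𝕜 := ℝ)).eventually_lt_const hδ

theorem integrable_sphere_comp {f : E d → ℝ} (hf : Continuous f) (t : ℝ) :
    Integrable (fun ω : sphere (0 : E d) 1 => f (t • (ω : E d))) (surf d) :=
  (by fun_prop : Continuous fun ω : sphere (0 : E d) 1 =>
    f (t • (ω : E d))).integrable_of_hasCompactSupport (HasCompactSupport.of_compactSpace _)

namespace SubharmonicOn

variable {u : E d → EReal} {Ω : Set (E d)} {R : ℝ}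

theorem moll_trunc_le (hd : 2 ≤ d) (hu : SubharmonicOn u Ω) (hΩ : IsOpen Ω)
    (hpre : IsPreconnected Ω) (hne : ∃ x ∈ Ω, u x ≠ ⊥) (hR : closedBall 0 R ⊆ Ω) {ε C : ℝ}
    (hε : 0 < ε) {x : E d} (hx : ‖x‖ + ε ≤ R) (hC : ∀ y ∈ ball x ε, u y ≤ C) :
    moll ε (trunc u R) x ≤ C := by
  refine moll_le hε (hu.integrable_trunc hd hΩ hpre hne hR) ?_
  filter_upwards [hu.ae_ne_bot hd hΩ hpre hne] with y hy hyb
  have hmem : y ∈ closedBall (0 : E d) R := by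
    rw [mem_closedBall_zero_iff]
    rw [mem_ball_iff_norm] at hyb
    have := norm_sub_norm_le y x
    linarith
  rw [trunc_of_mem hmem]
  have := EReal.toReal_le_toReal (hC y hyb) (hy (hR hmem)) (EReal.coe_ne_top _)
  simpa using this

/-- Upper semicontinuity gives `u < c` on a whole ball about `x`, and an average over a smaller ball
cannot exceed `c`. The case `u x = ⊥` is included. -/
theorem eventually_moll_le (hd : 2 ≤ d) (hu : SubharmonicOn u Ω) (hΩ : IsOpen Ω)
    (hpre : IsPreconnected Ω) (hne : ∃ x ∈ Ω, u x ≠ ⊥) (hR : closedBall 0 R ⊆ Ω) {x : E d}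
    (hx : ‖x‖ < R) {c : ℝ} (hc : u x < c) :
    ∀ᶠ n in atTop, moll (scale n) (trunc u R) x ≤ c := by
  have hxΩ : x ∈ Ω := hR (by simpa using hx.le)
  have h1 := hu.upperSemicontinuousOn x hxΩ c hc
  rw [hΩ.nhdsWithin_eq hxΩ] at h1
  obtain ⟨δ, hδ, hδ'⟩ := Metric.eventually_nhds_iff.1 h1
  filter_upwards [eventually_scale_lt hδ, eventually_scale_lt (sub_pos.2 hx)] with n h2 h3
  refine hu.moll_trunc_le hd hΩ hpre hne hR (scale_pos n) (by linarith) fun y hy => ?_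
  exact (hδ' ((mem_ball.1 hy).trans h2)).le

theorem tendsto_moll (hd : 2 ≤ d) (hu : SubharmonicOn u Ω) (hΩ : IsOpen Ω)
    (hpre : IsPreconnected Ω) (hne : ∃ x ∈ Ω, u x ≠ ⊥) (hR : closedBall 0 R ⊆ Ω) {x : E d}
    (hx : ‖x‖ < R) (hxb : u x ≠ ⊥) :
    Tendsto (fun n => moll (scale n) (trunc u R) x) atTop (𝓝 (u x).toReal) := by
  have hxΩ : x ∈ Ω := hR (by simpa using hx.le)
  have hco := EReal.coe_toReal (hu.lt_top x hxΩ).ne hxb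
  refine tendsto_order.2 ⟨fun c hc => ?_, fun c hc => ?_⟩
  · filter_upwards [eventually_scale_lt (sub_pos.2 hx)] with n h3
    exact hc.trans_le (hu.le_moll hd hΩ hpre hne hR (scale_pos n) (by linarith) hxb)
  · obtain ⟨c', h1, h2⟩ := exists_between hc
    have : u x < c' := by rw [← hco]; exact_mod_cast h1
    filter_upwards [hu.eventually_moll_le hd hΩ hpre hne hR hx this] with n hn
    exact hn.trans_lt h2

/-- The pointwise input for Fatou's lemma. It uses only the upper estimate on regularisations, so it
also covers points where `u = ⊥`, before these are known to be null on spheres. -/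
theorem gap_le_liminf (hd : 2 ≤ d) (hu : SubharmonicOn u Ω) (hΩ : IsOpen Ω)
    (hpre : IsPreconnected Ω) (hne : ∃ x ∈ Ω, u x ≠ ⊥) (hR : closedBall 0 R ⊆ Ω) {x : E d}
    (hx : ‖x‖ < R) (C : ℝ) :
    gap C (u x) ≤ liminf (fun n => ENNReal.ofReal (C - moll (scale n) (trunc u R) x)) atTop := by
  have hxΩ : x ∈ Ω := hR (by simpa using hx.le)
  refine le_of_forall_lt fun a ha => ?_
  obtain ⟨a, ha', ha⟩ := exists_between ha
  refine ha'.trans_le ?_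
  have hat : a ≠ ⊤ := (ha.trans_le le_top).ne
  have hlt : u x < ((C - a.toReal : ℝ) : EReal) := by
    by_cases hb : u x = ⊥
    · rw [hb]; exact EReal.bot_lt_coe _
    · rw [gap_of_ne_bot C hb, ENNReal.lt_ofReal_iff_toReal_lt hat] at ha
      rw [← EReal.coe_toReal (hu.lt_top x hxΩ).ne hb, EReal.coe_lt_coe_iff]
      linarith
  refine le_liminf_of_le (by isBoundedDefault) ?_
  filter_upwards [hu.eventually_moll_le hd hΩ hpre hne hR hx hlt] with n hn
  rw [← ENNReal.ofReal_toReal hat]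
  exact ENNReal.ofReal_le_ofReal (by linarith)

/-- Local integrability in polar coordinates makes almost every centred sphere good; a single good
one, of arbitrarily small radius, is enough to start from. -/
theorem exists_sphere_gap_lt_top (hd : 2 ≤ d) (hu : SubharmonicOn u Ω) (hΩ : IsOpen Ω)
    (hpre : IsPreconnected Ω) (hne : ∃ x ∈ Ω, u x ≠ ⊥) (hR : closedBall 0 R ⊆ Ω) {r C : ℝ}
    (hr : 0 < r) (hrR : r ≤ R) :
    ∃ t, 0 < t ∧ t < r ∧ ∫⁻ ω, gap C (u (t • (ω : E d))) ∂surf d < ⊤ := by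
  set v := Ω.indicator u with hv
  have hvm : Measurable v := hu.measurable_indicator hΩ
  have hgm := measurable_gap C
  have hvu : ∀ y ∈ closedBall (0 : E d) R, v y = u y := fun y hy => indicator_of_mem (hR hy) u
  set F : E d → ℝ≥0∞ := (ball (0 : E d) r).indicator fun y => gap C (v y) with hF
  have hFm : Measurable F := (hgm.comp hvm).indicator measurableSet_ball
  have hsub : ball (0 : E d) r ⊆ closedBall 0 R :=
    ball_subset_closedBall.trans (closedBall_subset_closedBall hrR)
  have hfin : ∫⁻ y, F y < ⊤ := by
    rw [hF, lintegral_indicator measurableSet_ball]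
    have hi : IntegrableOn (fun y => C - (u y).toReal) (ball (0 : E d) r) := by
      refine IntegrableOn.mono_set ?_ hsub
      exact (integrableOn_const (by simpa using measure_closedBall_lt_top.ne)).sub
        (hu.integrableOn_compact hd hΩ hpre hne (isCompact_closedBall 0 R) hR)
    refine lt_of_eq_of_lt ?_ hi.lintegral_lt_top
    refine setLIntegral_congr_fun_ae measurableSet_ball ?_
    filter_upwards [hu.ae_ne_bot hd hΩ hpre hne] with y hy hyb
    rw [hvu y (hsub hyb), gap_of_ne_bot C (hy (hR (hsub hyb)))]
  rw [lintegral_polar F hd hFm] at hfin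
  have hmeas : Measurable fun t : ℝ => ENNReal.ofReal (t ^ (d - 1)) *
      ∫⁻ ω, F (t • (ω : E d)) ∂surf d := by
    refine Measurable.mul (by fun_prop) ?_
    exact Measurable.lintegral_prod_right' (f := fun p : ℝ × sphere (0 : E d) 1 =>
      F (p.1 • (p.2 : E d))) (hFm.comp (by fun_prop))
  have h1 := ae_lt_top hmeas hfin.ne
  have h2 : ∀ᵐ t ∂volume.restrict (Ioo (0 : ℝ) r), ENNReal.ofReal (t ^ (d - 1)) *
      ∫⁻ ω, F (t • (ω : E d)) ∂surf d < ⊤ :=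
    ae_restrict_of_ae_restrict_of_subset Ioo_subset_Ioi_self h1
  have hnb : (ae ((volume : Measure ℝ).restrict (Ioo 0 r))).NeBot := by
    rw [ae_neBot, Ne, Measure.restrict_eq_zero]
    simp [hr]
  obtain ⟨t, ht, htI⟩ := (h2.and (ae_restrict_mem measurableSet_Ioo)).exists
  refine ⟨t, htI.1, htI.2, ?_⟩
  have h3 := ENNReal.lt_top_of_mul_ne_top_right ht.ne
    (by rw [Ne, ENNReal.ofReal_eq_zero, not_le]; exact pow_pos htI.1 _)
  refine lt_of_eq_of_lt (lintegral_congr fun ω => ?_) h3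
  have hmem : t • (ω : E d) ∈ ball (0 : E d) r := by
    rw [mem_ball_zero_iff, norm_smul_sphere htI.1.le]; exact htI.2
  rw [hF, indicator_of_mem hmem, hvu _ (hsub hmem)]

/-- A subharmonic function on a ball is integrable over the spheres with the same centre. -/
theorem sphere_integrable (hd : 2 ≤ d) (hu : SubharmonicOn u Ω) (hΩ : IsOpen Ω)
    (hpre : IsPreconnected Ω) (hne : ∃ x ∈ Ω, u x ≠ ⊥) (hR : closedBall 0 R ⊆ Ω) {r : ℝ}
    (hr : 0 < r) (hrR : r < R) :
    (∀ᵐ ω : sphere (0 : E d) 1 ∂surf d, u (r • (ω : E d)) = (u (r • (ω : E d))).toReal) ∧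
    Integrable (fun ω : sphere (0 : E d) 1 => (u (r • (ω : E d))).toReal) (surf d) := by
  obtain ⟨C, hC0, hC⟩ := hu.exists_bound (isCompact_closedBall 0 R) hR
  obtain ⟨t, ht0, htr, ht⟩ := hu.exists_sphere_gap_lt_top hd hΩ hpre hne hR (C := C) hr hrR.le
  have hw := hu.integrable_trunc hd hΩ hpre hne hR
  have hmem : ∀ {s : ℝ}, 0 < s → s ≤ R → ∀ ω : sphere (0 : E d) 1,
      s • (ω : E d) ∈ closedBall (0 : E d) R := fun hs hsR ω => by
    rw [mem_closedBall_zero_iff, norm_smul_sphere hs.le]; exact hsR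
  have hmeas : Measurable fun ω : sphere (0 : E d) 1 => u (r • (ω : E d)) := by
    have h1 : (fun ω : sphere (0 : E d) 1 => u (r • (ω : E d))) =
        fun ω : sphere (0 : E d) 1 => Ω.indicator u (r • (ω : E d)) := by
      ext ω
      rw [indicator_of_mem (hR (hmem hr hrR.le ω))]
    rw [h1]
    exact (hu.measurable_indicator hΩ).comp (by fun_prop)
  refine integrable_toReal_of_lintegral_gap hmeas hC0
    (Eventually.of_forall fun ω => hC _ (hmem hr hrR.le ω)) (ne_of_lt ?_)
  have hcont : ∀ n, Continuous (moll (scale n) (trunc u R)) := fun n =>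
    (contDiff_moll (scale_pos n) hw.locallyIntegrable).continuous
  -- The regularisations have nonnegative Laplacian, so their spherical integrals increase from
  -- radius `t` to `r`; at radius `t` they dominate `u`. Hence the deficit from `C` at `r` is
  -- bounded by the finite deficit at `t`, uniformly in `n`.
  have hstep : ∀ᶠ n in atTop,
      ∫⁻ ω : sphere (0 : E d) 1, ENNReal.ofReal (C - moll (scale n) (trunc u R) (r • (ω : E d)))
        ∂surf d ≤ ∫⁻ ω, gap C (u (t • (ω : E d))) ∂surf d := by
    filter_upwards [eventually_scale_lt (sub_pos.2 hrR)] with n hn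
    have hle : ∀ {s : ℝ}, 0 < s → s ≤ r → ∀ ω : sphere (0 : E d) 1,
        moll (scale n) (trunc u R) (s • (ω : E d)) ≤ C := fun {s} hs hsr ω => by
      refine hu.moll_trunc_le hd hΩ hpre hne hR (scale_pos n) ?_ fun y hy => hC y ?_
      · rw [norm_smul_sphere hs.le]; linarith
      · rw [mem_ball_iff_norm] at hy
        rw [mem_closedBall_zero_iff]
        have := norm_sub_norm_le y (s • (ω : E d))
        rw [norm_smul_sphere hs.le] at this
        linarith
    have hi := fun s : ℝ => (integrable_const (μ := surf d) C).sub
      (integrable_sphere_comp (hcont n) s)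
    calc _ = ENNReal.ofReal
          (∫ ω : sphere (0 : E d) 1, (C - moll (scale n) (trunc u R) (r • (ω : E d))) ∂surf d) :=
          (ofReal_integral_eq_lintegral_ofReal (hi r)
            (Eventually.of_forall fun ω => sub_nonneg.2 (hle hr le_rfl ω))).symm
      _ ≤ ENNReal.ofReal
          (∫ ω : sphere (0 : E d) 1, (C - moll (scale n) (trunc u R) (t • (ω : E d))) ∂surf d) := by
          refine ENNReal.ofReal_le_ofReal ?_
          rw [integral_sub (integrable_const _) (integrable_sphere_comp (hcont n) r),
            integral_sub (integrable_const _) (integrable_sphere_comp (hcont n) t)]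
          refine sub_le_sub_left ?_ _
          refine sphere_integral_mono hd (contDiff_two_moll (scale_pos n) hw.locallyIntegrable)
            ht0 htr.le fun x hx => ?_
          refine hu.laplacian_moll_nonneg hd hΩ hpre hne hR (scale_pos n) ?_
          rw [mem_ball_zero_iff] at hx
          linarith
      _ = ∫⁻ ω : sphere (0 : E d) 1,
            ENNReal.ofReal (C - moll (scale n) (trunc u R) (t • (ω : E d))) ∂surf d :=
          ofReal_integral_eq_lintegral_ofReal (hi t)
            (Eventually.of_forall fun ω => sub_nonneg.2 (hle ht0 htr.le ω))
      _ ≤ _ := by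
          refine lintegral_mono fun ω => ?_
          by_cases hb : u (t • (ω : E d)) = ⊥
          · simp [gap, hb]
          · rw [gap_of_ne_bot C hb]
            refine ENNReal.ofReal_le_ofReal (sub_le_sub_left ?_ _)
            refine hu.le_moll hd hΩ hpre hne hR (scale_pos n) ?_ hb
            rw [norm_smul_sphere ht0.le]; linarith
  calc ∫⁻ ω, gap C (u (r • (ω : E d))) ∂surf d
      ≤ ∫⁻ ω : sphere (0 : E d) 1, liminf (fun n =>
          ENNReal.ofReal (C - moll (scale n) (trunc u R) (r • (ω : E d)))) atTop ∂surf d :=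
        lintegral_mono fun ω => hu.gap_le_liminf hd hΩ hpre hne hR
          (by rw [norm_smul_sphere hr.le]; exact hrR) C
    _ ≤ liminf (fun n => ∫⁻ ω : sphere (0 : E d) 1,
          ENNReal.ofReal (C - moll (scale n) (trunc u R) (r • (ω : E d))) ∂surf d) atTop :=
        lintegral_liminf_le fun n => by
          have := hcont n
          fun_prop
    _ ≤ ∫⁻ ω, gap C (u (t • (ω : E d))) ∂surf d := by
        refine (liminf_le_liminf hstep).trans ?_
        simp
    _ < ⊤ := ht

/-- Dominated convergence: `u ≤ moll ≤ C` eventually, almost everywhere on the sphere, so the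
integrable function `C - u` dominates the difference. -/
theorem tendsto_sphere_moll (hd : 2 ≤ d) (hu : SubharmonicOn u Ω) (hΩ : IsOpen Ω)
    (hpre : IsPreconnected Ω) (hne : ∃ x ∈ Ω, u x ≠ ⊥) (hR : closedBall 0 R ⊆ Ω) {r : ℝ}
    (hr : 0 < r) (hrR : r < R) :
    Tendsto (fun n => ∫ ω : sphere (0 : E d) 1,
      |moll (scale n) (trunc u R) (r • (ω : E d)) - (u (r • (ω : E d))).toReal| ∂surf d)
      atTop (𝓝 0) := by
  obtain ⟨C, hC0, hC⟩ := hu.exists_bound (isCompact_closedBall 0 R) hR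
  obtain ⟨h1, h2⟩ := hu.sphere_integrable hd hΩ hpre hne hR hr hrR
  have hw := hu.integrable_trunc hd hΩ hpre hne hR
  have hcont : ∀ n, Continuous (moll (scale n) (trunc u R)) := fun n =>
    (contDiff_moll (scale_pos n) hw.locallyIntegrable).continuous
  have hnorm : ∀ ω : sphere (0 : E d) 1, ‖r • (ω : E d)‖ = r := norm_smul_sphere hr.le
  have := tendsto_integral_filter_of_dominated_convergence (μ := surf d) (l := atTop)
    (F := fun n (ω : sphere (0 : E d) 1) =>
      |moll (scale n) (trunc u R) (r • (ω : E d)) - (u (r • (ω : E d))).toReal|)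
    (f := fun _ => (0 : ℝ)) (fun ω : sphere (0 : E d) 1 => C - (u (r • (ω : E d))).toReal)
    ?_ ?_ ((integrable_const C).sub h2) ?_
  · simpa using this
  · exact Eventually.of_forall fun n =>
      ((integrable_sphere_comp (hcont n) r).sub h2).abs.aestronglyMeasurable
  · filter_upwards [eventually_scale_lt (sub_pos.2 hrR)] with n hn
    filter_upwards [h1] with ω hω
    have hb : u (r • (ω : E d)) ≠ ⊥ := by rw [hω]; simp
    have h3 := hu.le_moll hd hΩ hpre hne hR (scale_pos n)
      (by rw [hnorm ω]; linarith) hb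
    have h4 : moll (scale n) (trunc u R) (r • (ω : E d)) ≤ C := by
      refine hu.moll_trunc_le hd hΩ hpre hne hR (scale_pos n) ?_ fun y hy => hC y ?_
      · rw [hnorm]; linarith
      · rw [mem_ball_iff_norm] at hy
        rw [mem_closedBall_zero_iff]
        have := norm_sub_norm_le y (r • (ω : E d))
        rw [hnorm] at this
        linarith
    rw [Real.norm_eq_abs, abs_abs, abs_of_nonneg (by linarith)]
    linarith
  · filter_upwards [h1] with ω hω
    have hb : u (r • (ω : E d)) ≠ ⊥ := by rw [hω]; simp
    have h3 := hu.tendsto_moll hd hΩ hpre hne hR (x := r • (ω : E d)) (by rw [hnorm]; exact hrR) hb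
    simpa using (h3.sub_const (u (r • (ω : E d))).toReal).abs

end SubharmonicOn

/-! ### Existence of the Riesz measure. -/

section

open scoped CompactlySupported Manifold ContDiff

/-- Smooth functions with compact support in `Ω`. -/
structure IsTest (Ω : Set (E d)) (φ : E d → ℝ) : Prop where
  contDiff : ContDiff ℝ ((⊤ : ℕ∞) : WithTop ℕ∞) φ
  hasCompactSupport : HasCompactSupport φ
  tsupport_subset : tsupport φ ⊆ Ω

namespace IsTest

variable {Ω : Set (E d)} {φ ψ : E d → ℝ}

theorem zero : IsTest Ω (0 : E d → ℝ) :=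
  ⟨contDiff_const, HasCompactSupport.zero, by simp [tsupport]⟩

theorem add (hφ : IsTest Ω φ) (hψ : IsTest Ω ψ) : IsTest Ω (φ + ψ) :=
  ⟨hφ.contDiff.add hψ.contDiff, hφ.hasCompactSupport.add hψ.hasCompactSupport,
    (tsupport_add φ ψ).trans (union_subset hφ.tsupport_subset hψ.tsupport_subset)⟩

theorem smul (c : ℝ) (hφ : IsTest Ω φ) : IsTest Ω (c • φ) :=
  ⟨contDiff_const.smul hφ.contDiff, hφ.hasCompactSupport.smul_left (f := fun _ => c),
    (tsupport_smul_subset_right (fun _ => c) φ).trans hφ.tsupport_subset⟩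

theorem eq_zero_of_notMem (hφ : IsTest Ω φ) {x : E d} (hx : x ∉ Ω) : φ x = 0 :=
  image_eq_zero_of_notMem_tsupport fun h => hx (hφ.tsupport_subset h)

end IsTest

/-- The extension by zero of a function on `Ω`. -/
def extZero (Ω : Set (E d)) (f : Ω → ℝ) : E d → ℝ := Function.extend Subtype.val f 0

theorem extZero_coe {Ω : Set (E d)} (f : Ω → ℝ) (x : Ω) : extZero Ω f x = f x :=
  Subtype.val_injective.extend_apply f 0 x

theorem extZero_of_notMem {Ω : Set (E d)} (f : Ω → ℝ) {x : E d} (hx : x ∉ Ω) :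
    extZero Ω f x = 0 := by
  rw [extZero, Function.extend_apply']
  · rfl
  · rintro ⟨a, rfl⟩
    exact hx a.2

theorem extZero_add {Ω : Set (E d)} (f g : Ω → ℝ) :
    extZero Ω (f + g) = extZero Ω f + extZero Ω g := by
  ext x
  by_cases hx : x ∈ Ω
  · lift x to Ω using hx
    simp [extZero_coe]
  · simp [extZero_of_notMem _ hx]

theorem extZero_smul {Ω : Set (E d)} (c : ℝ) (f : Ω → ℝ) :
    extZero Ω (c • f) = c • extZero Ω f := by
  ext x
  by_cases hx : x ∈ Ω
  · lift x to Ω using hx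
    simp [extZero_coe]
  · simp [extZero_of_notMem _ hx]

/-- The restriction of a test function to `Ω`. -/
def IsTest.restrict {Ω : Set (E d)} {φ : E d → ℝ} (hφ : IsTest Ω φ) : C_c(Ω, ℝ) where
  toFun := fun x => φ x
  continuous_toFun := hφ.contDiff.continuous.comp continuous_subtype_val
  hasCompactSupport' := by
    refine HasCompactSupport.intro (K := Subtype.val ⁻¹' tsupport φ) ?_ fun x hx => ?_
    · rw [Subtype.isCompact_iff, Subtype.image_preimage_coe, inter_eq_right.2 hφ.tsupport_subset]
      exact hφ.hasCompactSupport
    · exact image_eq_zero_of_notMem_tsupport hx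

theorem IsTest.restrict_apply {Ω : Set (E d)} {φ : E d → ℝ} (hφ : IsTest Ω φ) (x : Ω) :
    hφ.restrict x = φ x := rfl

theorem IsTest.extZero_restrict {Ω : Set (E d)} {φ : E d → ℝ} (hφ : IsTest Ω φ) :
    extZero Ω hφ.restrict = φ := by
  ext x
  by_cases hx : x ∈ Ω
  · lift x to Ω using hx
    rw [extZero_coe, hφ.restrict_apply]
  · rw [extZero_of_notMem _ hx, hφ.eq_zero_of_notMem hx]

theorem exists_isTest_eq_one {Ω K : Set (E d)} (hΩ : IsOpen Ω) (hK : IsCompact K) (hKΩ : K ⊆ Ω) :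
    ∃ φ : E d → ℝ, IsTest Ω φ ∧ (∀ x, 0 ≤ φ x) ∧ ∀ x ∈ K, φ x = 1 := by
  obtain ⟨V, hV, hKV, hVΩ, hVc⟩ := exists_open_between_and_isCompact_closure hK hΩ hKΩ
  obtain ⟨f, h0, h1, h01⟩ := exists_contMDiffMap_zero_one_of_isClosed (n := ⊤) 𝓘(ℝ, E d)
    hV.isClosed_compl hK.isClosed (disjoint_compl_left_iff_subset.2 hKV)
  have hsupp : tsupport (f : E d → ℝ) ⊆ closure V := by
    refine closure_mono fun x hx => ?_
    by_contra hxV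
    exact hx (h0 hxV)
  exact ⟨f, ⟨f.contMDiff.contDiff, hVc.of_isClosed_subset (isClosed_tsupport _) hsupp,
    hsupp.trans hVΩ⟩, fun x => (h01 x).1, fun x hx => h1 hx⟩

/-- A positive linear functional on test functions is given by a measure. -/
theorem exists_measure_of_positive {Ω : Set (E d)} (hΩ : IsOpen Ω) (L : (E d → ℝ) → ℝ)
    (hadd : ∀ φ ψ, IsTest Ω φ → IsTest Ω ψ → L (φ + ψ) = L φ + L ψ)
    (hsmul : ∀ (c : ℝ) φ, IsTest Ω φ → L (c • φ) = c * L φ)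
    (hpos : ∀ φ, IsTest Ω φ → (∀ x, 0 ≤ φ x) → 0 ≤ L φ) :
    ∃ μ : Measure (E d), μ Ωᶜ = 0 ∧ (∀ K, IsCompact K → K ⊆ Ω → μ K < ⊤) ∧
      ∀ φ, IsTest Ω φ → L φ = ∫ x, φ x ∂μ := by
  have : LocallyCompactSpace Ω := hΩ.locallyCompactSpace
  let f : C_c(Ω, ℝ) →ₗ.[ℝ] ℝ :=
    { domain :=
        { carrier := {f | IsTest Ω (extZero Ω f)}
          add_mem' := fun {f g} hf hg => by
            have := IsTest.add hf hg
            rw [← extZero_add] at this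
            exact this
          zero_mem' := by
            have h : extZero Ω ((0 : C_c(Ω, ℝ)) : Ω → ℝ) = 0 := by
              ext x
              by_cases hx : x ∈ Ω
              · lift x to Ω using hx
                simp [extZero_coe]
              · simp [extZero_of_notMem _ hx]
            change IsTest Ω _
            rw [h]
            exact IsTest.zero
          smul_mem' := fun c f hf => by
            have := IsTest.smul c hf
            rw [← extZero_smul] at this
            exact this }
      toFun :=
        { toFun := fun g => L (extZero Ω (g : C_c(Ω, ℝ)))
          map_add' := fun g h => by
            rw [← hadd _ _ g.2 h.2, ← extZero_add]
            rfl
          map_smul' := fun c g => by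
            rw [RingHom.id_apply, smul_eq_mul, ← hsmul _ _ g.2, ← extZero_smul]
            rfl } }
  have hfval : ∀ g : f.domain, f g = L (extZero Ω (g : C_c(Ω, ℝ))) := fun g => rfl
  have hmem : ∀ φ (hφ : IsTest Ω φ), hφ.restrict ∈ f.domain := fun φ hφ => by
    change IsTest Ω (extZero Ω hφ.restrict)
    rwa [hφ.extZero_restrict]
  let cone : PointedCone ℝ C_c(Ω, ℝ) :=
    { carrier := {f | ∀ x, 0 ≤ f x}
      add_mem' := fun {f g} hf hg x => add_nonneg (hf x) (hg x)
      zero_mem' := fun x => le_rfl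
      smul_mem' := fun c f hf x => mul_nonneg c.2 (hf x) }
  -- The M. Riesz extension theorem takes the positive functional from test functions to all of
  -- `C_c(Ω, ℝ)`, where the Riesz–Markov–Kakutani theorem applies; no density argument is required.
  obtain ⟨g, hg1, hg2⟩ := riesz_extension cone f
    (fun x hx => by
      rw [hfval]
      refine hpos _ x.2 fun y => ?_
      by_cases hy : y ∈ Ω
      · lift y to Ω using hy
        rw [extZero_coe]
        exact hx y
      · rw [extZero_of_notMem _ hy])
    -- Each `y` must become nonnegative after adding a test function: take `|B| φ`, with `B` a bound
    -- for `y` on its support and `φ` a smooth cut-off equal to one there.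
    (fun y => by
      have hKc : IsCompact (Subtype.val '' tsupport (y : Ω → ℝ)) :=
        y.hasCompactSupport.isCompact.image continuous_subtype_val
      obtain ⟨φ, hφ, hφ0, hφ1⟩ := exists_isTest_eq_one hΩ hKc (by
        rintro _ ⟨z, -, rfl⟩; exact z.2)
      obtain ⟨B, hB⟩ := y.hasCompactSupport.isCompact.exists_bound_of_continuousOn
        y.continuous.continuousOn
      have hφB := hφ.smul (|B|)
      refine ⟨⟨hφB.restrict, hmem _ hφB⟩, ?_⟩
      intro x
      change (0 : ℝ) ≤ |B| * φ x + y x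
      by_cases hx : x ∈ tsupport (y : Ω → ℝ)
      · rw [hφ1 x ⟨x, hx, rfl⟩]
        have h1 : ‖y x‖ ≤ B := hB x hx
        rw [Real.norm_eq_abs] at h1
        have h2 := neg_abs_le (y x)
        have h3 := le_abs_self B
        linarith
      · rw [image_eq_zero_of_notMem_tsupport hx, add_zero]
        exact mul_nonneg (abs_nonneg _) (hφ0 x))
  let Λ : C_c(Ω, ℝ) →ₚ[ℝ] ℝ := PositiveLinearMap.mk₀ g fun x hx => hg2 x hx
  have hemb : MeasurableEmbedding (Subtype.val : Ω → E d) :=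
    MeasurableEmbedding.subtype_coe hΩ.measurableSet
  refine ⟨(RealRMK.rieszMeasure Λ).map Subtype.val, ?_, fun K hK hKΩ => ?_, fun φ hφ => ?_⟩
  · rw [hemb.map_apply]
    simp
  · rw [hemb.map_apply]
    refine IsCompact.measure_lt_top ?_
    rw [Subtype.isCompact_iff, Subtype.image_preimage_coe, inter_eq_right.2 hKΩ]
    exact hK
  · rw [hemb.integral_map]
    have h1 := RealRMK.integral_rieszMeasure Λ hφ.restrict
    have h2 : Λ hφ.restrict = L φ := by
      have := hg1 ⟨hφ.restrict, hmem φ hφ⟩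
      rw [hfval, hφ.extZero_restrict] at this
      exact this
    rw [h2] at h1
    exact h1.symm

theorem integral_mul_laplacian_comm {f φ : E d → ℝ} (hf : ContDiff ℝ 2 f) (hφ : ContDiff ℝ 2 φ)
    (hc : HasCompactSupport φ) : ∫ x, f x * (Δ φ) x = ∫ x, φ x * (Δ f) x := by
  have c1 := fun v => continuous_fderiv_apply hf v
  have c2 := fun v => continuous_fderiv_apply hφ v
  have c1' := fun v => ((c1 v).continuous_fderiv (by norm_num)).clm_apply (continuous_const (y := v))
  have c2' := fun v => ((c2 v).continuous_fderiv (by norm_num)).clm_apply (continuous_const (y := v))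
  have s2 := fun v => hc.fderiv_apply ℝ v
  have s2' := fun v => (s2 v).fderiv_apply ℝ v
  have i1 : ∀ v, Integrable fun x => f x * fderiv ℝ (fun y => fderiv ℝ φ y v) x v := fun v =>
    (hf.continuous.mul (c2' v)).integrable_of_hasCompactSupport (μ := volume)
    (s2' v).mul_left
  have i2 : ∀ v, Integrable fun x => fderiv ℝ f x v * fderiv ℝ φ x v := fun v =>
    ((c1 v).continuous.mul (c2 v).continuous).integrable_of_hasCompactSupport
    (μ := volume) (s2 v).mul_left
  have i3 : ∀ v, Integrable fun x => f x * fderiv ℝ φ x v := fun v =>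
    (hf.continuous.mul (c2 v).continuous).integrable_of_hasCompactSupport
    (μ := volume) (s2 v).mul_left
  have i4 : ∀ v, Integrable fun x => φ x * fderiv ℝ (fun y => fderiv ℝ f y v) x v := fun v =>
    (hφ.continuous.mul (c1' v)).integrable_of_hasCompactSupport
    (μ := volume) hc.mul_right
  have i5 : ∀ v, Integrable fun x => φ x * fderiv ℝ f x v := fun v =>
    (hφ.continuous.mul (c1 v).continuous).integrable_of_hasCompactSupport
    (μ := volume) hc.mul_right
  simp only [laplacian_eq_sum hf, laplacian_eq_sum hφ, Finset.mul_sum]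
  rw [integral_finsetSum _ fun i _ => i1 _, integral_finsetSum _ fun i _ => i4 _]
  refine Finset.sum_congr rfl fun i _ => ?_
  set v := EuclideanSpace.basisFun (Fin d) ℝ i
  have e1 := integral_mul_fderiv_eq_neg_fderiv_mul_of_integrable (f := f)
    (g := fun y => fderiv ℝ φ y v) (v := v) (i2 v) (i1 v) (i3 v)
    (fun x _ => (hf.differentiable (by norm_num)).differentiableAt)
    (fun x _ => ((c2 v).differentiable (by norm_num)).differentiableAt)
  have e2 := integral_mul_fderiv_eq_neg_fderiv_mul_of_integrable (f := φ)
    (g := fun y => fderiv ℝ f y v) (v := v)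
    ((i2 v).congr (Eventually.of_forall fun x => mul_comm _ _)) (i4 v) (i5 v)
    (fun x _ => (hφ.differentiable (by norm_num)).differentiableAt)
    (fun x _ => ((c1 v).differentiable (by norm_num)).differentiableAt)
  rw [e1, e2]
  congr 1
  exact integral_congr_ae (Eventually.of_forall fun x => mul_comm _ _)

theorem laplacian_eq_zero_of_notMem_tsupport {φ : E d → ℝ} {x : E d} (hx : x ∉ tsupport φ) :
    (Δ φ) x = 0 := by
  have h : φ =ᶠ[𝓝 x] fun _ => 0 := notMem_tsupport_iff_eventuallyEq.1 hx
  rw [(InnerProductSpace.laplacian_congr_nhds h).self_of_nhds]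
  simp

theorem hasCompactSupport_laplacian {φ : E d → ℝ} (hφ : HasCompactSupport φ) :
    HasCompactSupport (Δ φ) :=
  HasCompactSupport.intro hφ fun _ hx => laplacian_eq_zero_of_notMem_tsupport hx

theorem closedBall_subset_eball {ρ : ℝ≥0∞} {R : ℝ} (hR : ENNReal.ofReal R < ρ) :
    closedBall (0 : E d) R ⊆ Metric.eball 0 ρ := by
  intro x hx
  rw [Metric.mem_eball, edist_dist]
  exact (ENNReal.ofReal_le_ofReal (mem_closedBall.1 hx)).trans_lt hR

/-- The margin between `r` and `R` is the room needed to regularise on `K` at small scales. -/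
theorem exists_ball_of_isCompact {ρ : ℝ≥0∞} (hρ : 0 < ρ) {K : Set (E d)} (hK : IsCompact K)
    (hKρ : K ⊆ Metric.eball 0 ρ) :
    ∃ r R, 0 < r ∧ r < R ∧ K ⊆ ball (0 : E d) r ∧ closedBall (0 : E d) R ⊆ Metric.eball 0 ρ := by
  obtain ⟨M, hM0, hM, hKM⟩ : ∃ M : ℝ, 0 ≤ M ∧ ENNReal.ofReal M < ρ ∧ ∀ x ∈ K, ‖x‖ ≤ M := by
    rcases K.eq_empty_or_nonempty with rfl | hne
    · exact ⟨0, le_rfl, by simpa using hρ, by simp⟩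
    · obtain ⟨a, ha, hmax⟩ := hK.exists_isMaxOn hne continuous_norm.continuousOn
      refine ⟨‖a‖, norm_nonneg a, ?_, fun x hx => hmax hx⟩
      have := hKρ ha
      rwa [Metric.mem_eball, edist_dist, dist_zero_right] at this
  obtain ⟨R, hR0, hMR, hR⟩ := ENNReal.lt_iff_exists_real_btwn.1 hM
  have hMR' : M < R := by
    by_contra h
    exact not_le.2 hMR (ENNReal.ofReal_le_ofReal (not_lt.1 h))
  refine ⟨(M + R) / 2, R, by linarith, by linarith, fun x hx => ?_, closedBall_subset_eball hR⟩
  rw [mem_ball_zero_iff]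
  have := hKM x hx
  linarith

namespace SubharmonicOn

variable {u : E d → EReal} {Ω : Set (E d)} {R : ℝ}

theorem integrable_mul_laplacian (hd : 2 ≤ d) (hu : SubharmonicOn u Ω) (hΩ : IsOpen Ω)
    (hpre : IsPreconnected Ω) (hne : ∃ x ∈ Ω, u x ≠ ⊥) {φ : E d → ℝ} (hφ : IsTest Ω φ) :
    Integrable fun x => (u x).toReal * (Δ φ) x := by
  have hcont := continuous_laplacian (hφ.contDiff.of_le two_le_infty)
  obtain ⟨B, hB⟩ := (hasCompactSupport_laplacian hφ.hasCompactSupport).exists_bound_of_continuous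
    hcont
  have h1 := hu.integrableOn_compact hd hΩ hpre hne hφ.hasCompactSupport hφ.tsupport_subset
  rw [← integrableOn_iff_integrable_of_support_subset (s := tsupport φ)]
  · exact h1.mul_bdd (c := B) hcont.aestronglyMeasurable (Eventually.of_forall hB)
  · intro x hx
    by_contra h
    exact hx (by simp [laplacian_eq_zero_of_notMem_tsupport h])

/-- For a regularisation, Green's identity moves the Laplacian off `φ`, and the resulting integrand
is nonnegative; the inequality survives the limit. -/
theorem integral_mul_laplacian_nonneg (hd : 2 ≤ d) {ρ : ℝ≥0∞}
    (hu : SubharmonicOn u (Metric.eball 0 ρ)) (hne : ∃ x ∈ Metric.eball 0 ρ, u x ≠ ⊥)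
    {φ : E d → ℝ} (hφ : IsTest (Metric.eball 0 ρ) φ) (hφ0 : ∀ x, 0 ≤ φ x) :
    0 ≤ ∫ x, (u x).toReal * (Δ φ) x := by
  have hΩ : IsOpen (Metric.eball (0 : E d) ρ) := Metric.isOpen_eball
  have hpre : IsPreconnected (Metric.eball (0 : E d) ρ) := (convex_eball _ _).isPreconnected
  have hρ : 0 < ρ := by
    obtain ⟨x, hx, -⟩ := hne
    exact Metric.pos_of_mem_eball hx
  obtain ⟨r, R, hr, hrR, hsub, hR⟩ := exists_ball_of_isCompact hρ hφ.hasCompactSupport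
    hφ.tsupport_subset
  have hφ2 := hφ.contDiff.of_le two_le_infty
  have hcont := continuous_laplacian hφ2
  have hcs := hasCompactSupport_laplacian hφ.hasCompactSupport
  obtain ⟨B, hB⟩ := hcs.exists_bound_of_continuous hcont
  obtain ⟨C, hC0, hC⟩ := hu.exists_bound (isCompact_closedBall 0 R) hR
  have hw := hu.integrable_trunc hd hΩ hpre hne hR
  have hsm := fun n => contDiff_two_moll (scale_pos n) hw.locallyIntegrable
  -- On the support of `φ`, `u ≤ moll ≤ C` almost everywhere, so `|moll| ≤ C + |u|`, which is
  -- integrable against the bounded `Δφ`.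
  have hlim : Tendsto (fun n => ∫ x, moll (scale n) (trunc u R) x * (Δ φ) x) atTop
      (𝓝 (∫ x, (u x).toReal * (Δ φ) x)) := by
    refine tendsto_integral_filter_of_dominated_convergence
      (fun x => (C + |trunc u R x|) * |(Δ φ) x|) ?_ ?_ ?_ ?_
    · exact Eventually.of_forall fun n => ((hsm n).continuous.mul hcont).aestronglyMeasurable
    · filter_upwards [eventually_scale_lt (sub_pos.2 hrR)] with n hn
      filter_upwards [hu.ae_ne_bot hd hΩ hpre hne] with x hx
      rw [norm_mul, Real.norm_eq_abs, Real.norm_eq_abs]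
      by_cases hxs : x ∈ tsupport φ
      · have hxr := mem_ball_zero_iff.1 (hsub hxs)
        have hxR : x ∈ closedBall (0 : E d) R := by
          rw [mem_closedBall_zero_iff]; linarith
        refine mul_le_mul_of_nonneg_right ?_ (abs_nonneg _)
        have h1 := hu.le_moll hd hΩ hpre hne hR (scale_pos n) (x := x) (by linarith) (hx (hR hxR))
        have h2 : moll (scale n) (trunc u R) x ≤ C := by
          refine hu.moll_trunc_le hd hΩ hpre hne hR (scale_pos n) (by linarith) fun y hy => hC y ?_
          rw [mem_ball_iff_norm] at hy
          rw [mem_closedBall_zero_iff]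
          have := norm_sub_norm_le y x
          linarith
        rw [trunc_of_mem hxR]
        have h3 := neg_abs_le (u x).toReal
        have h4 := abs_nonneg (u x).toReal
        rw [abs_le]
        constructor <;> linarith
      · simp [laplacian_eq_zero_of_notMem_tsupport hxs]
    · have h1 : Integrable fun x => C * |(Δ φ) x| :=
        (hcont.integrable_of_hasCompactSupport hcs).abs.const_mul C
      have h2 : Integrable fun x => |trunc u R x| * |(Δ φ) x| :=
        hw.abs.mul_bdd (c := B) hcont.abs.aestronglyMeasurable
          (Eventually.of_forall fun x => by simpa using hB x)
      refine (h1.add h2).congr (Eventually.of_forall fun x => ?_)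
      simp only [Pi.add_apply]
      ring
    · filter_upwards [hu.ae_ne_bot hd hΩ hpre hne] with x hx
      by_cases hxs : x ∈ tsupport φ
      · have hxr := mem_ball_zero_iff.1 (hsub hxs)
        have hxR : x ∈ closedBall (0 : E d) R := by
          rw [mem_closedBall_zero_iff]; linarith
        exact (hu.tendsto_moll hd hΩ hpre hne hR (by linarith) (hx (hR hxR))).mul_const _
      · simp [laplacian_eq_zero_of_notMem_tsupport hxs]
  refine ge_of_tendsto hlim ?_
  filter_upwards [eventually_scale_lt (sub_pos.2 hrR)] with n hn
  rw [integral_mul_laplacian_comm (hsm n) hφ2 hφ.hasCompactSupport]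
  refine integral_nonneg fun x => ?_
  simp only [Pi.zero_apply]
  by_cases hxs : x ∈ tsupport φ
  · have hxr := mem_ball_zero_iff.1 (hsub hxs)
    exact mul_nonneg (hφ0 x) (hu.laplacian_moll_nonneg hd hΩ hpre hne hR (scale_pos n)
      (by linarith))
  · rw [image_eq_zero_of_notMem_tsupport hxs, zero_mul]

/-- The normalised distributional Laplacian is a positive functional on test functions. This shows
that `rieszMeasure` is a genuine choice and not its default value `0`. -/
theorem exists_isRieszMeasure (hd : 2 ≤ d) {ρ : ℝ≥0∞}
    (hu : SubharmonicOn u (Metric.eball 0 ρ)) (hne : ∃ x ∈ Metric.eball 0 ρ, u x ≠ ⊥) :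
    ∃ μ, IsRieszMeasure (Metric.eball 0 ρ) u μ := by
  have hΩ : IsOpen (Metric.eball (0 : E d) ρ) := Metric.isOpen_eball
  have hpre : IsPreconnected (Metric.eball (0 : E d) ρ) := (convex_eball _ _).isPreconnected
  have hs := sphereArea_pos hd
  have hdh : 0 < dHat d := lt_of_lt_of_le one_pos (le_max_left _ _)
  have hc : 0 < sphereArea d * dHat d := by positivity
  have hi := fun φ (hφ : IsTest _ φ) => hu.integrable_mul_laplacian hd hΩ hpre hne (φ := φ) hφ
  have h2 := fun φ (hφ : IsTest (Metric.eball (0 : E d) ρ) φ) => hφ.contDiff.of_le two_le_infty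
  have hmeas := exists_measure_of_positive hΩ
    (fun φ => (sphereArea d * dHat d)⁻¹ * ∫ x, (u x).toReal * (Δ φ) x)
    (fun φ ψ hφ hψ => by
      rw [← mul_add, ← integral_add (hi φ hφ) (hi ψ hψ)]
      congr 2
      ext x
      rw [(h2 φ hφ).contDiffAt.laplacian_add (h2 ψ hψ).contDiffAt, mul_add])
    (fun c φ hφ => by
      rw [mul_left_comm]
      congr 1
      rw [← integral_const_mul]
      refine integral_congr_ae (Eventually.of_forall fun x => ?_)
      simp only
      rw [InnerProductSpace.laplacian_smul c (h2 φ hφ).contDiffAt, smul_eq_mul]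
      ring)
    (fun φ hφ hφ0 => mul_nonneg (by positivity) (hu.integral_mul_laplacian_nonneg hd hne hφ hφ0))
  obtain ⟨μ, h1, h3, h4⟩ := hmeas
  refine ⟨μ, h1, h3, fun φ hφ hφc hφs => ?_⟩
  rw [← h4 φ ⟨hφ, hφc, hφs⟩, mul_inv_cancel_left₀ hc.ne']

theorem isRieszMeasure_rieszMeasure (hd : 2 ≤ d) {ρ : ℝ≥0∞}
    (hu : SubharmonicOn u (Metric.eball 0 ρ)) (hne : ∃ x ∈ Metric.eball 0 ρ, u x ≠ ⊥) :
    IsRieszMeasure (Metric.eball 0 ρ) u (rieszMeasure (Metric.eball 0 ρ) u) := by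
  have h := hu.exists_isRieszMeasure hd hne
  rw [rieszMeasure, dif_pos h]
  exact h.choose_spec

end SubharmonicOn

end

/-! ### The Laplacian of a regularisation in terms of the Riesz measure. -/

theorem fderiv_comp_neg_apply {f : E d → ℝ} (hf : Differentiable ℝ f) (x v : E d) :
    fderiv ℝ (fun z => f (-z)) x v = -(fderiv ℝ f (-x) v) := by
  have h := (hf (-x)).hasFDerivAt.comp x (hasFDerivAt_id (𝕜 := ℝ) x).neg
  rw [HasFDerivAt.fderiv (f := fun z => f (-z)) h]
  simp

theorem laplacian_comp_neg {f : E d → ℝ} (hf : ContDiff ℝ 2 f) (x : E d) :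
    (Δ fun z => f (-z)) x = (Δ f) (-x) := by
  have hf' : ContDiff ℝ 2 fun z => f (-z) := hf.comp contDiff_neg
  rw [laplacian_eq_sum hf', laplacian_eq_sum hf]
  refine Finset.sum_congr rfl fun i _ => ?_
  set v := EuclideanSpace.basisFun (Fin d) ℝ i
  have h1 : (fun y => fderiv ℝ (fun z => f (-z)) y v) = fun y => -(fderiv ℝ f (-y) v) :=
    funext fun y => fderiv_comp_neg_apply (hf.differentiable (by norm_num)) y v
  rw [h1, fderiv_fun_neg, neg_apply,
    fderiv_comp_neg_apply (f := fun y => fderiv ℝ f y v)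
      ((continuous_fderiv_apply hf v).differentiable (by norm_num)), neg_neg]

/-- The translated bump `y ↦ eta ε (x - y)` is the test function to insert in the definition of the
Riesz measure. The condition on `x` keeps its support where the truncation agrees with `u`. -/
theorem laplacian_moll_eq {Ω : Set (E d)} {u : E d → EReal} {μ : Measure (E d)}
    (hμ : IsRieszMeasure Ω u μ) {R ε : ℝ} (hε : 0 < ε) (hR : closedBall 0 R ⊆ Ω)
    (hw : Integrable (trunc u R)) {x : E d} (hx : ‖x‖ + ε ≤ R) :
    (Δ (moll ε (trunc u R))) x = sphereArea d * dHat d * ∫ y, eta ε (x - y) ∂μ := by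
  have hη : ContDiff ℝ 2 (eta ε : E d → ℝ) := (contDiff_eta ε).of_le two_le_infty
  set φ : E d → ℝ := fun y => eta ε (x - y) with hφ
  have hφ' : φ = fun y => eta ε (-x + y) := by
    ext y
    rw [hφ]
    simp only
    rw [← eta_neg, neg_sub, neg_add_eq_sub]
  have hφc : ContDiff ℝ ((⊤ : ℕ∞) : WithTop ℕ∞) φ :=
    (contDiff_eta ε).comp (contDiff_const.sub contDiff_id)
  have hsub : closedBall x ε ⊆ closedBall (0 : E d) R := by
    refine closedBall_subset_closedBall' ?_
    rw [dist_zero_right]; linarith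
  have hsupp : tsupport φ ⊆ closedBall x ε := by
    refine closure_minimal (fun y hy => ?_) isClosed_closedBall
    rw [mem_closedBall', dist_eq_norm]
    by_contra h
    exact hy (eta_eq_zero hε (not_le.1 h).le)
  have heven : ∀ z : E d, (Δ (eta ε : E d → ℝ)) (-z) = (Δ (eta ε : E d → ℝ)) z := by
    intro z
    have h : (fun z : E d => eta ε (-z)) = eta ε := funext (eta_neg ε)
    rw [← laplacian_comp_neg hη, h]
  have hlap : ∀ y, (Δ φ) y = (Δ (eta ε : E d → ℝ)) (x - y) := by
    intro y
    rw [hφ', laplacian_comp_add_left hη, ← heven (x - y), neg_sub, neg_add_eq_sub]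
  rw [← hμ.integral_eq φ hφc
    ((isCompact_closedBall x ε).of_isClosed_subset (isClosed_tsupport _) hsupp)
    (hsupp.trans (hsub.trans hR)), laplacian_moll hε hw.locallyIntegrable]
  refine integral_congr_ae (Eventually.of_forall fun y => ?_)
  simp only [← hlap]
  by_cases hy : y ∈ tsupport φ
  · rw [trunc_of_mem (hsub (hsupp hy))]
  · rw [laplacian_eq_zero_of_notMem_tsupport hy]; simp

/-! ### The smooth positive part and Kato's inequality. -/

/-- A smooth convex approximation of the positive part. -/
def posApprox (δ s : ℝ) : ℝ := (s + √(s ^ 2 + δ ^ 2)) / 2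

theorem abs_posApprox_sub_le {δ : ℝ} (hδ : 0 < δ) (s : ℝ) : |posApprox δ s - max 0 s| ≤ δ := by
  have h1 : |s| ≤ √(s ^ 2 + δ ^ 2) := Real.abs_le_sqrt (by nlinarith)
  have h2 : √(s ^ 2 + δ ^ 2) ≤ |s| + δ := by
    rw [Real.sqrt_le_left (by positivity)]
    nlinarith [abs_nonneg s, sq_abs s]
  rw [posApprox, abs_le]
  rcases le_total 0 s with h | h
  · rw [max_eq_right h]
    rw [abs_of_nonneg h] at h1 h2
    constructor <;> linarith
  · rw [max_eq_left h]
    rw [abs_of_nonpos h] at h1 h2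
    constructor <;> linarith

theorem contDiff_posApprox {δ : ℝ} (hδ : 0 < δ) : ContDiff ℝ 2 (posApprox δ) := by
  refine (contDiff_id.add (ContDiff.sqrt (by fun_prop) fun s => ?_)).div_const 2
  positivity

theorem hasDerivAt_posApprox {δ : ℝ} (hδ : 0 < δ) (s : ℝ) :
    HasDerivAt (posApprox δ) ((1 + s / √(s ^ 2 + δ ^ 2)) / 2) s := by
  have hne : s ^ 2 + δ ^ 2 ≠ 0 := by positivity
  have h1 : HasDerivAt (fun s : ℝ => s ^ 2 + δ ^ 2) (2 * s) s := by
    simpa using (hasDerivAt_pow 2 s).add_const (δ ^ 2)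
  have h2 := ((hasDerivAt_id s).add (h1.sqrt hne)).div_const 2
  refine h2.congr_deriv ?_
  have : 0 < √(s ^ 2 + δ ^ 2) := Real.sqrt_pos.2 (by positivity)
  field_simp

theorem hasDerivAt_deriv_posApprox {δ : ℝ} (hδ : 0 < δ) (s : ℝ) :
    ∃ c, 0 ≤ c ∧ HasDerivAt (fun s : ℝ => (1 + s / √(s ^ 2 + δ ^ 2)) / 2) c s := by
  have hne : s ^ 2 + δ ^ 2 ≠ 0 := by positivity
  have h1 : HasDerivAt (fun s : ℝ => s ^ 2 + δ ^ 2) (2 * s) s := by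
    simpa using (hasDerivAt_pow 2 s).add_const (δ ^ 2)
  have hpos : 0 < √(s ^ 2 + δ ^ 2) := Real.sqrt_pos.2 (by positivity)
  refine ⟨_, ?_, (((hasDerivAt_id s).div (h1.sqrt hne) hpos.ne').const_add 1).div_const 2⟩
  have hsq : √(s ^ 2 + δ ^ 2) ^ 2 = s ^ 2 + δ ^ 2 := Real.sq_sqrt (by positivity)
  have : 1 * √(s ^ 2 + δ ^ 2) - id s * (2 * s / (2 * √(s ^ 2 + δ ^ 2))) =
      δ ^ 2 / √(s ^ 2 + δ ^ 2) := by
    simp only [id]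
    field_simp
    rw [hsq]
    ring
  rw [this]
  positivity

/-- Kato's inequality for the smooth approximation of the positive part. -/
theorem laplacian_posApprox_ge {δ : ℝ} (hδ : 0 < δ) {f : E d → ℝ} (hf : ContDiff ℝ 2 f) {x : E d}
    {m : ℝ} (hm : 0 ≤ m) (hΔ : -m ≤ (Δ f) x) : -m ≤ (Δ fun y => posApprox δ (f y)) x := by
  set p : ℝ → ℝ := fun s => (1 + s / √(s ^ 2 + δ ^ 2)) / 2 with hp
  have hfd := hf.differentiable (by norm_num)
  have hcomp : ContDiff ℝ 2 fun y => posApprox δ (f y) := (contDiff_posApprox hδ).comp hf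
  have h1 : ∀ v, (fun y => fderiv ℝ (fun y => posApprox δ (f y)) y v) =
      fun y => p (f y) * fderiv ℝ f y v := by
    intro v
    ext y
    have := (hasDerivAt_posApprox hδ (f y)).comp_hasFDerivAt y (hfd y).hasFDerivAt
    rw [HasFDerivAt.fderiv (f := fun y => posApprox δ (f y)) this]
    simp [hp]
  obtain ⟨c, hc, hc'⟩ := hasDerivAt_deriv_posApprox hδ (f x)
  have h2 : ∀ v, fderiv ℝ (fun y => p (f y) * fderiv ℝ f y v) x v =
      c * (fderiv ℝ f x v) ^ 2 + p (f x) * fderiv ℝ (fun y => fderiv ℝ f y v) x v := by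
    intro v
    have e1 := hc'.comp_hasFDerivAt x (hfd x).hasFDerivAt
    have e2 := ((continuous_fderiv_apply hf v).differentiable (by norm_num) x).hasFDerivAt
    rw [HasFDerivAt.fderiv (HasFDerivAt.fun_mul (c := fun y => p (f y)) e1 e2)]
    simp [hp]
    ring
  rw [laplacian_eq_sum hcomp]
  simp only [h1, h2]
  rw [Finset.sum_add_distrib, ← Finset.mul_sum, ← Finset.mul_sum, ← laplacian_eq_sum hf]
  -- Convexity makes the gradient term nonnegative. The remaining term `p (f x) * Δf` is at least
  -- `-m` because `Δf ≥ -m`, `0 ≤ p ≤ 1` and `m ≥ 0`.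
  have h3 : 0 ≤ c * ∑ i, (fderiv ℝ f x (EuclideanSpace.basisFun (Fin d) ℝ i)) ^ 2 := by positivity
  have hpos : 0 < √((f x) ^ 2 + δ ^ 2) := Real.sqrt_pos.2 (by positivity)
  have habs : |f x| ≤ √((f x) ^ 2 + δ ^ 2) := Real.abs_le_sqrt (by nlinarith)
  have hq : |f x / √((f x) ^ 2 + δ ^ 2)| ≤ 1 := by
    rw [abs_div, abs_of_pos hpos, div_le_one hpos]; exact habs
  rw [abs_le] at hq
  have hp0 : 0 ≤ p (f x) := by simp only [hp]; linarith [hq.1]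
  have hp1 : p (f x) ≤ 1 := by simp only [hp]; linarith [hq.2]
  nlinarith

/-! ### Measure subtraction and weighted averages of monotone functions. -/

/-- Hahn decomposition: on one part `μ ≤ ν` and subtraction is exact, on the other `ν ≤ μ` already.
-/
theorem measure_le_sub_add {α : Type*} [MeasurableSpace α] (μ ν : Measure α) [IsFiniteMeasure μ]
    [IsFiniteMeasure ν] : ν ≤ ν - μ + μ := by
  obtain ⟨s, hs, h1, h2⟩ := hahn_decomposition ν μ
  have r1 : μ.restrict s ≤ ν.restrict s := by
    refine Measure.le_iff.2 fun t ht => ?_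
    rw [Measure.restrict_apply ht, Measure.restrict_apply ht]
    exact h1 _ (MeasurableSet.inter ht hs) inter_subset_right
  refine Measure.le_iff.2 fun t ht => ?_
  have e1 : ν (t ∩ s) = (ν - μ) (t ∩ s) + μ (t ∩ s) := by
    have := Measure.sub_add_cancel_of_le r1
    rw [← Measure.restrict_sub_eq_restrict_sub_restrict hs] at this
    rw [← Measure.restrict_apply ht, ← Measure.restrict_apply ht, ← Measure.restrict_apply ht,
      ← Measure.add_apply, this]
  have e2 : ν (t \ s) ≤ μ (t \ s) := h2 _ (MeasurableSet.diff ht hs) fun x hx => hx.2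
  rw [← measure_inter_add_sdiff t hs, e1, Measure.add_apply, ← measure_inter_add_sdiff (μ := μ) t hs,
    ← add_assoc]
  gcongr
  exact inter_subset_left

theorem intervalIntegrable_mul_monotoneOn {w q : ℝ → ℝ} {a b : ℝ} (hab : a ≤ b)
    (hw : ContinuousOn w (Icc a b)) (hq : MonotoneOn q (Icc a b)) :
    IntervalIntegrable (fun t => w t * q t) volume a b := by
  rw [← uIcc_of_le hab] at hw hq
  exact hq.intervalIntegrable.continuousOn_mul hw

/-- The weighted averages of a monotone function over adjacent intervals are ordered. -/
theorem integral_mul_integral_le_of_monotoneOn {w q : ℝ → ℝ} {a b c : ℝ} (hab : a ≤ b)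
    (hbc : b ≤ c) (hw : ContinuousOn w (Icc a c)) (hw0 : ∀ t ∈ Icc a c, 0 ≤ w t)
    (hq : MonotoneOn q (Icc a c)) :
    (∫ t in b..c, w t) * ∫ t in a..b, w t * q t ≤ (∫ t in a..b, w t) * ∫ t in b..c, w t * q t := by
  have s1 : Icc a b ⊆ Icc a c := Icc_subset_Icc_right hbc
  have s2 : Icc b c ⊆ Icc a c := Icc_subset_Icc_left hab
  have hb : b ∈ Icc a c := ⟨hab, hbc⟩
  have i1 : IntervalIntegrable w volume a b := (hw.mono s1).intervalIntegrable_of_Icc hab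
  have i2 : IntervalIntegrable w volume b c := (hw.mono s2).intervalIntegrable_of_Icc hbc
  have h1 : ∫ t in a..b, w t * q t ≤ (∫ t in a..b, w t) * q b := by
    rw [← intervalIntegral.integral_mul_const]
    refine intervalIntegral.integral_mono_on hab
      (intervalIntegrable_mul_monotoneOn hab (hw.mono s1) (hq.mono s1)) (i1.mul_const _)
      fun t ht => ?_
    exact mul_le_mul_of_nonneg_left (hq (s1 ht) hb ht.2) (hw0 t (s1 ht))
  have h2 : (∫ t in b..c, w t) * q b ≤ ∫ t in b..c, w t * q t := by
    rw [← intervalIntegral.integral_mul_const]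
    refine intervalIntegral.integral_mono_on hbc (i2.mul_const _)
      (intervalIntegrable_mul_monotoneOn hbc (hw.mono s2) (hq.mono s2)) fun t ht => ?_
    exact mul_le_mul_of_nonneg_left (hq hb (s2 ht) ht.1) (hw0 t (s2 ht))
  have k1 : 0 ≤ ∫ t in a..b, w t :=
    intervalIntegral.integral_nonneg hab fun t ht => hw0 t (s1 ht)
  have k2 : 0 ≤ ∫ t in b..c, w t :=
    intervalIntegral.integral_nonneg hbc fun t ht => hw0 t (s2 ht)
  calc (∫ t in b..c, w t) * ∫ t in a..b, w t * q t
      ≤ (∫ t in b..c, w t) * ((∫ t in a..b, w t) * q b) := mul_le_mul_of_nonneg_left h1 k2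
    _ = (∫ t in a..b, w t) * ((∫ t in b..c, w t) * q b) := by ring
    _ ≤ _ := mul_le_mul_of_nonneg_left h2 k1

theorem continuousOn_weight {a b : ℝ} (ha : 0 < a) :
    ContinuousOn (fun t : ℝ => (t ^ (d - 1))⁻¹) (Icc a b) :=
  (continuous_pow _).continuousOn.inv₀ fun _ ht => pow_ne_zero _ (ha.trans_le ht.1).ne'

theorem weight_nonneg {a b : ℝ} (ha : 0 < a) : ∀ t ∈ Icc a b, 0 ≤ (t ^ (d - 1))⁻¹ :=
  fun _ ht => inv_nonneg.2 (pow_nonneg (ha.trans_le ht.1).le _)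

/-- Supplies the increasing factor multiplying the weight `t^{1-d}` in the regularised increments.
-/
theorem monotoneOn_integral_ball {g : E d → ℝ} (hg : Continuous g) {c : ℝ}
    (hg0 : ∀ x ∈ ball (0 : E d) c, 0 ≤ g x) :
    MonotoneOn (fun t => ∫ x in ball (0 : E d) t, g x) (Iic c) := by
  intro s _ t ht hst
  have hi : IntegrableOn g (ball 0 t) :=
    (hg.continuousOn.integrableOn_compact (isCompact_closedBall 0 t)).mono_set
      ball_subset_closedBall
  refine setIntegral_mono_set hi ?_ (LE.le.eventuallyLE (ball_subset_ball hst))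
  filter_upwards [ae_restrict_mem measurableSet_ball] with x hx
  exact hg0 x (ball_subset_ball ht hx)

/-- Spherical means of a smooth function with `-g ≤ Δ f`. -/
theorem sphere_integral_add_eq (hd : 2 ≤ d) {f g : E d → ℝ} (hf : ContDiff ℝ 2 f)
    (hg : Continuous g) (hg0 : ∀ x, 0 ≤ g x) {a b : ℝ} (ha : 0 < a) (hab : a ≤ b) :
    ∫ ω, f (b • (ω : E d)) ∂surf d - ∫ ω, f (a • (ω : E d)) ∂surf d +
      ∫ t in a..b, (t ^ (d - 1))⁻¹ * ∫ x in ball (0 : E d) t, g x =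
      ∫ t in a..b, (t ^ (d - 1))⁻¹ * ∫ x in ball (0 : E d) t, ((Δ f) x + g x) := by
  rw [sphere_integral_sub_eq_flux hf, ← intervalIntegral.integral_add
    ((continuous_sphere_flux hf).intervalIntegrable _ _)
    (intervalIntegrable_mul_monotoneOn hab (continuousOn_weight ha)
      ((monotoneOn_integral_ball hg fun x _ => hg0 x).mono Icc_subset_Iic_self))]
  refine intervalIntegral.integral_congr fun t ht => ?_
  rw [uIcc_of_le hab] at ht
  have hi : ∀ {h : E d → ℝ}, Continuous h → IntegrableOn h (ball 0 t) := fun hh =>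
    (hh.continuousOn.integrableOn_compact (isCompact_closedBall 0 t)).mono_set
      ball_subset_closedBall
  rw [sphere_flux_eq_ball hd hf (ha.trans_le ht.1), integral_add (hi (continuous_laplacian hf))
    (hi hg), mul_add]

/-! ### Ball masses of regularised measures. -/

/-- The density of the regularisation of `τ` at scale `ε`. -/
def mollMeasure (ε : ℝ) (τ : Measure (E d)) (x : E d) : ℝ := ∫ y, eta ε (x - y) ∂τ

theorem mollMeasure_nonneg (ε : ℝ) (τ : Measure (E d)) (x : E d) : 0 ≤ mollMeasure ε τ x :=
  integral_nonneg fun _ => eta_nonneg ε _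

theorem integrable_eta_sub (ε : ℝ) (τ : Measure (E d)) [IsFiniteMeasure τ] (x : E d) :
    Integrable (fun y => eta ε (x - y)) τ := by
  obtain ⟨B, hB0, hB⟩ := exists_eta_le (d := d) ε
  refine Integrable.of_bound
    ((continuous_eta ε).comp (continuous_const.sub continuous_id)).aestronglyMeasurable B
    (Eventually.of_forall fun y => ?_)
  rw [Real.norm_of_nonneg (eta_nonneg ε _)]
  exact hB _

theorem continuous_mollMeasure (ε : ℝ) (τ : Measure (E d)) [IsFiniteMeasure τ] :
    Continuous (mollMeasure ε τ) := by
  obtain ⟨B, hB0, hB⟩ := exists_eta_le (d := d) ε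
  refine continuous_of_dominated (bound := fun _ => B) (fun x => (integrable_eta_sub ε τ x).1)
    (fun x => Eventually.of_forall fun y => ?_) (integrable_const B)
    (Eventually.of_forall fun y => (continuous_eta ε).comp (continuous_id.sub continuous_const))
  rw [Real.norm_of_nonneg (eta_nonneg ε _)]
  exact hB _

theorem integrable_eta_sub_right {ε : ℝ} (hε : 0 < ε) (y : E d) :
    Integrable fun x => eta ε (x - y) := (integrable_eta hε).comp_sub_right y

theorem integral_ball_mollMeasure {ε : ℝ} (τ : Measure (E d)) [IsFiniteMeasure τ] (t : ℝ) :
    ∫ x in ball (0 : E d) t, mollMeasure ε τ x =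
      ∫ y, (∫ x in ball (0 : E d) t, eta ε (x - y)) ∂τ := by
  obtain ⟨B, hB0, hB⟩ := exists_eta_le (d := d) ε
  have : IsFiniteMeasure ((volume : Measure (E d)).restrict (ball 0 t)) :=
    ⟨by rw [Measure.restrict_apply_univ]; exact measure_ball_lt_top⟩
  refine integral_integral_swap (f := fun x y => eta ε (x - y)) ?_
  refine Integrable.of_bound (C := B) ?_ (Eventually.of_forall fun p => ?_)
  · have : Continuous (Function.uncurry fun x y : E d => eta ε (x - y)) :=
      (continuous_eta ε).comp (continuous_fst.sub continuous_snd)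
    exact this.aestronglyMeasurable
  · rw [Function.uncurry, Real.norm_of_nonneg (eta_nonneg ε _)]
    exact hB _

theorem integral_ball_eta_nonneg (ε t : ℝ) (y : E d) :
    0 ≤ ∫ x in ball (0 : E d) t, eta ε (x - y) :=
  integral_nonneg fun _ => eta_nonneg ε _

theorem integral_ball_eta_le_one {ε : ℝ} (hε : 0 < ε) (t : ℝ) (y : E d) :
    ∫ x in ball (0 : E d) t, eta ε (x - y) ≤ 1 := by
  refine (setIntegral_le_integral (integrable_eta_sub_right hε y)
    (Eventually.of_forall fun x => eta_nonneg ε _)).trans ?_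
  rw [integral_sub_right_eq_self (eta ε : E d → ℝ) y, integral_eta hε]

theorem integral_ball_eta_eq_one {ε t : ℝ} (hε : 0 < ε) {y : E d} (hy : ‖y‖ + ε ≤ t) :
    ∫ x in ball (0 : E d) t, eta ε (x - y) = 1 := by
  rw [setIntegral_eq_integral_of_forall_compl_eq_zero, integral_sub_right_eq_self (eta ε : E d → ℝ) y,
    integral_eta hε]
  intro x hx
  rw [mem_ball_zero_iff, not_lt] at hx
  refine eta_eq_zero hε ?_
  linarith [norm_sub_norm_le x y]

theorem integral_ball_eta_eq_zero {ε t : ℝ} (hε : 0 < ε) {y : E d} (hy : t + ε ≤ ‖y‖) :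
    ∫ x in ball (0 : E d) t, eta ε (x - y) = 0 := by
  refine setIntegral_eq_zero_of_forall_eq_zero fun x hx => eta_eq_zero hε ?_
  rw [mem_ball_zero_iff] at hx
  rw [norm_sub_rev]
  linarith [norm_sub_norm_le y x]

theorem measurable_integral_ball_eta (ε t : ℝ) :
    StronglyMeasurable fun y : E d => ∫ x in ball (0 : E d) t, eta ε (x - y) := by
  have : Continuous (Function.uncurry fun y x : E d => eta ε (x - y)) :=
    (continuous_eta ε).comp (continuous_snd.sub continuous_fst)
  exact this.stronglyMeasurable.integral_prod_right

/-- By Fubini the mass is the `τ`-integral of a smoothed indicator of the ball. It takes values in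
`[0, 1]` and tends to the indicator off the sphere of radius `t`, which carries no mass by
hypothesis. -/
theorem tendsto_integral_ball_mollMeasure (τ : Measure (E d)) [IsFiniteMeasure τ] {t : ℝ}
    (ht : τ {y | ‖y‖ = t} = 0) :
    Tendsto (fun n => ∫ x in ball (0 : E d) t, mollMeasure (scale n) τ x) atTop
      (𝓝 (τ.real (closedBall 0 t))) := by
  have hlim : τ.real (closedBall 0 t) = ∫ y, (closedBall (0 : E d) t).indicator 1 y ∂τ := by
    rw [integral_indicator_one measurableSet_closedBall]
  simp only [integral_ball_mollMeasure, hlim]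
  refine tendsto_integral_of_dominated_convergence (fun _ => 1)
    (fun n => (measurable_integral_ball_eta _ t).aestronglyMeasurable) (integrable_const _)
    (fun n => Eventually.of_forall fun y => ?_) ?_
  · rw [Real.norm_of_nonneg (integral_ball_eta_nonneg _ _ _)]
    exact integral_ball_eta_le_one (scale_pos n) _ _
  · have hne : ∀ᵐ y ∂τ, ‖y‖ ≠ t := by
      rw [ae_iff]; simpa using ht
    filter_upwards [hne] with y hy
    refine tendsto_const_nhds.congr' ?_
    rcases lt_or_gt_of_ne hy with h | h
    · filter_upwards [eventually_scale_lt (sub_pos.2 h)] with n hn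
      rw [integral_ball_eta_eq_one (scale_pos n) (by linarith), indicator_of_mem (by simpa using h.le)]
      rfl
    · filter_upwards [eventually_scale_lt (sub_pos.2 h)] with n hn
      rw [integral_ball_eta_eq_zero (scale_pos n) (by linarith),
        indicator_of_notMem (by simpa using h)]

/-- Distinct centred spheres are disjoint, so only countably many can have positive mass under a
finite measure. -/
theorem ae_measure_norm_eq (τ : Measure (E d)) [IsFiniteMeasure τ] :
    ∀ᵐ t : ℝ, τ {y | ‖y‖ = t} = 0 := by
  have h := Measure.countable_meas_level_set_pos (μ := τ) (g := fun y : E d => ‖y‖) measurable_norm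
  filter_upwards [h.ae_notMem volume] with t ht
  simpa using ht

theorem tendsto_integral_weight_mollMeasure (τ : Measure (E d)) [IsFiniteMeasure τ] {a b : ℝ}
    (ha : 0 < a) (hab : a ≤ b) :
    Tendsto (fun n => ∫ t in a..b,
        (t ^ (d - 1))⁻¹ * ∫ x in ball (0 : E d) t, mollMeasure (scale n) τ x) atTop
      (𝓝 (∫ t in a..b, (t ^ (d - 1))⁻¹ * τ.real (closedBall 0 t))) := by
  refine intervalIntegral.tendsto_integral_filter_of_dominated_convergence
    (fun t => (t ^ (d - 1))⁻¹ * τ.real univ) (Eventually.of_forall fun n => ?_)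
    (Eventually.of_forall fun n => Eventually.of_forall fun t ht => ?_) ?_ ?_
  · rw [uIoc_of_le hab]
    exact ((intervalIntegrable_iff_integrableOn_Ioc_of_le hab).1
      (intervalIntegrable_mul_monotoneOn hab (continuousOn_weight ha)
        ((monotoneOn_integral_ball (continuous_mollMeasure _ τ)
          fun x _ => mollMeasure_nonneg _ _ x).mono Icc_subset_Iic_self))).aestronglyMeasurable
  · rw [uIoc_of_le hab] at ht
    have ht0 := ha.trans ht.1
    have hP0 : 0 ≤ ∫ x in ball (0 : E d) t, mollMeasure (scale n) τ x :=
      integral_nonneg fun x => mollMeasure_nonneg _ _ x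
    rw [Real.norm_of_nonneg (by positivity)]
    refine mul_le_mul_of_nonneg_left ?_ (by positivity)
    rw [integral_ball_mollMeasure]
    calc _ ≤ ∫ _, (1 : ℝ) ∂τ := by
          refine integral_mono ?_ (integrable_const _) fun y =>
            integral_ball_eta_le_one (scale_pos n) _ _
          refine Integrable.of_bound (measurable_integral_ball_eta _ t).aestronglyMeasurable 1
            (Eventually.of_forall fun y => ?_)
          rw [Real.norm_of_nonneg (integral_ball_eta_nonneg _ _ _)]
          exact integral_ball_eta_le_one (scale_pos n) _ _
      _ = _ := by simp
  · exact ((continuousOn_weight ha).intervalIntegrable_of_Icc hab).mul_const _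
  · filter_upwards [ae_measure_norm_eq τ] with t ht _
    exact (tendsto_integral_ball_mollMeasure τ ht).const_mul _

/-! ### The increments of the spherical integral of `U⁺`, by passage to the limit. -/

namespace DeltaSubharmonic

variable {ρ : ℝ≥0∞}

theorem isRieszMeasure_pos (hd : 2 ≤ d) (U : DeltaSubharmonic (eball (0 : E d) ρ)) :
    IsRieszMeasure (eball 0 ρ) U.pos (rieszMeasure (eball 0 ρ) U.pos) :=
  U.subharmonicOn_pos.isRieszMeasure_rieszMeasure hd U.pos_nontrivial

theorem isRieszMeasure_neg (hd : 2 ≤ d) (U : DeltaSubharmonic (eball (0 : E d) ρ)) :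
    IsRieszMeasure (eball 0 ρ) U.neg (rieszMeasure (eball 0 ρ) U.neg) :=
  U.subharmonicOn_neg.isRieszMeasure_rieszMeasure hd U.neg_nontrivial

theorem lowerVariation_closedBall_lt_top (hd : 2 ≤ d) (U : DeltaSubharmonic (eball (0 : E d) ρ))
    {R : ℝ} (hR : closedBall 0 R ⊆ eball (0 : E d) ρ) : U.lowerVariation (closedBall 0 R) < ⊤ :=
  (Measure.sub_le _).trans_lt
    ((U.isRieszMeasure_neg hd).lt_top_of_isCompact _ (isCompact_closedBall 0 R) hR)

/-- The smooth approximation of the positive part of `U` inside the ball of radius `R`. -/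
def smoothPos {Ω : Set (E d)} (U : DeltaSubharmonic Ω) (R : ℝ) (n : ℕ) (x : E d) : ℝ :=
  posApprox (scale n) (moll (scale n) (trunc U.pos R) x - moll (scale n) (trunc U.neg R) x)

/-- The integral of `U⁺` over the sphere of radius `t`, pulled back to the unit sphere. -/
def spherePos {Ω : Set (E d)} (U : DeltaSubharmonic Ω) (t : ℝ) : ℝ :=
  ∫ ω : sphere (0 : E d) 1,
    max 0 ((U.pos (t • (ω : E d))).toReal - (U.neg (t • (ω : E d))).toReal) ∂surf d

/-- The increment over `[a, b]` of the spherical integral of `U⁺`, plus the mass term. -/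
def increment {Ω : Set (E d)} (U : DeltaSubharmonic Ω)
    (a b : ℝ) : ℝ :=
  U.spherePos b - U.spherePos a + sphereArea d * dHat d *
    ∫ t in a..b, (t ^ (d - 1))⁻¹ * U.lowerVariation.real (closedBall 0 t)

theorem integrable_trunc_pos (hd : 2 ≤ d) (U : DeltaSubharmonic (eball (0 : E d) ρ)) {R : ℝ}
    (hR : closedBall 0 R ⊆ eball (0 : E d) ρ) : Integrable (trunc U.pos R) :=
  U.subharmonicOn_pos.integrable_trunc hd isOpen_eball (convex_eball _ _).isPreconnected
    U.pos_nontrivial hR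

theorem integrable_trunc_neg (hd : 2 ≤ d) (U : DeltaSubharmonic (eball (0 : E d) ρ)) {R : ℝ}
    (hR : closedBall 0 R ⊆ eball (0 : E d) ρ) : Integrable (trunc U.neg R) :=
  U.subharmonicOn_neg.integrable_trunc hd isOpen_eball (convex_eball _ _).isPreconnected
    U.neg_nontrivial hR

theorem contDiff_smoothPos (hd : 2 ≤ d) (U : DeltaSubharmonic (eball (0 : E d) ρ)) {R : ℝ}
    (hR : closedBall 0 R ⊆ eball (0 : E d) ρ) (n : ℕ) : ContDiff ℝ 2 (U.smoothPos R n) :=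
  (contDiff_posApprox (scale_pos n)).comp
    ((contDiff_two_moll (scale_pos n) (U.integrable_trunc_pos hd hR).locallyIntegrable).sub
      (contDiff_two_moll (scale_pos n) (U.integrable_trunc_neg hd hR).locallyIntegrable))

theorem sphere_integrable_pos (hd : 2 ≤ d) (U : DeltaSubharmonic (eball (0 : E d) ρ)) {R : ℝ}
    (hR : closedBall 0 R ⊆ eball (0 : E d) ρ) {r : ℝ} (hr : 0 < r) (hrR : r < R) :
    (∀ᵐ ω : sphere (0 : E d) 1 ∂surf d, U.pos (r • (ω : E d)) = (U.pos (r • (ω : E d))).toReal) ∧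
    Integrable (fun ω : sphere (0 : E d) 1 => (U.pos (r • (ω : E d))).toReal) (surf d) :=
  U.subharmonicOn_pos.sphere_integrable hd isOpen_eball (convex_eball _ _).isPreconnected
    U.pos_nontrivial hR hr hrR

theorem sphere_integrable_neg (hd : 2 ≤ d) (U : DeltaSubharmonic (eball (0 : E d) ρ)) {R : ℝ}
    (hR : closedBall 0 R ⊆ eball (0 : E d) ρ) {r : ℝ} (hr : 0 < r) (hrR : r < R) :
    (∀ᵐ ω : sphere (0 : E d) 1 ∂surf d, U.neg (r • (ω : E d)) = (U.neg (r • (ω : E d))).toReal) ∧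
    Integrable (fun ω : sphere (0 : E d) 1 => (U.neg (r • (ω : E d))).toReal) (surf d) :=
  U.subharmonicOn_neg.sphere_integrable hd isOpen_eball (convex_eball _ _).isPreconnected
    U.neg_nontrivial hR hr hrR

theorem integrable_spherePos (hd : 2 ≤ d) (U : DeltaSubharmonic (eball (0 : E d) ρ)) {R : ℝ}
    (hR : closedBall 0 R ⊆ eball (0 : E d) ρ) {r : ℝ} (hr : 0 < r) (hrR : r < R) :
    Integrable (fun ω : sphere (0 : E d) 1 =>
      max 0 ((U.pos (r • (ω : E d))).toReal - (U.neg (r • (ω : E d))).toReal)) (surf d) := by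
  have := ((U.sphere_integrable_pos hd hR hr hrR).2.sub (U.sphere_integrable_neg hd hR hr hrR).2)
  simpa only [max_comm, Pi.sub_apply] using this.pos_part

/-- The positive part is 1-Lipschitz and its smooth version is uniformly within `scale n` of it, so
the error is at most `scale n` plus the two `L¹` errors of the regularisations on the sphere. -/
theorem tendsto_sphere_smoothPos (hd : 2 ≤ d) (U : DeltaSubharmonic (eball (0 : E d) ρ)) {R : ℝ}
    (hR : closedBall 0 R ⊆ eball (0 : E d) ρ) {r : ℝ} (hr : 0 < r) (hrR : r < R) :
    Tendsto (fun n => ∫ ω : sphere (0 : E d) 1, U.smoothPos R n (r • (ω : E d)) ∂surf d) atTop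
      (𝓝 (U.spherePos r)) := by
  have h1 := U.subharmonicOn_pos.tendsto_sphere_moll hd isOpen_eball
    (convex_eball _ _).isPreconnected U.pos_nontrivial hR hr hrR
  have h2 := U.subharmonicOn_neg.tendsto_sphere_moll hd isOpen_eball
    (convex_eball _ _).isPreconnected U.neg_nontrivial hR hr hrR
  have h3 : Tendsto (fun n => scale n * (surf d).real univ) atTop (𝓝 0) := by
    have := (tendsto_one_div_add_atTop_nhds_zero_nat (𝕜 := ℝ)).mul_const ((surf d).real univ)
    rwa [zero_mul] at this
  have h4 := (h3.add h1).add h2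
  simp only [add_zero] at h4
  rw [tendsto_iff_norm_sub_tendsto_zero]
  refine squeeze_zero (fun _ => norm_nonneg _) (fun n => ?_) h4
  have c1 := integrable_sphere_comp (contDiff_two_moll (scale_pos n)
    (U.integrable_trunc_pos hd hR).locallyIntegrable).continuous r
  have c2 := integrable_sphere_comp (contDiff_two_moll (scale_pos n)
    (U.integrable_trunc_neg hd hR).locallyIntegrable).continuous r
  have i1 := (c1.sub (U.sphere_integrable_pos hd hR hr hrR).2).abs
  have i2 := (c2.sub (U.sphere_integrable_neg hd hR hr hrR).2).abs
  have i0 : Integrable (fun _ : sphere (0 : E d) 1 => scale n) (surf d) := integrable_const _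
  rw [spherePos, ← integral_sub
    (integrable_sphere_comp (U.contDiff_smoothPos hd hR n).continuous r)
    (U.integrable_spherePos hd hR hr hrR)]
  refine (norm_integral_le_integral_norm _).trans ?_
  have hc : scale n * (surf d).real univ = ∫ _ : sphere (0 : E d) 1, scale n ∂surf d := by
    simp [mul_comm]
  rw [hc]
  have e1 := integral_add i0 i1
  have e2 := integral_add (i0.add i1) i2
  simp only [Pi.add_apply, Pi.sub_apply] at e1 e2
  rw [← e1, ← e2]
  refine integral_mono_ae ((integrable_sphere_comp (U.contDiff_smoothPos hd hR n).continuous r).sub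
    (U.integrable_spherePos hd hR hr hrR)).norm ((i0.add i1).add i2)
    (Eventually.of_forall fun ω => ?_)
  simp only [smoothPos, Real.norm_eq_abs]
  set A := moll (scale n) (trunc U.pos R) (r • (ω : E d))
  set B := moll (scale n) (trunc U.neg R) (r • (ω : E d))
  set a := (U.pos (r • (ω : E d))).toReal
  set b := (U.neg (r • (ω : E d))).toReal
  have k1 := abs_posApprox_sub_le (scale_pos n) (A - B)
  have k2 : |max 0 (A - B) - max 0 (a - b)| ≤ |(A - B) - (a - b)| := by
    simpa using abs_max_sub_max_le_max 0 (A - B) 0 (a - b)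
  have k3 : |(A - B) - (a - b)| ≤ |A - a| + |B - b| := by
    have : (A - B) - (a - b) = (A - a) - (B - b) := by ring
    rw [this]; exact abs_sub _ _
  have k4 := abs_sub_le (posApprox (scale n) (A - B)) (max 0 (A - B)) (max 0 (a - b))
  linarith

/-- The Laplacian of the regularised `U⁺` is bounded below by the regularised lower variation. -/
theorem laplacian_smoothPos_ge (hd : 2 ≤ d) (U : DeltaSubharmonic (eball (0 : E d) ρ)) {R : ℝ}
    (hR : closedBall 0 R ⊆ eball (0 : E d) ρ) (n : ℕ) {x : E d} (hx : ‖x‖ + scale n ≤ R) :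
    -(sphereArea d * dHat d *
      mollMeasure (scale n) (U.lowerVariation.restrict (closedBall 0 R)) x) ≤
      (Δ (U.smoothPos R n)) x := by
  set μ := rieszMeasure (eball 0 ρ) U.pos with hμ
  set ν := rieszMeasure (eball 0 ρ) U.neg with hν
  set K := closedBall (0 : E d) R with hK
  have hc : 0 ≤ sphereArea d * dHat d :=
    mul_nonneg (sphereArea_pos hd).le (zero_le_one.trans (le_max_left _ _))
  have fμ : IsFiniteMeasure (μ.restrict K) := ⟨by
    rw [Measure.restrict_apply_univ]
    exact (U.isRieszMeasure_pos hd).lt_top_of_isCompact _ (isCompact_closedBall 0 R) hR⟩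
  have fν : IsFiniteMeasure (ν.restrict K) := ⟨by
    rw [Measure.restrict_apply_univ]
    exact (U.isRieszMeasure_neg hd).lt_top_of_isCompact _ (isCompact_closedBall 0 R) hR⟩
  have fτ : IsFiniteMeasure (U.lowerVariation.restrict K) := ⟨by
    rw [Measure.restrict_apply_univ]
    exact U.lowerVariation_closedBall_lt_top hd hR⟩
  have hle : ν.restrict K ≤ U.lowerVariation.restrict K + μ.restrict K := by
    rw [lowerVariation, Measure.restrict_sub_eq_restrict_sub_restrict measurableSet_closedBall]
    exact measure_le_sub_add _ _
  -- The bump about `x` vanishes outside `K`, so every measure may be restricted to `K`. There the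
  -- Riesz measures are finite, as `measure_le_sub_add` requires.
  have hres : ∀ κ : Measure (E d), ∫ y, eta (scale n) (x - y) ∂κ =
      ∫ y, eta (scale n) (x - y) ∂(κ.restrict K) := by
    intro κ
    refine (setIntegral_eq_integral_of_forall_compl_eq_zero fun y hy => ?_).symm
    rw [hK, mem_closedBall_zero_iff, not_le] at hy
    refine eta_eq_zero (scale_pos n) ?_
    rw [norm_sub_rev]
    linarith [norm_sub_norm_le y x]
  have hmono : ∫ y, eta (scale n) (x - y) ∂(ν.restrict K) ≤
      ∫ y, eta (scale n) (x - y) ∂(U.lowerVariation.restrict K) +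
        ∫ y, eta (scale n) (x - y) ∂(μ.restrict K) := by
    rw [← integral_add_measure (integrable_eta_sub _ _ x) (integrable_eta_sub _ _ x)]
    exact integral_mono_measure hle (Eventually.of_forall fun y => eta_nonneg _ _)
      (integrable_eta_sub _ _ x)
  have c1 := contDiff_two_moll (scale_pos n) (U.integrable_trunc_pos hd hR).locallyIntegrable
  have c2 := contDiff_two_moll (scale_pos n) (U.integrable_trunc_neg hd hR).locallyIntegrable
  refine laplacian_posApprox_ge (scale_pos n) (c1.sub c2)
    (mul_nonneg hc (mollMeasure_nonneg _ _ _)) ?_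
  have hsub : (Δ fun x => moll (scale n) (trunc U.pos R) x - moll (scale n) (trunc U.neg R) x) x =
      (Δ (moll (scale n) (trunc U.pos R))) x - (Δ (moll (scale n) (trunc U.neg R))) x :=
    c1.contDiffAt.laplacian_sub c2.contDiffAt
  rw [hsub, laplacian_moll_eq (U.isRieszMeasure_pos hd) (scale_pos n) hR
    (U.integrable_trunc_pos hd hR) hx, laplacian_moll_eq (U.isRieszMeasure_neg hd) (scale_pos n) hR
    (U.integrable_trunc_neg hd hR) hx, ← mul_sub, neg_mul_eq_mul_neg, hres, hres (rieszMeasure _ _)]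
  refine mul_le_mul_of_nonneg_left ?_ hc
  rw [mollMeasure]
  linarith

/-- Both claims are closed inequalities that hold for the regularised increments at all small
scales, where the integrand is `t^{1-d}` times a nonnegative increasing function. The radius `R > c`
leaves room for regularisation. -/
theorem increment_nonneg_and_mul_le (hd : 2 ≤ d) (U : DeltaSubharmonic (eball (0 : E d) ρ)) {R : ℝ}
    (hR : closedBall 0 R ⊆ eball (0 : E d) ρ) {a b c : ℝ} (ha : 0 < a) (hab : a ≤ b) (hbc : b ≤ c)
    (hcR : c < R) :
    0 ≤ U.increment a b ∧
    (∫ t in b..c, (t ^ (d - 1))⁻¹) * U.increment a b ≤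
      (∫ t in a..b, (t ^ (d - 1))⁻¹) * U.increment b c := by
  set K := closedBall (0 : E d) R with hK
  set τ := U.lowerVariation.restrict K with hτ
  set C := sphereArea d * dHat d with hC
  have hc : 0 ≤ C :=
    mul_nonneg (sphereArea_pos hd).le (zero_le_one.trans (le_max_left _ _))
  have fτ : IsFiniteMeasure τ := ⟨by
    rw [hτ, Measure.restrict_apply_univ]
    exact U.lowerVariation_closedBall_lt_top hd hR⟩
  have hb : 0 < b := ha.trans_le hab
  have hτeq : ∀ t ≤ R, τ.real (closedBall 0 t) = U.lowerVariation.real (closedBall 0 t) := by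
    intro t ht
    rw [hτ, measureReal_restrict_apply measurableSet_closedBall,
      inter_eq_left.2 (closedBall_subset_closedBall ht)]
  set X : ℕ → ℝ → ℝ → ℝ := fun n a b =>
    ∫ ω, U.smoothPos R n (b • (ω : E d)) ∂surf d - ∫ ω, U.smoothPos R n (a • (ω : E d)) ∂surf d +
      ∫ t in a..b, (t ^ (d - 1))⁻¹ * ∫ x in ball (0 : E d) t, C * mollMeasure (scale n) τ x with hX
  have hlim : ∀ {a b : ℝ}, 0 < a → a ≤ b → b < R →
      Tendsto (fun n => X n a b) atTop (𝓝 (U.increment a b)) := by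
    intro a b ha hab hbR
    have h1 := tendsto_integral_weight_mollMeasure τ ha hab
    have e1 : ∫ t in a..b, (t ^ (d - 1))⁻¹ * τ.real (closedBall 0 t) =
        ∫ t in a..b, (t ^ (d - 1))⁻¹ * U.lowerVariation.real (closedBall 0 t) := by
      refine intervalIntegral.integral_congr fun t ht => ?_
      rw [uIcc_of_le hab] at ht
      simp only [hτeq t (ht.2.trans hbR.le)]
    rw [e1] at h1
    refine (((U.tendsto_sphere_smoothPos hd hR (ha.trans_le hab) hbR).sub
      (U.tendsto_sphere_smoothPos hd hR ha (hab.trans_lt hbR))).add (h1.const_mul C)).congr fun n => ?_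
    rw [hX]
    simp only [integral_const_mul]
    rw [← intervalIntegral.integral_const_mul]
    congr 1
    refine intervalIntegral.integral_congr fun t _ => ?_
    ring
  have hev : ∀ᶠ n in atTop, 0 ≤ X n a b ∧ (∫ t in b..c, (t ^ (d - 1))⁻¹) * X n a b ≤
      (∫ t in a..b, (t ^ (d - 1))⁻¹) * X n b c := by
    filter_upwards [eventually_scale_lt (sub_pos.2 hcR)] with n hn
    have hg : Continuous fun x => C * mollMeasure (scale n) τ x :=
      continuous_const.mul (continuous_mollMeasure _ τ)
    have hg0 : ∀ x, 0 ≤ C * mollMeasure (scale n) τ x := fun x =>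
      mul_nonneg hc (mollMeasure_nonneg _ _ x)
    have hf := U.contDiff_smoothPos hd hR n
    -- Here `scale n < R - c`, so the Laplacian bound is available on all of `ball 0 c`.
    have hpos : ∀ x ∈ ball (0 : E d) c,
        0 ≤ (Δ (U.smoothPos R n)) x + C * mollMeasure (scale n) τ x := by
      intro x hx
      rw [mem_ball_zero_iff] at hx
      have := U.laplacian_smoothPos_ge hd hR n (x := x) (by linarith)
      linarith
    have hmono := monotoneOn_integral_ball ((continuous_laplacian hf).add hg) hpos
    have eX : ∀ {a b : ℝ}, 0 < a → a ≤ b → X n a b = ∫ t in a..b, (t ^ (d - 1))⁻¹ *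
        ∫ x in ball (0 : E d) t, ((Δ (U.smoothPos R n)) x + C * mollMeasure (scale n) τ x) :=
      fun ha hab => sphere_integral_add_eq hd hf hg hg0 ha hab
    rw [eX ha hab, eX hb hbc]
    constructor
    · refine intervalIntegral.integral_nonneg hab fun t ht => ?_
      refine mul_nonneg (weight_nonneg ha t ht) (setIntegral_nonneg measurableSet_ball fun x hx => ?_)
      exact hpos x (ball_subset_ball (ht.2.trans hbc) hx)
    · exact integral_mul_integral_le_of_monotoneOn hab hbc (continuousOn_weight ha)
        (weight_nonneg ha) (hmono.mono Icc_subset_Iic_self)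
  exact ⟨ge_of_tendsto (hlim ha hab (hbc.trans_lt hcR)) (hev.mono fun n h => h.1),
    le_of_tendsto_of_tendsto ((hlim ha hab (hbc.trans_lt hcR)).const_mul _)
      ((hlim hb hbc hcR).const_mul _) (hev.mono fun n h => h.2)⟩

end DeltaSubharmonic

/-! ### Convexity with respect to the kernel. -/

/-- The derivative is the weight of the spherical means and of the counting function, up to the
constant. This makes the kernel the natural variable. -/
theorem hasDerivAt_kernel (hd : 2 ≤ d) {t : ℝ} (ht : 0 < t) :
    HasDerivAt (kernel d) (dHat d * (t ^ (d - 1))⁻¹) t := by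
  rcases hd.eq_or_lt with rfl | h
  · have e : kernel 2 = Real.log := by ext s; simp [kernel]
    rw [e]
    convert Real.hasDerivAt_log ht.ne' using 1
    simp [dHat]
  · obtain ⟨m, rfl⟩ : ∃ m, d = m + 3 := ⟨d - 3, by omega⟩
    have e : kernel (m + 3) = fun s : ℝ => -(s ^ (m + 1))⁻¹ := by
      ext s
      have h2 : m + 3 - 2 = m + 1 := by omega
      simp [kernel, h2]
    rw [e]
    refine ((hasDerivAt_pow (m + 1) t).inv (pow_pos ht _).ne').neg.congr_deriv ?_
    have h3 : dHat (m + 3) = m + 1 := by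
      rw [dHat, max_eq_right]
      · push_cast; ring
      · push_cast
        have : (0 : ℝ) ≤ m := Nat.cast_nonneg m
        linarith
    have h4 : m + 3 - 1 = m + 2 := by omega
    rw [h3, h4]
    field_simp
    push_cast
    ring

theorem dHat_pos (d : ℕ) : 0 < dHat d := zero_lt_one.trans_le (le_max_left _ _)

theorem strictMonoOn_kernel (hd : 2 ≤ d) : StrictMonoOn (kernel d) (Ioi 0) := by
  refine strictMonoOn_of_deriv_pos (convex_Ioi 0)
    (fun t ht => (hasDerivAt_kernel hd ht).continuousAt.continuousWithinAt) fun t ht => ?_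
  rw [interior_Ioi] at ht
  rw [(hasDerivAt_kernel hd ht).deriv]
  exact mul_pos (dHat_pos d) (inv_pos.2 (pow_pos ht _))

theorem kernel_sub (hd : 2 ≤ d) {a b : ℝ} (ha : 0 < a) (hab : a ≤ b) :
    kernel d b - kernel d a = dHat d * ∫ t in a..b, (t ^ (d - 1))⁻¹ := by
  rw [← intervalIntegral.integral_const_mul]
  refine (intervalIntegral.integral_eq_sub_of_hasDerivAt (fun t ht => ?_) ?_).symm
  · rw [uIcc_of_le hab] at ht
    exact hasDerivAt_kernel hd (ha.trans_le ht.1)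
  · exact ((continuousOn_weight ha).intervalIntegrable_of_Icc hab).const_mul _

theorem convex_kernel_image (hd : 2 ≤ d) {I : Set ℝ} (hI : I.OrdConnected) (hI0 : I ⊆ Ioi 0) :
    Convex ℝ (kernel d '' I) :=
  Real.convex_iff_isPreconnected.2 (hI.isPreconnected.image _ fun _ ht =>
    (hasDerivAt_kernel hd (hI0 ht)).continuousAt.continuousWithinAt)

/-- The three-point criterion for convexity with respect to the kernel. -/
theorem convexOn_comp_invFunOn_kernel (hd : 2 ≤ d) {I : Set ℝ} (hI : I.OrdConnected)
    (hI0 : I ⊆ Ioi 0) {f : ℝ → ℝ}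
    (h : ∀ a ∈ I, ∀ b ∈ I, ∀ c ∈ I, a < b → b < c →
      (∫ t in b..c, (t ^ (d - 1))⁻¹) * (f b - f a) ≤
        (∫ t in a..b, (t ^ (d - 1))⁻¹) * (f c - f b)) :
    ConvexOn ℝ (kernel d '' I) (f ∘ Function.invFunOn (kernel d) I) := by
  have hmono : StrictMonoOn (kernel d) I := (strictMonoOn_kernel hd).mono hI0
  have hinv : ∀ a ∈ I, Function.invFunOn (kernel d) I (kernel d a) = a := fun a ha =>
    hmono.injOn.leftInvOn_invFunOn ha
  have hconv := convex_kernel_image hd hI hI0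
  -- In the variable `kernel d t`, differences of abscissae are integrals of the weight, so the
  -- hypothesis is the comparison of adjacent slopes with denominators cleared.
  refine convexOn_of_slope_mono_adjacent hconv fun {x y z} hx hz hxy hyz => ?_
  have hy : y ∈ kernel d '' I := hconv.ordConnected.out hx hz ⟨hxy.le, hyz.le⟩
  obtain ⟨a, ha, rfl⟩ := hx
  obtain ⟨b, hb, rfl⟩ := hy
  obtain ⟨c, hc, rfl⟩ := hz
  have hab := (hmono.lt_iff_lt ha hb).1 hxy
  have hbc := (hmono.lt_iff_lt hb hc).1 hyz
  simp only [Function.comp_apply, hinv a ha, hinv b hb, hinv c hc]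
  rw [div_le_div_iff₀ (sub_pos.2 hxy) (sub_pos.2 hyz), kernel_sub hd (hI0 ha) hab.le,
    kernel_sub hd (hI0 hb) hbc.le]
  have := mul_le_mul_of_nonneg_left (h a ha b hb c hc hab hbc) (dHat_pos d).le
  linarith

/-! ### The characteristic in real terms. -/

theorem countingN_add (μ : Measure (E d)) {r a R : ℝ} (hra : r ≤ a) (haR : a ≤ R) :
    countingN μ r R = countingN μ r a + countingN μ a R := by
  rw [countingN, countingN, countingN, ← mul_add, ← lintegral_union measurableSet_Ioc
    (Ioc_disjoint_Ioc_of_le le_rfl), Ioc_union_Ioc_eq_Ioc hra haR]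

theorem exists_closedBall_subset_eball {ρ : ℝ≥0∞} {R : ℝ} (hR : ENNReal.ofReal R < ρ) :
    ∃ R', R < R' ∧ closedBall (0 : E d) R' ⊆ eball 0 ρ := by
  obtain ⟨q, h1, h2⟩ := ENNReal.lt_iff_exists_nnreal_btwn.1 hR
  refine ⟨q, ?_, closedBall_subset_eball (by rwa [ENNReal.ofReal_coe_nnreal])⟩
  by_contra h
  exact absurd h1 (not_lt.2 (by
    rw [← ENNReal.ofReal_coe_nnreal]; exact ENNReal.ofReal_le_ofReal (not_lt.1 h)))

namespace DeltaSubharmonic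

variable {ρ : ℝ≥0∞}

/-- The mean of `U⁺` over the sphere of radius `R`, as a real number. -/
def meanPos {Ω : Set (E d)} (U : DeltaSubharmonic Ω) (R : ℝ) : ℝ :=
  (sphereArea d)⁻¹ * U.spherePos R

/-- The counting function of the lower variation, as a real number. -/
def realN {Ω : Set (E d)} (U : DeltaSubharmonic Ω) (r R : ℝ) : ℝ :=
  dHat d * ∫ t in r..R, (t ^ (d - 1))⁻¹ * U.lowerVariation.real (closedBall 0 t)

variable (U : DeltaSubharmonic (eball (0 : E d) ρ)) {R : ℝ}

theorem increment_eq (hd : 2 ≤ d) (a b : ℝ) :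
    U.increment a b = sphereArea d * (U.meanPos b - U.meanPos a + U.realN a b) := by
  have := (sphereArea_pos hd).ne'
  rw [increment, meanPos, meanPos, realN]
  field_simp

theorem meanPos_nonneg (hd : 2 ≤ d) : 0 ≤ U.meanPos R :=
  mul_nonneg (inv_nonneg.2 (sphereArea_pos hd).le) (integral_nonneg fun _ => le_max_left _ _)

/-- Both subharmonic functions are finite almost everywhere on the sphere, so the conventional value
of `⊥ - ⊥` plays no role. -/
theorem sphereMean_eq_meanPos (hd : 2 ≤ d) (hR0 : 0 < R) (hR : ENNReal.ofReal R < ρ) :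
    sphereMean (fun x => max 0 (U.val x)) 0 R = (U.meanPos R : EReal) := by
  obtain ⟨R', hRR', hR'⟩ := exists_closedBall_subset_eball (d := d) hR
  have h := extIntegral_eq_integral (U.integrable_spherePos hd hR' hR0 hRR')
    (f := fun ω : sphere (0 : E d) 1 => max 0 (U.val (0 + R • (ω : E d)))) (by
      filter_upwards [(U.sphere_integrable_pos hd hR' hR0 hRR').1,
        (U.sphere_integrable_neg hd hR' hR0 hRR').1] with ω h1 h2
      rw [zero_add, val, h1, h2, ← EReal.coe_sub, ← EReal.coe_zero,
        ← EReal.coe_strictMono.monotone.map_max, EReal.toReal_coe, EReal.toReal_coe])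
  rw [sphereMean, h, ← EReal.coe_mul]
  rfl

theorem monotoneOn_lowerVariation (hd : 2 ≤ d) (hR : ENNReal.ofReal R < ρ) :
    MonotoneOn (fun t => U.lowerVariation.real (closedBall (0 : E d) t)) (Iic R) := by
  intro s _ t ht hst
  refine measureReal_mono (closedBall_subset_closedBall hst) (ne_of_lt ?_)
  exact U.lowerVariation_closedBall_lt_top hd
    (closedBall_subset_eball ((ENNReal.ofReal_le_ofReal ht).trans_lt hR))

theorem intervalIntegrable_weight_lowerVariation (hd : 2 ≤ d) {r : ℝ} (hr : 0 < r) (hrR : r ≤ R)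
    (hR : ENNReal.ofReal R < ρ) :
    IntervalIntegrable (fun t => (t ^ (d - 1))⁻¹ * U.lowerVariation.real (closedBall (0 : E d) t))
      volume r R :=
  intervalIntegrable_mul_monotoneOn hrR (continuousOn_weight hr)
    ((U.monotoneOn_lowerVariation hd hR).mono Icc_subset_Iic_self)

theorem realN_nonneg {r : ℝ} (hr : 0 < r) (hrR : r ≤ R) : 0 ≤ U.realN r R :=
  mul_nonneg (dHat_pos d).le (intervalIntegral.integral_nonneg hrR fun t ht =>
    mul_nonneg (weight_nonneg hr t ht) measureReal_nonneg)

theorem realN_add (hd : 2 ≤ d) {a b c : ℝ} (ha : 0 < a) (hab : a ≤ b) (hbc : b ≤ c)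
    (hc : ENNReal.ofReal c < ρ) : U.realN a b + U.realN b c = U.realN a c := by
  rw [realN, realN, realN, ← mul_add, intervalIntegral.integral_add_adjacent_intervals
    (U.intervalIntegrable_weight_lowerVariation hd ha hab
      ((ENNReal.ofReal_le_ofReal hbc).trans_lt hc))
    (U.intervalIntegrable_weight_lowerVariation hd (ha.trans_le hab) hbc hc)]

theorem countingN_eq_realN (hd : 2 ≤ d) {r : ℝ} (hr : 0 < r) (hrR : r ≤ R)
    (hR : ENNReal.ofReal R < ρ) :
    countingN U.lowerVariation r R = ENNReal.ofReal (U.realN r R) := by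
  rw [countingN, realN, ENNReal.ofReal_mul (dHat_pos d).le, intervalIntegral.integral_of_le hrR,
    ofReal_integral_eq_lintegral_ofReal
      ((intervalIntegrable_iff_integrableOn_Ioc_of_le hrR).1
        (U.intervalIntegrable_weight_lowerVariation hd hr hrR hR))]
  · congr 1
    refine setLIntegral_congr_fun measurableSet_Ioc fun t ht => ?_
    have ht0 : 0 < t ^ (d - 1) := pow_pos (hr.trans ht.1) _
    have hfin := U.lowerVariation_closedBall_lt_top hd
      (closedBall_subset_eball ((ENNReal.ofReal_le_ofReal ht.2).trans_lt hR))
    rw [ENNReal.ofReal_mul (inv_nonneg.2 ht0.le), ENNReal.ofReal_inv_of_pos ht0,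
      ofReal_measureReal hfin.ne, div_eq_mul_inv, mul_comm]
  · filter_upwards [ae_restrict_mem measurableSet_Ioc] with t ht
    exact mul_nonneg (weight_nonneg hr t (Ioc_subset_Icc_self ht)) measureReal_nonneg

/-- Splitting at a positive radius `a` isolates the only possibly infinite piece, the counting
integral over `(r, a]`, which does not depend on `R`. -/
theorem nevanlinnaT_eq (hd : 2 ≤ d) {r a : ℝ} (hra : r ≤ a) (ha : 0 < a) (haR : a ≤ R)
    (hR : ENNReal.ofReal R < ρ) :
    nevanlinnaT U r R = (U.meanPos R : EReal) +
      ((countingN U.lowerVariation r a + ENNReal.ofReal (U.realN a R) : ℝ≥0∞) : EReal) := by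
  rw [nevanlinnaT, U.sphereMean_eq_meanPos hd (ha.trans_le haR) hR, countingN_add _ hra haR,
    U.countingN_eq_realN hd ha haR hR]

theorem nevanlinnaT_eq_coe (hd : 2 ≤ d) {r a : ℝ} (hra : r ≤ a) (ha : 0 < a) (haR : a ≤ R)
    (hR : ENNReal.ofReal R < ρ) (hfin : countingN U.lowerVariation r a ≠ ⊤) :
    nevanlinnaT U r R =
      ((U.meanPos R + ((countingN U.lowerVariation r a).toReal + U.realN a R) : ℝ) : EReal) := by
  rw [U.nevanlinnaT_eq hd hra ha haR hR, ← ENNReal.ofReal_toReal hfin,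
    ← ENNReal.ofReal_add ENNReal.toReal_nonneg (U.realN_nonneg ha haR),
    EReal.coe_ennreal_ofReal, max_eq_left (add_nonneg ENNReal.toReal_nonneg (U.realN_nonneg ha haR)),
    ENNReal.toReal_ofReal ENNReal.toReal_nonneg, ← EReal.coe_add]

theorem nevanlinnaT_eq_top_iff (hd : 2 ≤ d) {r : ℝ} (hr : 0 ≤ r) (hrR : r < R)
    (hR : ENNReal.ofReal R < ρ) :
    nevanlinnaT U r R = ⊤ ↔ countingN U.lowerVariation r R = ⊤ := by
  rw [nevanlinnaT, U.sphereMean_eq_meanPos hd (hr.trans_lt hrR) hR]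
  constructor
  · intro h
    by_contra hne
    rw [← ENNReal.ofReal_toReal hne, EReal.coe_ennreal_ofReal, ← EReal.coe_add] at h
    exact EReal.coe_ne_top _ h
  · intro h
    rw [h]
    simp

theorem countingN_ne_top (hd : 2 ≤ d) {r : ℝ} (hr : 0 < r) (hrR : r ≤ R)
    (hR : ENNReal.ofReal R < ρ) : countingN U.lowerVariation r R ≠ ⊤ := by
  rw [U.countingN_eq_realN hd hr hrR hR]
  exact ENNReal.ofReal_ne_top

/-- The integral between two positive radii below `ρ` is finite, so finiteness for one upper limit
gives it for all. This is the all-or-nothing alternative at `r = 0`; `a` itself may exceed `ρ`. -/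
theorem countingN_ne_top_of_ne_top (hd : 2 ≤ d) {r a b : ℝ} (hr : 0 ≤ r) (hra : r < a) (hrb : r < b)
    (hb : ENNReal.ofReal b < ρ) (h : countingN U.lowerVariation r a ≠ ⊤) :
    countingN U.lowerVariation r b ≠ ⊤ := by
  rcases le_total a b with hab | hba
  · rw [countingN_add _ hra.le hab]
    exact ENNReal.add_ne_top.2 ⟨h, U.countingN_ne_top hd (hr.trans_lt hra) hab hb⟩
  · rw [countingN_add _ hrb.le hba] at h
    exact (ENNReal.add_ne_top.1 h).1

theorem increment_nonneg (hd : 2 ≤ d) {a b : ℝ} (ha : 0 < a) (hab : a ≤ b)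
    (hb : ENNReal.ofReal b < ρ) : 0 ≤ U.meanPos b - U.meanPos a + U.realN a b := by
  obtain ⟨R', hbR', hR'⟩ := exists_closedBall_subset_eball (d := d) hb
  have h := (U.increment_nonneg_and_mul_le hd hR' ha hab le_rfl hbR').1
  rw [U.increment_eq hd] at h
  exact nonneg_of_mul_nonneg_right h (sphereArea_pos hd)

theorem mul_increment_le (hd : 2 ≤ d) {a b c : ℝ} (ha : 0 < a) (hab : a ≤ b) (hbc : b ≤ c)
    (hc : ENNReal.ofReal c < ρ) :
    (∫ t in b..c, (t ^ (d - 1))⁻¹) * (U.meanPos b - U.meanPos a + U.realN a b) ≤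
      (∫ t in a..b, (t ^ (d - 1))⁻¹) * (U.meanPos c - U.meanPos b + U.realN b c) := by
  obtain ⟨R', hcR', hR'⟩ := exists_closedBall_subset_eball (d := d) hc
  have h := (U.increment_nonneg_and_mul_le hd hR' ha hab hbc hcR').2
  rw [U.increment_eq hd, U.increment_eq hd, mul_left_comm, mul_left_comm _ (sphereArea d)] at h
  exact le_of_mul_le_mul_left h (sphereArea_pos hd)

theorem monotoneOn_nevanlinnaT (hd : 2 ≤ d) {r : ℝ} (hr : 0 ≤ r) :
    MonotoneOn (fun R => nevanlinnaT U r R) {R : ℝ | r < R ∧ ENNReal.ofReal R < ρ} := by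
  intro a ha b hb hab
  have ha0 := hr.trans_lt ha.1
  simp only
  by_cases hfin : countingN U.lowerVariation r a = ⊤
  · have htop : countingN U.lowerVariation r b = ⊤ := by
      rw [countingN_add _ ha.1.le hab, hfin, top_add]
    rw [(U.nevanlinnaT_eq_top_iff hd hr hb.1 hb.2).2 htop]
    exact le_top
  · have e : U.realN a a = 0 := by simp [realN]
    rw [U.nevanlinnaT_eq_coe hd ha.1.le ha0 le_rfl ha.2 hfin,
      U.nevanlinnaT_eq_coe hd ha.1.le ha0 hab hb.2 hfin, EReal.coe_le_coe_iff, e]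
    linarith [U.increment_nonneg hd ha0 hab hb.2]

/-- The common contribution of `(r, a]` cancels, which leaves an increment independent of `r`; one
three-point inequality therefore serves every `r`, including `r = 0`. -/
theorem toReal_nevanlinnaT_sub (hd : 2 ≤ d) {r a b : ℝ} (hr : 0 ≤ r) (hra : r < a) (hab : a ≤ b)
    (hb : ENNReal.ofReal b < ρ) (hfin : countingN U.lowerVariation r a ≠ ⊤) :
    (nevanlinnaT U r b).toReal - (nevanlinnaT U r a).toReal =
      U.meanPos b - U.meanPos a + U.realN a b := by
  have e : U.realN a a = 0 := by simp [realN]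
  have ha0 := hr.trans_lt hra
  rw [U.nevanlinnaT_eq_coe hd hra.le ha0 le_rfl ((ENNReal.ofReal_le_ofReal hab).trans_lt hb) hfin,
    U.nevanlinnaT_eq_coe hd hra.le ha0 hab hb hfin, EReal.toReal_coe, EReal.toReal_coe, e]
  ring

theorem convexWrt_nevanlinnaT (hd : 2 ≤ d) {r : ℝ} (hr : 0 ≤ r)
    (hfin : ∀ R : ℝ, r < R → ENNReal.ofReal R < ρ → countingN U.lowerVariation r R ≠ ⊤) :
    ConvexWrt (kernel d) {R : ℝ | r < R ∧ ENNReal.ofReal R < ρ}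
      (fun R => (nevanlinnaT U r R).toReal) := by
  have hI : OrdConnected {R : ℝ | r < R ∧ ENNReal.ofReal R < ρ} :=
    ⟨fun a ha b hb t ht =>
      ⟨ha.1.trans_le ht.1, (ENNReal.ofReal_le_ofReal ht.2).trans_lt hb.2⟩⟩
  refine convexOn_comp_invFunOn_kernel hd hI (fun a ha => hr.trans_lt ha.1)
    fun a ha b hb c hc hab hbc => ?_
  rw [U.toReal_nevanlinnaT_sub hd hr ha.1 hab.le hb.2 (hfin a ha.1 ha.2),
    U.toReal_nevanlinnaT_sub hd hr hb.1 hbc.le hc.2 (hfin b hb.1 hb.2)]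
  exact U.mul_increment_le hd (hr.trans_lt ha.1) hab.le hbc.le hc.2

/-- The negative of the characteristic has increments `realN a b`, the integral of the weight
against the increasing mass of balls, so it is convex in the kernel variable. -/
theorem concaveWrt_nevanlinnaT (hd : 2 ≤ d) (hR : ENNReal.ofReal R < ρ) :
    ConcaveWrt (kernel d) (Ioo 0 R) (fun r => (nevanlinnaT U r R).toReal) := by
  have hsub : ∀ {a b : ℝ}, 0 < a → a ≤ b → b < R →
      -(nevanlinnaT U b R).toReal - -(nevanlinnaT U a R).toReal = U.realN a b := by
    intro a b ha hab hbR
    have e : ∀ r, 0 < r → r < R → (nevanlinnaT U r R).toReal = U.meanPos R + U.realN r R := by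
      intro r hr hrR
      have h0 : countingN U.lowerVariation r r = 0 := by simp [countingN]
      rw [U.nevanlinnaT_eq_coe hd le_rfl hr hrR.le hR (by rw [h0]; exact ENNReal.zero_ne_top),
        EReal.toReal_coe, h0]
      simp
    rw [e a ha (hab.trans_lt hbR), e b (ha.trans_le hab) hbR,
      ← U.realN_add hd ha hab hbR.le hR]
    ring
  have h := convexOn_comp_invFunOn_kernel hd (I := Ioo 0 R) ordConnected_Ioo (fun a ha => ha.1)
    (f := fun r => -(nevanlinnaT U r R).toReal) fun a ha b hb c hc hab hbc => by
      rw [hsub ha.1 hab.le hb.2, hsub hb.1 hbc.le hc.2, realN, realN, mul_left_comm,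
        mul_left_comm _ (dHat d)]
      refine mul_le_mul_of_nonneg_left ?_ (dHat_pos d).le
      exact integral_mul_integral_le_of_monotoneOn hab.le hbc.le (continuousOn_weight ha.1)
        (weight_nonneg ha.1) ((U.monotoneOn_lowerVariation hd hR).mono
          fun t ht => ht.2.trans hc.2.le)
  exact neg_convexOn_iff.1 h

end DeltaSubharmonic

end

end DiffNevanlinna

/-! ### The theorem. -/

theorem mainTheorem2 (d : ℕ) (hd : 2 ≤ d) (ρ : ℝ≥0∞)
    (U : DiffNevanlinna.DeltaSubharmonic (Metric.eball (0 : DiffNevanlinna.E d) ρ)) :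
    -- positivity, and finiteness for `r > 0`
    (∀ r R : ℝ, 0 ≤ r → r < R → ENNReal.ofReal R < ρ →
      0 ≤ DiffNevanlinna.nevanlinnaT U r R ∧
      (0 < r → DiffNevanlinna.nevanlinnaT U r R ≠ ⊤)) ∧
    -- in the second variable: increasing, and convex with respect to the kernel
    -- (for `r = 0` the characteristic may be identically `+∞`)
    (∀ r : ℝ, 0 ≤ r →
      MonotoneOn (fun R => DiffNevanlinna.nevanlinnaT U r R)
        {R : ℝ | r < R ∧ ENNReal.ofReal R < ρ} ∧
      ((r = 0 ∧ ∀ R : ℝ, r < R → ENNReal.ofReal R < ρ →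
          DiffNevanlinna.nevanlinnaT U r R = ⊤) ∨
        ((∀ R : ℝ, r < R → ENNReal.ofReal R < ρ → DiffNevanlinna.nevanlinnaT U r R ≠ ⊤) ∧
          DiffNevanlinna.ConvexWrt (DiffNevanlinna.kernel d)
            {R : ℝ | r < R ∧ ENNReal.ofReal R < ρ}
            (fun R => (DiffNevanlinna.nevanlinnaT U r R).toReal)))) ∧
    -- in the first variable: decreasing, and concave with respect to the kernel
    (∀ R : ℝ, 0 < R → ENNReal.ofReal R < ρ →
      AntitoneOn (fun r => DiffNevanlinna.nevanlinnaT U r R) (Set.Ico 0 R) ∧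
      DiffNevanlinna.ConcaveWrt (DiffNevanlinna.kernel d) (Set.Ioo 0 R)
        (fun r => (DiffNevanlinna.nevanlinnaT U r R).toReal)) := by
  refine ⟨fun r R hr hrR hR => ⟨?_, fun hr0 => ?_⟩, fun r hr => ⟨U.monotoneOn_nevanlinnaT hd hr, ?_⟩,
    fun R hR0 hR => ⟨?_, U.concaveWrt_nevanlinnaT hd hR⟩⟩
  · rw [DiffNevanlinna.nevanlinnaT, U.sphereMean_eq_meanPos hd (hr.trans_lt hrR) hR]
    exact add_nonneg (EReal.coe_nonneg.2 (U.meanPos_nonneg hd)) (EReal.coe_ennreal_nonneg _)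
  · rw [Ne, U.nevanlinnaT_eq_top_iff hd hr hrR hR]
    exact U.countingN_ne_top hd hr0 hrR.le hR
  · by_cases h : ∃ a, r < a ∧ DiffNevanlinna.countingN U.lowerVariation r a ≠ ⊤
    · obtain ⟨a, hra, ha⟩ := h
      have hfin : ∀ R : ℝ, r < R → ENNReal.ofReal R < ρ →
          DiffNevanlinna.countingN U.lowerVariation r R ≠ ⊤ := fun R hrR hR =>
        U.countingN_ne_top_of_ne_top hd hr hra hrR hR ha
      exact Or.inr ⟨fun R hrR hR => by
        rw [Ne, U.nevanlinnaT_eq_top_iff hd hr hrR hR]; exact hfin R hrR hR,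
        U.convexWrt_nevanlinnaT hd hr hfin⟩
    · push Not at h
      rcases hr.eq_or_lt with rfl | hr0
      · exact Or.inl ⟨rfl, fun R hrR hR => (U.nevanlinnaT_eq_top_iff hd le_rfl hrR hR).2 (h R hrR)⟩
      · have hfin : ∀ R : ℝ, r < R → ENNReal.ofReal R < ρ →
            DiffNevanlinna.countingN U.lowerVariation r R ≠ ⊤ := fun R hrR hR =>
          U.countingN_ne_top hd hr0 hrR.le hR
        -- For `r > 0` the counting function is finite at every admissible `R`, so an everywhere
        -- infinite one means that no admissible `R` exists and the claim is vacuous.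
        exact Or.inr ⟨fun R hrR hR => absurd (h R hrR) (hfin R hrR hR),
          U.convexWrt_nevanlinnaT hd hr hfin⟩
  · intro r _ s _ hrs
    refine add_le_add le_rfl (EReal.coe_ennreal_le_coe_ennreal_iff.2 ?_)
    exact mul_le_mul_right (MeasureTheory.lintegral_mono_set (Set.Ioc_subset_Ioc_left hrs)) _
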